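/- **Setting.** Let $\mathcal B$ be a unital complex $*$-algebra. A $*$-algebra over $\mathcal B$ is a (not necessarily unital) complex $*$-algebra $\mathcal A$ that is a $\mathcal B$-$\mathcal B$-bimodule with $(ba)a'=b(aa')$, $(ab)a'=a(ba')$, $a(a'b)=(aa')b$, $(ba)^*=a^*b^*$; unital $*$-algebras containing $\mathcal B$ as a unital $*$-subalgebra are examples. Then $\mathcal B\oplus\mathcal A$ is a unital $*$-algebra containing $\mathcal B$. A conditional expectation on $\mathcal A$ is a $\mathcal B$-$\mathcal B$-bimodule map $\Phi\colon\mathcal A\to\mathcal B$ such that $\widetilde\Phi(b+a)=b+\Phi(a)$ is completely positive on $\mathcal B\oplus\mathcal A$, i.e. for all $x_1,\dots,x_n\in\mathcal B\oplus\mathcal A$ there are finitely many $c_{ki}\in\mathcal B$ with $\widetilde\Phi(x_i^*x_j)=\sum_k c_{ki}^*c_{kj}$ for all $i,j$. (If $\mathcal B$ is a $C^*$-algebra, this is the same as positivity.) Let $\mathcal A_1\sqcup\mathcal A_2$ be the coproduct of $*$-algebras over $\mathcal B$ (the non-unital free product, spanned by alternating words). A *conditional independence* is a prescription which, for every $\mathcal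 B$ and all conditional expectations $\Phi_i\colon\mathcal A_i\to\mathcal B$ ($i=1,2$), yields a conditional expectation $\Phi_1\odot\Phi_2$ on $\mathcal A_1\sqcup\mathcal A_2$ such that 1. $(\Phi_1\odot\Phi_2)|_{\mathcal A_i}=\Phi_i$; 2. $(\Phi_1\odot\Phi_2)\odot\Phi_3=\Phi_1\odot(\Phi_2\odot\Phi_3)$ under the canonical isomorphism of the coproducts; 3. it is natural: if $\beta\colon\mathcal B\to\mathcal B'$ is a unital $*$-homomorphism and $f_i\colon\mathcal A_i\to\mathcal A_i'$ are $*$-homomorphisms with $f_i(bab')=\beta(b)f_i(a)\beta(b')$ (and likewise for the two one-sided actions) and $\Phi_i'\circ f_i=\beta\circ\Phi_i$, then $(\Phi_1'\odot\Phi_2')\circ(f_1\sqcup f_2)=\beta\circ(\Phi_1\odot\Phi_2)$. It is *symmetric* if $\Phi_1\odot\Phi_2=\Phi_2\odot\Phi_1$ under $\mathcal A_1\sqcup\mathcal A_2\cong\mathcal A_2\sqcup\mathcal A_1$; its *opposite* is $(\Phi_1,\Phi_2)\mapsto\Phi_2\odot\Phi_1$. It is *unital* if, whenever $\mathcal A_1,\mathcal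 A_2$ have units $e_1,e_2$ with $\Phi_i(e_i)=\mathbf 1$, the conditional expectation $\Phi_1\odot\Phi_2$ respects the identification of $e_1$ and $e_2$ with $\mathbf 1$ (it factors through the unital free product of $\mathcal A_1$ and $\mathcal A_2$ with amalgamation over $\mathcal B$). Write $\Phi$ for $\Phi_1\odot\Phi_2$, extended to $\mathcal B\oplus(\mathcal A_1\sqcup\mathcal A_2)$ by $\mathrm{id}_{\mathcal B}$, and extend each $\Phi_i$ to $\mathcal B\oplus\mathcal A_i$ likewise. The independence is * *conditional free independence* if $\Phi(x_1\cdots x_n)=0$ for $n\ge1$ whenever the $x_j$ are taken alternatingly from $\mathcal B\oplus\mathcal A_1$ and $\mathcal B\oplus\mathcal A_2$ with $\Phi(x_j)=0$ for all $j$; * *conditional boolean independence* if $\Phi(a_1\cdots a_n)=\Phi(a_1)\cdots\Phi(a_n)$ for $n\ge1$ and $a_j$ taken alternatingly from $\mathcal A_1$ and $\mathcal A_2$; * *conditional monotone independence* if $\Phi(x_0y_1x_1\cdots y_nx_n)=\Phi_1(x_0)\,\Phi_2\bigl(y_1\Phi_1(x_1)y_2\Phi_1(x_2)\cdots y_n\bigr)\,\Phi_1(x_n)$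 for $n\ge1$, $x_j\in\mathcal B\oplus\mathcal A_1$, $y_j\in\mathcal A_2$. **Theorem.** There is exactly one unital conditional independence, namely conditional free independence; it is automatically symmetric. There is exactly one non-unital symmetric conditional independence, namely conditional boolean independence. Up to passage to the opposite (exchange of the order of the two factors) there is exactly one non-symmetric conditional independence, namely conditional monotone independence: the non-symmetric conditional independences are precisely conditional monotone independence and its opposite. Every non-symmetric conditional independence is non-unital. -/

import Mathlib

universe u

namespace CondProb

open scoped RightActions

/-!
Throughout, the base `B` is a unital complex `*`-algebra, given by the instances
`[Ring B] [StarRing B] [Algebra ℂ B] [StarModule ℂ B]`.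
`b • a` is the left action of `B` and `a <• b` is the right action of `B`.
-/

/-- A (not necessarily unital) `*`-algebra over `B`: a complex `*`-algebra which is a
`B`-`B`-bimodule in such a way that multiplication and involution are compatible with the
two actions. A unital `*`-algebra that contains `B` as a unital `*`-subalgebra is an
example. -/
structure BAlg (B : Type u) [Ring B] [StarRing B] [Algebra ℂ B] where
  carrier : Type u
  [ring : NonUnitalRing carrier]
  [starRing : StarRing carrier]
  [left : Module B carrier]
  [right : Module Bᵐᵒᵖ carrier]
  smul_op_smul : ∀ (b b' : B) (a : carrier), (b • a) <• b' = b • (a <• b')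
  smul_mul : ∀ (b : B) (a a' : carrier), (b • a) * a' = b • (a * a')
  mul_op_smul : ∀ (b : B) (a a' : carrier), a * (a' <• b) = (a * a') <• b
  op_smul_mul : ∀ (b : B) (a a' : carrier), (a <• b) * a' = a * (b • a')
  star_smul : ∀ (b : B) (a : carrier), star (b • a) = star a <• star b
  complex_smul : ∀ (z : ℂ) (a : carrier), algebraMap ℂ B z • a = a <• algebraMap ℂ B z

instance {B : Type u} [Ring B] [StarRing B] [Algebra ℂ B] :
    CoeSort (BAlg B) (Type u) := ⟨BAlg.carrier⟩

attribute [instance] BAlg.ring BAlg.starRing BAlg.left BAlg.right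

section Base

variable {B : Type u} [Ring B] [StarRing B] [Algebra ℂ B]

/-- `*`-homomorphisms of `*`-algebras over `B`. -/
structure Hom (A D : BAlg B) where
  toFun : A → D
  map_add : ∀ a a', toFun (a + a') = toFun a + toFun a'
  map_mul : ∀ a a', toFun (a * a') = toFun a * toFun a'
  map_star : ∀ a, toFun (star a) = star (toFun a)
  map_smul : ∀ (b : B) a, toFun (b • a) = b • toFun a
  map_op_smul : ∀ (b : B) a, toFun (a <• b) = toFun a <• b

instance (A D : BAlg B) : CoeFun (Hom A D) (fun _ => A → D) := ⟨Hom.toFun⟩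

/-- Composition of homomorphisms. -/
def Hom.comp {A D E : BAlg B} (g : Hom D E) (f : Hom A D) : Hom A E where
  toFun a := g (f a)
  map_add a a' := by rw [f.map_add, g.map_add]
  map_mul a a' := by rw [f.map_mul, g.map_mul]
  map_star a := by rw [f.map_star, g.map_star]
  map_smul b a := by rw [f.map_smul, g.map_smul]
  map_op_smul b a := by rw [f.map_op_smul, g.map_op_smul]

/-! ### The unitization `B ⊕ A` -/

/-- The unital `*`-algebra `B ⊕ A`, containing `B` as a unital `*`-subalgebra. -/
def Uni (A : BAlg B) : Type u := B × A

namespace Uni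

variable {A : BAlg B}

/-- The embedding of `B` into `B ⊕ A`. -/
def ofB (b : B) : Uni A := (b, 0)

/-- The embedding of `A` into `B ⊕ A`. -/
def ofA (a : A) : Uni A := (0, a)

instance : AddCommGroup (Uni A) := inferInstanceAs (AddCommGroup (B × A))

instance : Mul (Uni A) :=
  ⟨fun x y => (x.1 * y.1, x.1 • y.2 + x.2 <• y.1 + x.2 * y.2)⟩

instance : One (Uni A) := ⟨ofB 1⟩

instance : Star (Uni A) := ⟨fun x => (star x.1, star x.2)⟩

theorem star_op_smul (b : B) (a : A) : star (a <• b) = star b • star a := by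
  have h := A.star_smul (star b) (star a)
  rw [star_star, star_star] at h
  rw [← h, star_star]

@[simp] theorem add_fst (x y : Uni A) : (x + y).1 = x.1 + y.1 := rfl
@[simp] theorem add_snd (x y : Uni A) : (x + y).2 = x.2 + y.2 := rfl
@[simp] theorem zero_fst : (0 : Uni A).1 = 0 := rfl
@[simp] theorem zero_snd : (0 : Uni A).2 = 0 := rfl
@[simp] theorem one_fst : (1 : Uni A).1 = 1 := rfl
@[simp] theorem one_snd : (1 : Uni A).2 = 0 := rfl
@[simp] theorem mul_fst (x y : Uni A) : (x * y).1 = x.1 * y.1 := rfl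
@[simp] theorem mul_snd (x y : Uni A) :
    (x * y).2 = x.1 • y.2 + x.2 <• y.1 + x.2 * y.2 := rfl
@[simp] theorem star_fst (x : Uni A) : (star x).1 = star x.1 := rfl
@[simp] theorem star_snd (x : Uni A) : (star x).2 = star x.2 := rfl

instance : Ring (Uni A) :=
  { (inferInstance : AddCommGroup (Uni A)), (inferInstance : Mul (Uni A)),
    (inferInstance : One (Uni A)) with
    left_distrib := fun x y z => by
      apply Prod.ext
      · simp [mul_add]
      · simp [mul_add, smul_add, add_smul]; abel
    right_distrib := fun x y z => by
      apply Prod.ext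
      · simp [add_mul]
      · simp [add_mul, smul_add, add_smul]; abel
    zero_mul := fun x => by apply Prod.ext <;> simp
    mul_zero := fun x => by apply Prod.ext <;> simp
    one_mul := fun x => by apply Prod.ext <;> simp
    mul_one := fun x => by apply Prod.ext <;> simp
    mul_assoc := fun x y z => by
      apply Prod.ext
      · simp [mul_assoc]
      · simp [smul_add, add_mul, mul_add, mul_smul, A.smul_op_smul, A.smul_mul,
          A.mul_op_smul, A.op_smul_mul, mul_assoc]
        abel }

instance : StarRing (Uni A) where
  star_involutive x := by apply Prod.ext <;> simp
  star_mul x y := by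
    apply Prod.ext
    · simp
    · simp [A.star_smul, star_op_smul]; abel
  star_add x y := by apply Prod.ext <;> simp

/-- The unital extension `B ⊕ A → B ⊕ D` of a homomorphism `A → D`. -/
def map {A D : BAlg B} (f : Hom A D) (x : Uni A) : Uni D := (x.1, f x.2)

end Uni

/-! ### Conditional expectations -/

/-- A (`B`-valued) conditional expectation on a `*`-algebra `A` over `B`: a `B`-`B`-bimodule
map `φ : A → B` whose extension `b + a ↦ b + φ a` to `B ⊕ A`, a map onto `B` that is the
identity on `B`, is completely positive, i.e. for all `x₁, …, xₙ` in `B ⊕ A` the matrix with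
entries `φ (xᵢ* xⱼ)` is a finite sum of matrices with entries `cᵢ* cⱼ`.
If `B` is a `C*`-algebra then positivity and complete positivity are the same thing for such
maps. -/
structure Expectation (A : BAlg B) where
  toFun : A → B
  map_add : ∀ a a', toFun (a + a') = toFun a + toFun a'
  map_smul : ∀ (b : B) a, toFun (b • a) = b * toFun a
  map_op_smul : ∀ (b : B) a, toFun (a <• b) = toFun a * b
  positive : ∀ (n : ℕ) (x : Fin n → Uni A), ∃ (m : ℕ) (c : Fin m → Fin n → B), ∀ i j,
    (star (x i) * x j).1 + toFun (star (x i) * x j).2 = ∑ k, star (c k i) * c k j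

instance (A : BAlg B) : CoeFun (Expectation A) (fun _ => A → B) := ⟨Expectation.toFun⟩

/-- The extension of a conditional expectation from `A` to `B ⊕ A`. -/
def Expectation.ext {A : BAlg B} (φ : Expectation A) (x : Uni A) : B := x.1 + φ x.2

/-! ### The coproduct (non-unital free product over `B`) -/

/-- Formal `*`-algebra expressions in elements of `A₁` and `A₂` with coefficients in `B`. -/
inductive Term (A₁ A₂ : BAlg B) : Type u
  | inl (a : A₁)
  | inr (a : A₂)
  | zero
  | add (s t : Term A₁ A₂)
  | neg (s : Term A₁ A₂)
  | mul (s t : Term A₁ A₂)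
  | star (s : Term A₁ A₂)
  | smul (b : B) (s : Term A₁ A₂)
  | opSMul (b : B) (s : Term A₁ A₂)

/-- The value of an expression in a `*`-algebra over `B` into which `A₁` and `A₂` are mapped. -/
def Term.eval {A₁ A₂ D : BAlg B} (f : Hom A₁ D) (g : Hom A₂ D) : Term A₁ A₂ → D
  | inl a => f a
  | inr a => g a
  | zero => 0
  | add s t => s.eval f g + t.eval f g
  | neg s => - s.eval f g
  | mul s t => s.eval f g * t.eval f g
  | star s => Star.star (s.eval f g)
  | smul b s => b • s.eval f g
  | opSMul b s => s.eval f g <• b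

/-- Two expressions are identified if they have the same value in all `*`-algebras over `B`
into which `A₁` and `A₂` are mapped. -/
def termSetoid (A₁ A₂ : BAlg B) : Setoid (Term A₁ A₂) where
  r s t := ∀ (D : BAlg B) (f : Hom A₁ D) (g : Hom A₂ D), s.eval f g = t.eval f g
  iseqv :=
    { refl := fun _ _ _ _ => rfl
      symm := fun h D f g => (h D f g).symm
      trans := fun h h' D f g => (h D f g).trans (h' D f g) }

/-- The underlying set of the coproduct. -/
def CoprodCarrier (A₁ A₂ : BAlg B) : Type u := Quotient (termSetoid A₁ A₂)

namespace CoprodCarrier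

variable {A₁ A₂ : BAlg B}

/-- The class of an expression. -/
def mk (s : Term A₁ A₂) : CoprodCarrier A₁ A₂ := Quotient.mk (termSetoid A₁ A₂) s

/-- The value of a class of expressions. -/
def eval {D : BAlg B} (f : Hom A₁ D) (g : Hom A₂ D) (x : CoprodCarrier A₁ A₂) : D :=
  Quotient.lift (s := termSetoid A₁ A₂) (fun s => s.eval f g) (fun _ _ h => h D f g) x

theorem ext {x y : CoprodCarrier A₁ A₂}
    (h : ∀ (D : BAlg B) (f : Hom A₁ D) (g : Hom A₂ D), eval f g x = eval f g y) : x = y := by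
  induction x using Quotient.inductionOn
  induction y using Quotient.inductionOn
  exact Quotient.sound h

instance : Zero (CoprodCarrier A₁ A₂) := ⟨mk .zero⟩
instance : Add (CoprodCarrier A₁ A₂) :=
  ⟨Quotient.map₂ Term.add fun _ _ h _ _ h' D f g =>
    congrArg₂ (· + ·) (h D f g) (h' D f g)⟩
instance : Neg (CoprodCarrier A₁ A₂) :=
  ⟨Quotient.map Term.neg fun _ _ h D f g => congrArg (- ·) (h D f g)⟩
instance : Mul (CoprodCarrier A₁ A₂) :=
  ⟨Quotient.map₂ Term.mul fun _ _ h _ _ h' D f g =>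
    congrArg₂ (· * ·) (h D f g) (h' D f g)⟩
instance : Star (CoprodCarrier A₁ A₂) :=
  ⟨Quotient.map Term.star fun _ _ h D f g => congrArg Star.star (h D f g)⟩
instance : SMul B (CoprodCarrier A₁ A₂) :=
  ⟨fun b => Quotient.map (Term.smul b) fun _ _ h D f g => congrArg (b • ·) (h D f g)⟩
instance : SMul Bᵐᵒᵖ (CoprodCarrier A₁ A₂) :=
  ⟨fun b => Quotient.map (Term.opSMul b.unop) fun _ _ h D f g =>
    congrArg (· <• b.unop) (h D f g)⟩

section eval

variable {D : BAlg B} (f : Hom A₁ D) (g : Hom A₂ D)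

@[simp] theorem eval_inl (a : A₁) : eval f g (mk (.inl a)) = f a := rfl
@[simp] theorem eval_inr (a : A₂) : eval f g (mk (.inr a)) = g a := rfl
@[simp] theorem eval_zero : eval f g 0 = 0 := rfl
@[simp] theorem eval_add (x y : CoprodCarrier A₁ A₂) :
    eval f g (x + y) = eval f g x + eval f g y := by
  induction x using Quotient.inductionOn
  induction y using Quotient.inductionOn
  rfl
@[simp] theorem eval_neg (x : CoprodCarrier A₁ A₂) : eval f g (-x) = -eval f g x := by
  induction x using Quotient.inductionOn
  rfl
@[simp] theorem eval_mul (x y : CoprodCarrier A₁ A₂) :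
    eval f g (x * y) = eval f g x * eval f g y := by
  induction x using Quotient.inductionOn
  induction y using Quotient.inductionOn
  rfl
@[simp] theorem eval_star (x : CoprodCarrier A₁ A₂) :
    eval f g (star x) = star (eval f g x) := by
  induction x using Quotient.inductionOn
  rfl
@[simp] theorem eval_smul (b : B) (x : CoprodCarrier A₁ A₂) :
    eval f g (b • x) = b • eval f g x := by
  induction x using Quotient.inductionOn
  rfl
@[simp] theorem eval_op_smul (b : Bᵐᵒᵖ) (x : CoprodCarrier A₁ A₂) :
    eval f g (b • x) = b • eval f g x := by
  induction x using Quotient.inductionOn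
  rfl

end eval

instance : NonUnitalRing (CoprodCarrier A₁ A₂) where
  add_assoc x y z := ext fun D f g => by simp [add_assoc]
  zero_add x := ext fun D f g => by simp
  add_zero x := ext fun D f g => by simp
  nsmul := nsmulRec
  zsmul := zsmulRec
  neg_add_cancel x := ext fun D f g => by simp
  add_comm x y := ext fun D f g => by simp [add_comm]
  left_distrib x y z := ext fun D f g => by simp [mul_add]
  right_distrib x y z := ext fun D f g => by simp [add_mul]
  zero_mul x := ext fun D f g => by simp
  mul_zero x := ext fun D f g => by simp
  mul_assoc x y z := ext fun D f g => by simp [mul_assoc]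

instance : StarRing (CoprodCarrier A₁ A₂) where
  star_involutive x := ext fun D f g => by simp
  star_mul x y := ext fun D f g => by simp
  star_add x y := ext fun D f g => by simp

instance : Module B (CoprodCarrier A₁ A₂) where
  one_smul x := ext fun D f g => by simp
  mul_smul b b' x := ext fun D f g => by simp [mul_smul]
  smul_zero b := ext fun D f g => by simp
  smul_add b x y := ext fun D f g => by simp [smul_add]
  add_smul b b' x := ext fun D f g => by simp [add_smul]
  zero_smul x := ext fun D f g => by simp

instance : Module Bᵐᵒᵖ (CoprodCarrier A₁ A₂) where
  one_smul x := ext fun D f g => by simp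
  mul_smul b b' x := ext fun D f g => by simp [mul_smul]
  smul_zero b := ext fun D f g => by simp
  smul_add b x y := ext fun D f g => by simp [smul_add]
  add_smul b b' x := ext fun D f g => by simp [add_smul]
  zero_smul x := ext fun D f g => by simp

end CoprodCarrier

/-- The coproduct `A₁ ⊔ A₂` of two `*`-algebras over `B`, i.e. their non-unital free product
with amalgamation of the actions of `B`, spanned by the alternating words. It is determined by
the universal property expressed by `inl`, `inr`, `lift`. -/
def coprod (A₁ A₂ : BAlg B) : BAlg B where
  carrier := CoprodCarrier A₁ A₂
  smul_op_smul b b' x := CoprodCarrier.ext fun D f g => by simp [D.smul_op_smul]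
  smul_mul b x y := CoprodCarrier.ext fun D f g => by simp [D.smul_mul]
  mul_op_smul b x y := CoprodCarrier.ext fun D f g => by simp [D.mul_op_smul]
  op_smul_mul b x y := CoprodCarrier.ext fun D f g => by simp [D.op_smul_mul]
  star_smul b x := CoprodCarrier.ext fun D f g => by simp [D.star_smul]
  complex_smul z x := CoprodCarrier.ext fun D f g => by simp [D.complex_smul]

/-- The first inclusion `A₁ → A₁ ⊔ A₂`. -/
def inl (A₁ A₂ : BAlg B) : Hom A₁ (coprod A₁ A₂) where
  toFun a := CoprodCarrier.mk (.inl a)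
  map_add a a' := Quotient.sound fun _ f _ => f.map_add a a'
  map_mul a a' := Quotient.sound fun _ f _ => f.map_mul a a'
  map_star a := Quotient.sound fun _ f _ => f.map_star a
  map_smul b a := Quotient.sound fun _ f _ => f.map_smul b a
  map_op_smul b a := Quotient.sound fun _ f _ => f.map_op_smul b a

/-- The second inclusion `A₂ → A₁ ⊔ A₂`. -/
def inr (A₁ A₂ : BAlg B) : Hom A₂ (coprod A₁ A₂) where
  toFun a := CoprodCarrier.mk (.inr a)
  map_add a a' := Quotient.sound fun _ _ g => g.map_add a a'
  map_mul a a' := Quotient.sound fun _ _ g => g.map_mul a a'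
  map_star a := Quotient.sound fun _ _ g => g.map_star a
  map_smul b a := Quotient.sound fun _ _ g => g.map_smul b a
  map_op_smul b a := Quotient.sound fun _ _ g => g.map_op_smul b a

/-- The homomorphism on `A₁ ⊔ A₂` that extends `f` and `g`. -/
def lift {A₁ A₂ D : BAlg B} (f : Hom A₁ D) (g : Hom A₂ D) : Hom (coprod A₁ A₂) D where
  toFun := CoprodCarrier.eval f g
  map_add := CoprodCarrier.eval_add f g
  map_mul := CoprodCarrier.eval_mul f g
  map_star := CoprodCarrier.eval_star f g
  map_smul := CoprodCarrier.eval_smul f g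
  map_op_smul b := CoprodCarrier.eval_op_smul f g (MulOpposite.op b)

/-- The canonical isomorphism `A₁ ⊔ A₂ → A₂ ⊔ A₁`. -/
def swap (A₁ A₂ : BAlg B) : Hom (coprod A₁ A₂) (coprod A₂ A₁) :=
  lift (inr A₂ A₁) (inl A₂ A₁)

/-- The canonical isomorphism `(A₁ ⊔ A₂) ⊔ A₃ → A₁ ⊔ (A₂ ⊔ A₃)`. -/
def assoc (A₁ A₂ A₃ : BAlg B) :
    Hom (coprod (coprod A₁ A₂) A₃) (coprod A₁ (coprod A₂ A₃)) :=
  lift (lift (inl A₁ (coprod A₂ A₃)) ((inr A₁ (coprod A₂ A₃)).comp (inl A₂ A₃)))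
    ((inr A₁ (coprod A₂ A₃)).comp (inr A₂ A₃))

end Base

/-! ### Change of the base algebra -/

section BaseChange

variable {B B' : Type u} [Ring B] [StarRing B] [Algebra ℂ B]
  [Ring B'] [StarRing B'] [Algebra ℂ B']

/-- A `*`-algebra over `B'`, considered as a `*`-algebra over `B` along a unital
`*`-homomorphism `β : B → B'`. -/
def restrict (β : B →⋆ₐ[ℂ] B') (A : BAlg B') : BAlg B :=
  letI : Module B A := Module.compHom A (β : B →+* B')
  letI : Module Bᵐᵒᵖ A := Module.compHom A ((β : B →+* B').op)
  { carrier := A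
    smul_op_smul := fun b b' a => A.smul_op_smul (β b) (β b') a
    smul_mul := fun b a a' => A.smul_mul (β b) a a'
    mul_op_smul := fun b a a' => A.mul_op_smul (β b) a a'
    op_smul_mul := fun b a a' => A.op_smul_mul (β b) a a'
    star_smul := fun b a => by
      have h := A.star_smul (β b) a
      rw [← map_star β b] at h
      exact h
    complex_smul := fun z a => by
      have h := A.complex_smul z a
      rw [← AlgHomClass.commutes β z] at h
      exact h }

/-- A homomorphism over `B'`, considered as a homomorphism over `B`. -/
def Hom.restrict (β : B →⋆ₐ[ℂ] B') {A D : BAlg B'} (f : Hom A D) :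
    Hom (CondProb.restrict β A) (CondProb.restrict β D) where
  toFun := f.toFun
  map_add := f.map_add
  map_mul := f.map_mul
  map_star := f.map_star
  map_smul b a := f.map_smul (β b) a
  map_op_smul b a := f.map_op_smul (β b) a

/-- The homomorphism `f₁ ⊔ f₂ : A₁ ⊔ A₂ → A₁' ⊔ A₂'` over `β : B → B'`. -/
def coprodMap (β : B →⋆ₐ[ℂ] B') {A₁ A₂ : BAlg B} {A₁' A₂' : BAlg B'}
    (f₁ : Hom A₁ (restrict β A₁')) (f₂ : Hom A₂ (restrict β A₂')) :
    Hom (coprod A₁ A₂) (restrict β (coprod A₁' A₂')) :=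
  lift (((inl A₁' A₂').restrict β).comp f₁) (((inr A₁' A₂').restrict β).comp f₂)

end BaseChange

/-! ### Conditional independences -/

/-- A conditional independence: a prescription that, over every base algebra `B`, assigns to
two conditional expectations on `A₁`, `A₂` a conditional expectation on `A₁ ⊔ A₂` that extends
them (i.e. computes the mixed moments), that is associative, and that is natural, including
naturality under a change of the base algebra. -/
structure Independence where
  prod : ∀ {B : Type u} [Ring B] [StarRing B] [Algebra ℂ B] [StarModule ℂ B]
    {A₁ A₂ : BAlg B}, Expectation A₁ → Expectation A₂ → Expectation (coprod A₁ A₂)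
  prod_inl : ∀ {B : Type u} [Ring B] [StarRing B] [Algebra ℂ B] [StarModule ℂ B]
    {A₁ A₂ : BAlg B} (φ₁ : Expectation A₁) (φ₂ : Expectation A₂) (a : A₁),
    prod φ₁ φ₂ (inl A₁ A₂ a) = φ₁ a
  prod_inr : ∀ {B : Type u} [Ring B] [StarRing B] [Algebra ℂ B] [StarModule ℂ B]
    {A₁ A₂ : BAlg B} (φ₁ : Expectation A₁) (φ₂ : Expectation A₂) (a : A₂),
    prod φ₁ φ₂ (inr A₁ A₂ a) = φ₂ a
  associative : ∀ {B : Type u} [Ring B] [StarRing B] [Algebra ℂ B] [StarModule ℂ B]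
    {A₁ A₂ A₃ : BAlg B} (φ₁ : Expectation A₁) (φ₂ : Expectation A₂) (φ₃ : Expectation A₃)
    (x : coprod (coprod A₁ A₂) A₃),
    prod (prod φ₁ φ₂) φ₃ x = prod φ₁ (prod φ₂ φ₃) (assoc A₁ A₂ A₃ x)
  natural : ∀ {B B' : Type u} [Ring B] [StarRing B] [Algebra ℂ B] [StarModule ℂ B]
    [Ring B'] [StarRing B'] [Algebra ℂ B'] [StarModule ℂ B'] (β : B →⋆ₐ[ℂ] B')
    {A₁ A₂ : BAlg B} {A₁' A₂' : BAlg B'}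
    (φ₁ : Expectation A₁) (φ₂ : Expectation A₂)
    (φ₁' : Expectation A₁') (φ₂' : Expectation A₂')
    (f₁ : Hom A₁ (restrict β A₁')) (f₂ : Hom A₂ (restrict β A₂')),
    (∀ a, φ₁' (f₁ a) = β (φ₁ a)) → (∀ a, φ₂' (f₂ a) = β (φ₂ a)) →
    ∀ x, prod φ₁' φ₂' (coprodMap β f₁ f₂ x) = β (prod φ₁ φ₂ x)

namespace Independence

/-- `Q` is the opposite of `P`: it is `P` with the two factors interchanged. -/
def IsOpposite (Q P : Independence.{u}) : Prop :=
  ∀ {B : Type u} [Ring B] [StarRing B] [Algebra ℂ B] [StarModule ℂ B]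
    {A₁ A₂ : BAlg B} (φ₁ : Expectation A₁) (φ₂ : Expectation A₂) (x : coprod A₁ A₂),
    Q.prod φ₁ φ₂ x = P.prod φ₂ φ₁ (swap A₁ A₂ x)

/-- `P` is symmetric: it does not depend on the order of the factors. -/
def IsSymmetric (P : Independence.{u}) : Prop := P.IsOpposite P

/-- `P` is unital: if `A₁`, `A₂` are unital algebras (with units `e₁`, `e₂`) and the
conditional expectations are unital, then in the product `e₁` and `e₂` may be identified with
the unit, i.e. the product conditional expectation factors through the unital free product of
`A₁` and `A₂` with amalgamation over `B`. -/
def IsUnital (P : Independence.{u}) : Prop :=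
  ∀ {B : Type u} [Ring B] [StarRing B] [Algebra ℂ B] [StarModule ℂ B]
    {A₁ A₂ : BAlg B} (φ₁ : Expectation A₁) (φ₂ : Expectation A₂) (e₁ : A₁) (e₂ : A₂),
    (∀ a, e₁ * a = a ∧ a * e₁ = a) → (∀ a, e₂ * a = a ∧ a * e₂ = a) →
    φ₁ e₁ = 1 → φ₂ e₂ = 1 →
    ∀ x y : Uni (coprod A₁ A₂),
      (P.prod φ₁ φ₂).ext (x * Uni.ofA (inl A₁ A₂ e₁) * y) = (P.prod φ₁ φ₂).ext (x * y) ∧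
      (P.prod φ₁ φ₂).ext (x * Uni.ofA (inr A₁ A₂ e₂) * y) = (P.prod φ₁ φ₂).ext (x * y)

/-- `P` is conditional free independence: in the product, `B ⊕ A₁` and `B ⊕ A₂` are free with
amalgamation over `B`, i.e. the expectation of every alternating product of centred elements
is zero. -/
def IsFree (P : Independence.{u}) : Prop :=
  ∀ {B : Type u} [Ring B] [StarRing B] [Algebra ℂ B] [StarModule ℂ B]
    {A₁ A₂ : BAlg B} (φ₁ : Expectation A₁) (φ₂ : Expectation A₂)
    (w : List (Uni A₁ ⊕ Uni A₂)), w ≠ [] →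
    w.IsChain (fun s t => s.isLeft ≠ t.isLeft) →
    (∀ s ∈ w, Sum.elim φ₁.ext φ₂.ext s = 0) →
    (P.prod φ₁ φ₂).ext
      (w.map (Sum.elim (Uni.map (inl A₁ A₂)) (Uni.map (inr A₁ A₂)))).prod = 0

/-- `P` is conditional boolean independence: the expectation of every alternating product
`a₁ a₂ ⋯ aₙ` of elements of `A₁` and `A₂` is the product of the expectations of the `aᵢ`. -/
def IsBoolean (P : Independence.{u}) : Prop :=
  ∀ {B : Type u} [Ring B] [StarRing B] [Algebra ℂ B] [StarModule ℂ B]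
    {A₁ A₂ : BAlg B} (φ₁ : Expectation A₁) (φ₂ : Expectation A₂)
    (w : List (A₁ ⊕ A₂)), w ≠ [] →
    w.IsChain (fun s t => s.isLeft ≠ t.isLeft) →
    (P.prod φ₁ φ₂).ext
      (w.map (fun s => Uni.ofA (Sum.elim (inl A₁ A₂) (inr A₁ A₂) s))).prod =
      (w.map (Sum.elim φ₁ φ₂)).prod

/-- `P` is conditional monotone independence: for `x₀, …, xₙ` in `B ⊕ A₁` and `y₁, …, yₙ` in
`A₂`, where `n ≥ 1`, the expectation of `x₀ y₁ x₁ ⋯ yₙ xₙ` is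
`φ₁(x₀) φ₂(y₁ φ₁(x₁) y₂ φ₁(x₂) ⋯ yₙ) φ₁(xₙ)`. In the definition, `x`, `y`, `z` are `x₀`, `y₁`,
`xₙ`, and `w` lists the pairs `(x₁, y₂), …, (xₙ₋₁, yₙ)`. -/
def IsMonotone (P : Independence.{u}) : Prop :=
  ∀ {B : Type u} [Ring B] [StarRing B] [Algebra ℂ B] [StarModule ℂ B]
    {A₁ A₂ : BAlg B} (φ₁ : Expectation A₁) (φ₂ : Expectation A₂)
    (x z : Uni A₁) (y : A₂) (w : List (Uni A₁ × A₂)),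
    (P.prod φ₁ φ₂).ext
      (Uni.map (inl A₁ A₂) x * Uni.ofA (inr A₁ A₂ y) *
        (w.map (fun p => Uni.map (inl A₁ A₂) p.1 * Uni.ofA (inr A₁ A₂ p.2))).prod *
        Uni.map (inl A₁ A₂) z) =
      φ₁.ext x *
        φ₂.ext (Uni.ofA y *
          (w.map (fun p => (Uni.ofB (φ₁.ext p.1) * Uni.ofA p.2 : Uni A₂))).prod) *
        φ₁.ext z

end Independence

end CondProb

/-! Uniqueness. By naturality an independence is known as soon as it is known on two copies of the
complex 2 × 2 matrices, with the `(0, 0)`-entry as expectation (`Independence.eq_of_matExp`). The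
reason is a dilation: after an injective change of base from `B` to an algebra `D` built from
operators on a Fock space, every expectation `φ` on `A` becomes the `(0, 0)`-entry of a homomorphism
from `A` to the 2 × 2 matrices over `D` (`Summand.dilation`). Both factors can be dilated over the
same `D`, and matrices over `D` are scalar matrices with coefficients from `D`. The operators have
no natural involution; the double `Q × Qᵐᵒᵖ` with the exchange of components supplies one.

For the matrices everything hinges on one number `α` (`Independence.alpha`), the expectation of `E₀₁
1 E₁₀` in the product of the matrices with `ℂ`. All other expectations of `m 1 n` are forced,
because positivity makes `E₀₁`, `E₁₁`, `1 - E₀₀` and the difference between the two units null. By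
dilation, `Φ(x 1 y) = φ(x) φ(y) + α (φ(xy) - φ(x) φ(y))` over the scalars, and associativity with
two copies of `ℂ` gives `α² = α` (`Independence.alpha_mul_self`). So the unit of `ℂ` acts as the
projection `diag(1, α)` of the matrices. If `α'` is the number of the opposite independence,
associativity with `ℂ` in the middle says that `diag(1, α)` in the first copy and `diag(1, α')` in
the second act alike (`Independence.matProd_corner`).

This leaves four cases. If `α = α' = 0`, a centred element standing to the right of the other
algebra is null: boolean (`eq_boolean`). If `α = 0` and `α' = 1`, the unit of the second copy acts
as `E₀₀` in the first, which compresses the elements between two letters of the second copy to their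
expectations: monotone (`eq_monotone`). The reversed values give the opposite. If `α = α' = 1`, both
units act as `1`, and a gauge transformation by two Toeplitz isometries multiplies an alternating
product of centred matrix units by an operator without vacuum coefficient, so that its expectation
is zero: free (`eq_free`).

Existence. Each of the three products is read off a ring representation of the coproduct, obtained
from `exists_ringLift`, and is characterised by reduction rules or by vanishing on alternating
centred products. Hermiticity, naturality and associativity follow because both sides obey the same
rules and agree on the reduced elements; positivity is checked on reduced elements. The values of
`alpha`, together with unitality of the free product, separate the cases and settle which
independences are unital or symmetric. -/

namespace CondProb

open scoped RightActions

/-! ### Formal properties of homomorphisms, expectations, coproducts and the opposite independence.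
-/

section Basics

variable {B : Type u} [Ring B] [StarRing B] [Algebra ℂ B]

/-! ### Homomorphisms and the unitization -/

theorem Hom.ext' {A D : BAlg B} {f g : Hom A D} (h : ∀ a, f a = g a) : f = g := by
  cases f
  cases g
  congr
  exact funext h

theorem Hom.map_zero {A D : BAlg B} (f : Hom A D) : f 0 = 0 := by
  have h := f.map_add 0 0
  simpa using h

/-- The identity homomorphism. -/
def Hom.id (A : BAlg B) : Hom A A where
  toFun a := a
  map_add _ _ := rfl
  map_mul _ _ := rfl
  map_star _ := rfl
  map_smul _ _ := rfl
  map_op_smul _ _ := rfl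

@[simp] theorem Hom.id_apply {A : BAlg B} (a : A) : Hom.id A a = a := rfl

@[simp] theorem Hom.comp_apply {A D E : BAlg B} (g : Hom D E) (f : Hom A D) (a : A) :
    g.comp f a = g (f a) := rfl

namespace Uni

variable {A D E : BAlg B}

@[simp] theorem ofB_fst (b : B) : (ofB b : Uni A).1 = b := rfl
@[simp] theorem ofB_snd (b : B) : (ofB b : Uni A).2 = 0 := rfl
@[simp] theorem ofA_fst (a : A) : (ofA a : Uni A).1 = 0 := rfl
@[simp] theorem ofA_snd (a : A) : (ofA a : Uni A).2 = a := rfl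
@[simp] theorem map_fst (f : Hom A D) (x : Uni A) : (map f x).1 = x.1 := rfl
@[simp] theorem map_snd (f : Hom A D) (x : Uni A) : (map f x).2 = f x.2 := rfl
@[simp] theorem neg_fst (x : Uni A) : (-x).1 = -x.1 := rfl
@[simp] theorem neg_snd (x : Uni A) : (-x).2 = -x.2 := rfl
@[simp] theorem sub_fst (x y : Uni A) : (x - y).1 = x.1 - y.1 := rfl
@[simp] theorem sub_snd (x y : Uni A) : (x - y).2 = x.2 - y.2 := rfl

theorem ext' {x y : Uni A} (h₁ : x.1 = y.1) (h₂ : x.2 = y.2) : x = y := Prod.ext h₁ h₂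

theorem eq_add (x : Uni A) : x = ofB x.1 + ofA x.2 := by apply ext' <;> simp

@[simp] theorem ofB_zero : (ofB 0 : Uni A) = 0 := rfl
@[simp] theorem ofA_zero : (ofA 0 : Uni A) = 0 := rfl
@[simp] theorem ofB_one : (ofB 1 : Uni A) = 1 := rfl
theorem ofB_add (b b' : B) : (ofB (b + b') : Uni A) = ofB b + ofB b' := by
  apply ext' <;> simp
theorem ofB_mul (b b' : B) : (ofB (b * b') : Uni A) = ofB b * ofB b' := by
  apply ext' <;> simp
theorem ofA_add (a a' : A) : (ofA (a + a') : Uni A) = ofA a + ofA a' := by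
  apply ext' <;> simp
theorem ofA_sub (a a' : A) : (ofA (a - a') : Uni A) = ofA a - ofA a' := by
  apply ext' <;> simp
theorem ofA_mul (a a' : A) : (ofA (a * a') : Uni A) = ofA a * ofA a' := by
  apply ext' <;> simp
theorem ofA_smul (b : B) (a : A) : (ofA (b • a) : Uni A) = ofB b * ofA a := by
  apply ext' <;> simp
theorem ofA_op_smul (b : B) (a : A) : (ofA (a <• b) : Uni A) = ofA a * ofB b := by
  apply ext' <;> simp
theorem star_ofB (b : B) : star (ofB b : Uni A) = ofB (star b) := by
  apply ext' <;> simp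
theorem star_ofA (a : A) : star (ofA a : Uni A) = ofA (star a) := by
  apply ext' <;> simp

/-- The embedding of `B` as a ring homomorphism. -/
def ofBHom (A : BAlg B) : B →+* Uni A where
  toFun := ofB
  map_one' := rfl
  map_mul' := ofB_mul
  map_zero' := rfl
  map_add' := ofB_add

@[simp] theorem ofBHom_apply (b : B) : ofBHom A b = ofB b := rfl

/-- The unital extension of a homomorphism as a ring homomorphism. -/
def mapHom (f : Hom A D) : Uni A →+* Uni D where
  toFun := map f
  map_one' := by apply ext' <;> simp [f.map_zero]
  map_mul' x y := by
    apply ext' <;> simp [f.map_add, f.map_mul, f.map_smul, f.map_op_smul]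
  map_zero' := by apply ext' <;> simp [f.map_zero]
  map_add' x y := by apply ext' <;> simp [f.map_add]

@[simp] theorem mapHom_apply (f : Hom A D) (x : Uni A) : mapHom f x = map f x := rfl

protected theorem map_add (f : Hom A D) (x y : Uni A) : map f (x + y) = map f x + map f y :=
  (mapHom f).map_add x y
protected theorem map_sub (f : Hom A D) (x y : Uni A) : map f (x - y) = map f x - map f y :=
  (mapHom f).map_sub x y
protected theorem map_mul (f : Hom A D) (x y : Uni A) : map f (x * y) = map f x * map f y :=
  (mapHom f).map_mul x y
@[simp] protected theorem map_one (f : Hom A D) : map f (1 : Uni A) = 1 := (mapHom f).map_one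
@[simp] protected theorem map_zero (f : Hom A D) : map f (0 : Uni A) = 0 := (mapHom f).map_zero
@[simp] theorem map_ofB (f : Hom A D) (b : B) : map f (ofB b) = ofB b := by
  apply ext' <;> simp [f.map_zero]
@[simp] theorem map_ofA (f : Hom A D) (a : A) : map f (ofA a) = ofA (f a) := rfl
protected theorem map_star (f : Hom A D) (x : Uni A) : map f (star x) = star (map f x) := by
  apply ext' <;> simp [f.map_star]
@[simp] protected theorem map_id (x : Uni A) : map (Hom.id A) x = x := rfl

end Uni

/-! ### Conditional expectations -/

namespace Expectation

open Uni

variable {A D : BAlg B}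

theorem eq_of_forall {φ ψ : Expectation A} (h : ∀ a, φ a = ψ a) : φ = ψ := by
  cases φ
  cases ψ
  congr
  exact funext h

variable (φ : Expectation A)

theorem map_zero : φ 0 = 0 := by
  have h := φ.map_add 0 0
  simpa using h

theorem map_neg (a : A) : φ (-a) = -φ a := by
  have h := φ.map_add (-a) a
  rw [neg_add_cancel, φ.map_zero] at h
  exact eq_neg_of_add_eq_zero_left h.symm

theorem map_sub (a a' : A) : φ (a - a') = φ a - φ a' := by
  rw [sub_eq_add_neg, φ.map_add, φ.map_neg, sub_eq_add_neg]

theorem ext_add (x y : Uni A) : φ.ext (x + y) = φ.ext x + φ.ext y := by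
  simp only [Expectation.ext, add_fst, add_snd, φ.map_add]
  abel

/-- The extension to `B ⊕ A` as a homomorphism of additive groups. -/
def extHom : Uni A →+ B := AddMonoidHom.mk' φ.ext φ.ext_add

@[simp] theorem extHom_apply (x : Uni A) : φ.extHom x = φ.ext x := rfl

@[simp] theorem ext_zero : φ.ext 0 = 0 := φ.extHom.map_zero
theorem ext_sub (x y : Uni A) : φ.ext (x - y) = φ.ext x - φ.ext y := φ.extHom.map_sub x y
theorem ext_sum {κ : Type*} (s : Finset κ) (x : κ → Uni A) :
    φ.ext (∑ k ∈ s, x k) = ∑ k ∈ s, φ.ext (x k) := _root_.map_sum φ.extHom x s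

@[simp] theorem ext_ofB (b : B) : φ.ext (ofB b) = b := by
  simp [Expectation.ext, φ.map_zero]

@[simp] theorem ext_ofA (a : A) : φ.ext (ofA a) = φ a := by
  simp [Expectation.ext]

@[simp] theorem ext_one : φ.ext 1 = 1 := φ.ext_ofB 1

theorem ext_ofB_mul (b : B) (x : Uni A) : φ.ext (ofB b * x) = b * φ.ext x := by
  simp [Expectation.ext, φ.map_smul, mul_add]

theorem ext_mul_ofB (x : Uni A) (b : B) : φ.ext (x * ofB b) = φ.ext x * b := by
  simp [Expectation.ext, φ.map_op_smul, add_mul]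

theorem ext_positive (n : ℕ) (x : Fin n → Uni A) : ∃ (m : ℕ) (c : Fin m → Fin n → B), ∀ i j,
    φ.ext (star (x i) * x j) = ∑ k, star (c k i) * c k j := φ.positive n x

/-- A Gram matrix is hermitian, and that of the family `1, x` has `φ.ext x` off the diagonal. -/
theorem ext_star (x : Uni A) : φ.ext (star x) = star (φ.ext x) := by
  obtain ⟨m, c, h⟩ := φ.ext_positive 2 ![1, x]
  have h₁ := h 0 1
  have h₂ := h 1 0
  simp only [Matrix.cons_val_zero, Matrix.cons_val_one, star_one, one_mul,
    mul_one] at h₁ h₂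
  rw [h₁, h₂, star_sum]
  simp

theorem map_star (a : A) : φ (star a) = star (φ a) := by
  have h := φ.ext_star (ofA a)
  rwa [star_ofA, ext_ofA, ext_ofA] at h

/-- A conditional expectation from its extension to `B ⊕ A`. -/
def ofExt (L : Uni A →+ B) (hB : ∀ b, L (ofB b) = b) (hl : ∀ b x, L (ofB b * x) = b * L x)
    (hr : ∀ x b, L (x * ofB b) = L x * b)
    (hp : ∀ (n : ℕ) (x : Fin n → Uni A), ∃ (m : ℕ) (c : Fin m → Fin n → B), ∀ i j,
      L (star (x i) * x j) = ∑ k, star (c k i) * c k j) : Expectation A where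
  toFun a := L (ofA a)
  map_add a a' := by rw [ofA_add, L.map_add]
  map_smul b a := by rw [ofA_smul, hl]
  map_op_smul b a := by rw [ofA_op_smul, hr]
  positive n x := by
    obtain ⟨m, c, h⟩ := hp n x
    refine ⟨m, c, fun i j => ?_⟩
    rw [← h i j, eq_add (star (x i) * x j), L.map_add, hB]
    simp

theorem ofExt_ext (L : Uni A →+ B) (hB hl hr hp) (x : Uni A) :
    (ofExt L hB hl hr hp).ext x = L x := by
  conv_rhs => rw [eq_add x, L.map_add, hB]
  rfl

/-- The restriction of a conditional expectation along a homomorphism. -/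
def comp (ψ : Expectation D) (f : Hom A D) : Expectation A where
  toFun a := ψ (f a)
  map_add a a' := by rw [f.map_add, ψ.map_add]
  map_smul b a := by rw [f.map_smul, ψ.map_smul]
  map_op_smul b a := by rw [f.map_op_smul, ψ.map_op_smul]
  positive n x := by
    obtain ⟨m, c, h⟩ := ψ.positive n (fun i => map f (x i))
    refine ⟨m, c, fun i j => ?_⟩
    rw [← h i j, ← Uni.map_star, ← Uni.map_mul]
    rfl

@[simp] theorem comp_apply (ψ : Expectation D) (f : Hom A D) (a : A) :
    ψ.comp f a = ψ (f a) := rfl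

end Expectation

/-! ### The coproduct -/

section Coprod

open Uni

variable {A₁ A₂ A₃ D E : BAlg B}

@[simp] theorem lift_inl (f : Hom A₁ D) (g : Hom A₂ D) (a : A₁) :
    lift f g (inl A₁ A₂ a) = f a := rfl

@[simp] theorem lift_inr (f : Hom A₁ D) (g : Hom A₂ D) (a : A₂) :
    lift f g (inr A₁ A₂ a) = g a := rfl

/-- The class of an expression, as an element of the coproduct. -/
def termClass (t : Term A₁ A₂) : coprod A₁ A₂ := CoprodCarrier.mk t

/-- Induction on the elements of a coproduct. -/
theorem coprod_induction {p : coprod A₁ A₂ → Prop} (hl : ∀ a, p (inl A₁ A₂ a))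
    (hr : ∀ a, p (inr A₁ A₂ a)) (hadd : ∀ x y, p x → p y → p (x + y))
    (hmul : ∀ x y, p x → p y → p (x * y)) (hsmul : ∀ (b : B) x, p x → p (b • x))
    (hop : ∀ (b : B) x, p x → p (x <• b)) (x : coprod A₁ A₂) : p x := by
  have h0 : ∀ x : coprod A₁ A₂, p x → p 0 := fun x hx => by
    have := hsmul 0 x hx
    rwa [zero_smul] at this
  have hneg : ∀ x : coprod A₁ A₂, p x → p (-x) := fun x hx => by
    have := hsmul (-1) x hx
    rwa [neg_smul, one_smul] at this
  -- There is no clause for the involution among the hypotheses. Carrying the claim for `star` along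
  -- pushes the involution down to the generators.
  have key : ∀ t : Term A₁ A₂, p (termClass t) ∧ p (star (termClass t)) := by
    intro t
    induction t with
    | inl a =>
      have e : star (termClass (.inl a)) = inl A₁ A₂ (star a) := ((inl A₁ A₂).map_star a).symm
      exact ⟨hl a, e ▸ hl (star a)⟩
    | inr a =>
      have e : star (termClass (.inr a)) = inr A₁ A₂ (star a) := ((inr A₁ A₂).map_star a).symm
      exact ⟨hr a, e ▸ hr (star a)⟩
    | zero =>
      have e : star (termClass (.zero : Term A₁ A₂)) = 0 := star_zero (coprod A₁ A₂)
      exact ⟨h0 _ (hl 0), e ▸ h0 _ (hl 0)⟩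
    | add s t hs ht =>
      have e : star (termClass (s.add t)) = _ := star_add (termClass s) (termClass t)
      exact ⟨hadd _ _ hs.1 ht.1, e ▸ hadd _ _ hs.2 ht.2⟩
    | neg s hs =>
      have e : star (termClass s.neg) = _ := star_neg (termClass s)
      exact ⟨hneg _ hs.1, e ▸ hneg _ hs.2⟩
    | mul s t hs ht =>
      have e : star (termClass (s.mul t)) = _ := star_mul (termClass s) (termClass t)
      exact ⟨hmul _ _ hs.1 ht.1, e ▸ hmul _ _ ht.2 hs.2⟩
    | star s hs =>
      have e : star (termClass s.star) = _ := star_star (termClass s)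
      exact ⟨hs.2, e ▸ hs.1⟩
    | smul b s hs =>
      have e : star (termClass (s.smul b)) = _ := (coprod A₁ A₂).star_smul b (termClass s)
      exact ⟨hsmul b _ hs.1, e ▸ hop (star b) _ hs.2⟩
    | opSMul b s hs =>
      have e : star (termClass (s.opSMul b)) = _ := star_op_smul b (termClass s)
      exact ⟨hop b _ hs.1, e ▸ hsmul (star b) _ hs.2⟩
  induction x using Quotient.inductionOn with
  | h t => exact (key t).1

/-- Induction on the elements of the unitization of a coproduct. -/
theorem uni_coprod_induction {p : Uni (coprod A₁ A₂) → Prop} (hB : ∀ b, p (ofB b))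
    (hl : ∀ a, p (ofA (inl A₁ A₂ a))) (hr : ∀ a, p (ofA (inr A₁ A₂ a)))
    (hadd : ∀ x y, p x → p y → p (x + y)) (hmul : ∀ x y, p x → p y → p (x * y))
    (x : Uni (coprod A₁ A₂)) : p x := by
  rw [eq_add x]
  refine hadd _ _ (hB _) ?_
  refine coprod_induction (p := fun a => p (ofA a)) hl hr ?_ ?_ ?_ ?_ x.2
  · intro x y hx hy
    rw [ofA_add]
    exact hadd _ _ hx hy
  · intro x y hx hy
    rw [ofA_mul]
    exact hmul _ _ hx hy
  · intro b x hx
    rw [ofA_smul]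
    exact hmul _ _ (hB b) hx
  · intro b x hx
    rw [ofA_op_smul]
    exact hmul _ _ hx (hB b)

theorem coprod_hom_ext {f g : Hom (coprod A₁ A₂) D} (hl : ∀ a, f (inl A₁ A₂ a) = g (inl A₁ A₂ a))
    (hr : ∀ a, f (inr A₁ A₂ a) = g (inr A₁ A₂ a)) : f = g := by
  refine Hom.ext' fun x => ?_
  refine coprod_induction (p := fun x => f x = g x) hl hr ?_ ?_ ?_ ?_ x
  · intro x y hx hy
    rw [f.map_add, g.map_add, hx, hy]
  · intro x y hx hy
    rw [f.map_mul, g.map_mul, hx, hy]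
  · intro b x hx
    rw [f.map_smul, g.map_smul, hx]
  · intro b x hx
    rw [f.map_op_smul, g.map_op_smul, hx]

/-- The homomorphism `f ⊔ g` over a fixed base. -/
def sumMap (f : Hom A₁ D) (g : Hom A₂ E) : Hom (coprod A₁ A₂) (coprod D E) :=
  lift ((inl D E).comp f) ((inr D E).comp g)

@[simp] theorem sumMap_inl (f : Hom A₁ D) (g : Hom A₂ E) (a : A₁) :
    sumMap f g (inl A₁ A₂ a) = inl D E (f a) := rfl

@[simp] theorem sumMap_inr (f : Hom A₁ D) (g : Hom A₂ E) (a : A₂) :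
    sumMap f g (inr A₁ A₂ a) = inr D E (g a) := rfl

@[simp] theorem swap_inl (a : A₁) : swap A₁ A₂ (inl A₁ A₂ a) = inr A₂ A₁ a := rfl
@[simp] theorem swap_inr (a : A₂) : swap A₁ A₂ (inr A₁ A₂ a) = inl A₂ A₁ a := rfl

@[simp] theorem swap_swap (x : coprod A₁ A₂) : swap A₂ A₁ (swap A₁ A₂ x) = x := by
  have : (swap A₂ A₁).comp (swap A₁ A₂) = Hom.id _ :=
    coprod_hom_ext (fun _ => rfl) (fun _ => rfl)
  exact congrArg (fun f : Hom _ _ => f x) this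

@[simp] theorem assoc_inl_inl (a : A₁) :
    assoc A₁ A₂ A₃ (inl _ A₃ (inl A₁ A₂ a)) = inl A₁ _ a := rfl
@[simp] theorem assoc_inl_inr (a : A₂) :
    assoc A₁ A₂ A₃ (inl _ A₃ (inr A₁ A₂ a)) = inr A₁ _ (inl A₂ A₃ a) := rfl
@[simp] theorem assoc_inr (a : A₃) :
    assoc A₁ A₂ A₃ (inr _ A₃ a) = inr A₁ _ (inr A₂ A₃ a) := rfl

end Coprod

end Basics

/-! ### Independences -/

namespace Independence

theorem eq_of_prod {P Q : Independence.{u}}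
    (h : ∀ {B : Type u} [Ring B] [StarRing B] [Algebra ℂ B] [StarModule ℂ B]
      {A₁ A₂ : BAlg B} (φ₁ : Expectation A₁) (φ₂ : Expectation A₂),
      P.prod φ₁ φ₂ = Q.prod φ₁ φ₂) : P = Q := by
  cases P with
  | mk p _ _ _ _ =>
  cases Q with
  | mk q _ _ _ _ =>
  have : @p = @q := by
    funext B _ _ _ _ A₁ A₂ φ₁ φ₂
    exact h φ₁ φ₂
  subst this
  rfl

section Fixed

variable {B : Type u} [Ring B] [StarRing B] [Algebra ℂ B] [StarModule ℂ B]

/-- Naturality over a fixed base. -/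
theorem natural_fixed (P : Independence.{u}) {A₁ A₂ D₁ D₂ : BAlg B}
    (φ₁ : Expectation A₁) (φ₂ : Expectation A₂) (ψ₁ : Expectation D₁) (ψ₂ : Expectation D₂)
    (f₁ : Hom A₁ D₁) (f₂ : Hom A₂ D₂) (h₁ : ∀ a, ψ₁ (f₁ a) = φ₁ a) (h₂ : ∀ a, ψ₂ (f₂ a) = φ₂ a)
    (x : coprod A₁ A₂) : P.prod ψ₁ ψ₂ (sumMap f₁ f₂ x) = P.prod φ₁ φ₂ x := by
  -- Restriction along the identity changes neither the carrier nor, up to unfolding, the actions,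
  -- so homomorphisms only have to be repackaged.
  let g₁ : Hom A₁ (restrict (StarAlgHom.id ℂ B) D₁) :=
    ⟨f₁.toFun, f₁.map_add, f₁.map_mul, f₁.map_star, f₁.map_smul, f₁.map_op_smul⟩
  let g₂ : Hom A₂ (restrict (StarAlgHom.id ℂ B) D₂) :=
    ⟨f₂.toFun, f₂.map_add, f₂.map_mul, f₂.map_star, f₂.map_smul, f₂.map_op_smul⟩
  let k : Hom (coprod A₁ A₂) (restrict (StarAlgHom.id ℂ B) (coprod D₁ D₂)) :=
    ⟨(sumMap f₁ f₂).toFun, (sumMap f₁ f₂).map_add, (sumMap f₁ f₂).map_mul,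
      (sumMap f₁ f₂).map_star, (sumMap f₁ f₂).map_smul, (sumMap f₁ f₂).map_op_smul⟩
  have e : coprodMap (StarAlgHom.id ℂ B) g₁ g₂ = k :=
    coprod_hom_ext (fun _ => rfl) (fun _ => rfl)
  have h := P.natural (StarAlgHom.id ℂ B) φ₁ φ₂ ψ₁ ψ₂ g₁ g₂ h₁ h₂ x
  rw [e] at h
  exact h

/-- The product with the two factors interchanged. -/
def opProd (P : Independence.{u}) {A₁ A₂ : BAlg B} (φ₁ : Expectation A₁) (φ₂ : Expectation A₂) :
    Expectation (coprod A₁ A₂) := (P.prod φ₂ φ₁).comp (swap A₁ A₂)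

theorem opProd_apply (P : Independence.{u}) {A₁ A₂ : BAlg B} (φ₁ : Expectation A₁)
    (φ₂ : Expectation A₂) (x : coprod A₁ A₂) :
    P.opProd φ₁ φ₂ x = P.prod φ₂ φ₁ (swap A₁ A₂ x) := rfl

/-- This is associativity of `P` for the factors in reversed order, transported by naturality along
the exchange of two of them. -/
theorem opProd_associative (P : Independence.{u}) {A₁ A₂ A₃ : BAlg B} (φ₁ : Expectation A₁)
    (φ₂ : Expectation A₂) (φ₃ : Expectation A₃) (x : coprod (coprod A₁ A₂) A₃) :
    P.opProd (P.opProd φ₁ φ₂) φ₃ x = P.opProd φ₁ (P.opProd φ₂ φ₃) (assoc A₁ A₂ A₃ x) := by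
  -- `k` reverses the order of the three factors; `e₁` and `e₂` express it by exchanges of two
  -- factors before and after reassociation.
  let k : Hom (coprod (coprod A₁ A₂) A₃) (coprod (coprod A₃ A₂) A₁) :=
    lift (lift (inr _ _) ((inl _ _).comp (inr _ _))) ((inl _ _).comp (inl _ _))
  have e₁ : (assoc A₃ A₂ A₁).comp k =
      (sumMap (Hom.id _) (swap A₁ A₂)).comp (swap (coprod A₁ A₂) A₃) := by
    refine coprod_hom_ext (fun y => ?_) (fun _ => rfl)
    have : ((assoc A₃ A₂ A₁).comp k).comp (inl _ _) =
        ((sumMap (Hom.id _) (swap A₁ A₂)).comp (swap (coprod A₁ A₂) A₃)).comp (inl _ _) :=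
      coprod_hom_ext (fun _ => rfl) (fun _ => rfl)
    exact congrArg (fun f : Hom _ _ => f y) this
  have e₂ : (sumMap (swap A₂ A₃) (Hom.id _)).comp ((swap A₁ (coprod A₂ A₃)).comp
      (assoc A₁ A₂ A₃)) = k := by
    refine coprod_hom_ext (fun y => ?_) (fun _ => rfl)
    have : ((sumMap (swap A₂ A₃) (Hom.id _)).comp ((swap A₁ (coprod A₂ A₃)).comp
      (assoc A₁ A₂ A₃))).comp (inl _ _) = k.comp (inl _ _) :=
      coprod_hom_ext (fun _ => rfl) (fun _ => rfl)
    exact congrArg (fun f : Hom _ _ => f y) this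
  have h := P.associative φ₃ φ₂ φ₁ (k x)
  have h₁ := P.natural_fixed φ₃ (P.opProd φ₁ φ₂) φ₃ (P.prod φ₂ φ₁) (Hom.id _) (swap A₁ A₂)
    (fun _ => rfl) (fun _ => rfl) (swap _ _ x)
  have h₂ := P.natural_fixed (P.opProd φ₂ φ₃) φ₁ (P.prod φ₃ φ₂) φ₁ (swap A₂ A₃) (Hom.id _)
    (fun _ => rfl) (fun _ => rfl) (swap _ _ (assoc A₁ A₂ A₃ x))
  have e₁' := congrArg (fun f : Hom _ _ => f x) e₁
  have e₂' := congrArg (fun f : Hom _ _ => f x) e₂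
  simp only [Hom.comp_apply] at e₁' e₂'
  rw [opProd_apply, opProd_apply, ← h₁, ← h₂, ← e₁', e₂', h]

end Fixed

/-- The opposite independence. -/
def op (P : Independence.{u}) : Independence.{u} where
  prod φ₁ φ₂ := P.opProd φ₁ φ₂
  prod_inl φ₁ φ₂ a := P.prod_inr φ₂ φ₁ a
  prod_inr φ₁ φ₂ a := P.prod_inl φ₂ φ₁ a
  associative φ₁ φ₂ φ₃ x := P.opProd_associative φ₁ φ₂ φ₃ x
  natural := by
    intro B B' _ _ _ _ _ _ _ _ β A₁ A₂ A₁' A₂' φ₁ φ₂ φ₁' φ₂' f₁ f₂ h₁ h₂ x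
    have e : ((swap A₁' A₂').restrict β).comp (coprodMap β f₁ f₂) =
        (coprodMap β f₂ f₁).comp (swap A₁ A₂) := coprod_hom_ext (fun _ => rfl) (fun _ => rfl)
    have h := P.natural β φ₂ φ₁ φ₂' φ₁' f₂ f₁ h₂ h₁ (swap A₁ A₂ x)
    have e' := congrArg (fun f : Hom _ _ => f x) e
    simp only [Hom.comp_apply] at e'
    rw [← e'] at h
    exact h

theorem op_prod (P : Independence.{u}) {B : Type u} [Ring B] [StarRing B] [Algebra ℂ B]
    [StarModule ℂ B] {A₁ A₂ : BAlg B} (φ₁ : Expectation A₁) (φ₂ : Expectation A₂) :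
    P.op.prod φ₁ φ₂ = (P.prod φ₂ φ₁).comp (swap A₁ A₂) := rfl

theorem op_op (P : Independence.{u}) : P.op.op = P := by
  refine eq_of_prod fun φ₁ φ₂ => Expectation.eq_of_forall fun x => ?_
  rw [op_prod, op_prod]
  simp

theorem op_isOpposite (P : Independence.{u}) : P.op.IsOpposite P := fun _ _ _ => rfl

theorem isOpposite_iff {P Q : Independence.{u}} : Q.IsOpposite P ↔ Q = P.op :=
  ⟨fun h => eq_of_prod fun φ₁ φ₂ => Expectation.eq_of_forall fun x => h φ₁ φ₂ x,
    fun h => h ▸ P.op_isOpposite⟩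

theorem isSymmetric_iff {P : Independence.{u}} : P.IsSymmetric ↔ P.op = P :=
  isOpposite_iff.trans eq_comm

end Independence

end CondProb

/-! ### Matrices over the base, doubles of rings, and ring homomorphisms on coproducts. -/

namespace CondProb

open scoped RightActions

open Uni

/-! ### The algebra `B` and the algebra of `2 × 2` matrices over `B` -/

section Models

variable {B : Type u} [Ring B] [StarRing B] [Algebra ℂ B]

variable (B) in
/-- The base `B` as a `*`-algebra over itself. -/
def selfAlg : BAlg B where
  carrier := B
  smul_op_smul b b' a := mul_assoc b a b'
  smul_mul b a a' := mul_assoc b a a'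
  mul_op_smul b a a' := (mul_assoc a a' b).symm
  op_smul_mul b a a' := mul_assoc a b a'
  star_smul b a := star_mul b a
  complex_smul z a := Algebra.commutes z a

variable (B) in
/-- The identity of `B` as a conditional expectation. -/
def selfExp : Expectation (selfAlg B) where
  toFun a := a
  map_add _ _ := rfl
  map_smul _ _ := rfl
  map_op_smul _ _ := rfl
  positive n x := by
    have h : ∀ p q r s : B, star p * q + (star p * s + star r * q + star r * s) =
        star (p + r) * (q + s) := fun p q r s => by
      rw [star_add]; noncomm_ring
    let y : Fin n → B := fun i => (x i).2
    -- The extension to the unitization is multiplicative, so a single vector suffices.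
    refine ⟨1, fun _ i => (x i).1 + y i, fun i j => ?_⟩
    rw [Fin.sum_univ_one]
    exact h (x i).1 (x j).1 (y i) (y j)

variable (B) in
/-- The algebra of `2 × 2` matrices over `B`. -/
def matAlg : BAlg B where
  carrier := Matrix (Fin 2) (Fin 2) B
  smul_op_smul b b' a := by
    ext i j
    exact mul_assoc b (a i j) b'
  smul_mul b a a' := Matrix.smul_mul b a a'
  mul_op_smul b a a' := Matrix.mul_smul a _ a'
  op_smul_mul b a a' := by
    ext i j
    simp [Matrix.mul_apply, mul_assoc]
  star_smul b a := by
    ext i j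
    simp [Matrix.star_apply]
  complex_smul z a := by
    ext i j
    exact Algebra.commutes z (a i j)

/-- The matrix with the given entries, as an element of `matAlg B`. -/
def mat (m : Matrix (Fin 2) (Fin 2) B) : matAlg B := m

/-- The entries of an element of `matAlg B`. -/
def ent (m : matAlg B) : Matrix (Fin 2) (Fin 2) B := m

@[simp] theorem ent_mat (m : Matrix (Fin 2) (Fin 2) B) : ent (mat m) = m := rfl
@[simp] theorem ent_add (m n : matAlg B) (i j) : ent (m + n) i j = ent m i j + ent n i j := rfl
@[simp] theorem ent_mul (m n : matAlg B) (i j) :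
    ent (m * n) i j = ent m i 0 * ent n 0 j + ent m i 1 * ent n 1 j := by
  have : ent (m * n) i j = ∑ k, ent m i k * ent n k j := Matrix.mul_apply
  rw [this, Fin.sum_univ_two]
@[simp] theorem ent_star (m : matAlg B) (i j) : ent (star m) i j = star (ent m j i) := rfl
@[simp] theorem ent_smul (b : B) (m : matAlg B) (i j) : ent (b • m) i j = b * ent m i j := rfl
@[simp] theorem ent_op_smul (b : B) (m : matAlg B) (i j) :
    ent (m <• b) i j = ent m i j * b := rfl
@[simp] theorem ent_zero (i j) : ent (0 : matAlg B) i j = 0 := rfl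

theorem ent_ext {m n : matAlg B} (h : ∀ i j, ent m i j = ent n i j) : m = n := Matrix.ext h

variable (B) in
/-- The `(0, 0)`-entry as a conditional expectation on the matrices. -/
def matExp : Expectation (matAlg B) where
  toFun m := ent m 0 0
  map_add _ _ := rfl
  map_smul _ _ := rfl
  map_op_smul _ _ := rfl
  -- The vectors are the zeroth columns of the matrices `b + m`: the `(0, 0)`-entry of `x* y` is the
  -- inner product of these columns.
  positive n x := ⟨2, fun k i => (if k = 0 then (x i).1 else 0) + ent (x i).2 k 0, fun i j => by
    simp [star_add]
    noncomm_ring⟩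

@[simp] theorem matExp_apply (m : matAlg B) : matExp B m = ent m 0 0 := rfl

@[simp] theorem selfExp_apply (b : selfAlg B) : selfExp B b = b := rfl

/-- The matrix units. -/
def unit (i j : Fin 2) : matAlg B := mat (Matrix.single i j 1)

theorem ent_unit (i j k l : Fin 2) :
    ent (unit i j : matAlg B) k l = if i = k ∧ j = l then 1 else 0 := by
  simp [unit, Matrix.single_apply]

theorem mat_eq_sum (m : matAlg B) : m = ent m 0 0 • unit 0 0 + ent m 0 1 • unit 0 1 +
    (ent m 1 0 • unit 1 0 + ent m 1 1 • unit 1 1) := by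
  refine ent_ext fun i j => ?_
  fin_cases i <;> fin_cases j <;> simp [ent_unit]

end Models

/-! ### The double of a ring -/

/-- The double `Q × Qᵐᵒᵖ`, a `*`-algebra in which the involution exchanges the components. -/
def Dbl (Q : Type u) [Ring Q] : Type u := Q × Qᵐᵒᵖ

namespace Dbl

variable {Q : Type u} [Ring Q]

instance : Ring (Dbl Q) := inferInstanceAs (Ring (Q × Qᵐᵒᵖ))

/-- The element of the double with the given components. -/
def mk (x y : Q) : Dbl Q := (x, MulOpposite.op y)

/-- The second component. -/
def snd (x : Dbl Q) : Q := MulOpposite.unop x.2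

theorem ext' {x y : Dbl Q} (h₁ : x.1 = y.1) (h₂ : snd x = snd y) : x = y :=
  Prod.ext h₁ (MulOpposite.unop_injective h₂)

@[simp] theorem mk_fst (x y : Q) : (mk x y).1 = x := rfl
@[simp] theorem mk_snd (x y : Q) : snd (mk x y) = y := rfl
@[simp] theorem add_fst (x y : Dbl Q) : (x + y).1 = x.1 + y.1 := rfl
@[simp] theorem add_snd (x y : Dbl Q) : snd (x + y) = snd x + snd y := rfl
@[simp] theorem mul_fst (x y : Dbl Q) : (x * y).1 = x.1 * y.1 := rfl
@[simp] theorem mul_snd (x y : Dbl Q) : snd (x * y) = snd y * snd x := rfl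
@[simp] theorem one_fst : (1 : Dbl Q).1 = 1 := rfl
@[simp] theorem one_snd : snd (1 : Dbl Q) = 1 := rfl
@[simp] theorem zero_fst : (0 : Dbl Q).1 = 0 := rfl
@[simp] theorem zero_snd : snd (0 : Dbl Q) = 0 := rfl

instance : StarRing (Dbl Q) where
  star x := mk (snd x) x.1
  star_involutive _ := rfl
  star_mul _ _ := rfl
  star_add _ _ := rfl

theorem star_mk (x y : Q) : star (mk x y) = mk y x := rfl
@[simp] theorem star_fst (x : Dbl Q) : (star x).1 = snd x := rfl
@[simp] theorem star_snd (x : Dbl Q) : snd (star x) = x.1 := rfl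

variable [Algebra ℂ Q]

instance : Algebra ℂ (Dbl Q) := RingHom.toAlgebra'
  { toFun := fun z => mk (algebraMap ℂ Q z) (algebraMap ℂ Q (star z))
    map_one' := ext' (by simp) (by simp)
    map_mul' := fun z w => ext' (by simp) (by simp only [mk_snd, mul_snd, star_mul, map_mul])
    map_zero' := ext' (by simp) (by simp)
    map_add' := fun z w => ext' (by simp) (by simp) }
  (fun z x => ext' (Algebra.commutes z x.1) (Algebra.commutes (star z) (snd x)).symm)

theorem algebraMap_eq (z : ℂ) :
    algebraMap ℂ (Dbl Q) z = mk (algebraMap ℂ Q z) (algebraMap ℂ Q (star z)) := rfl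

instance : StarModule ℂ (Dbl Q) where
  star_smul z x := by
    rw [Algebra.smul_def, Algebra.smul_def, star_mul, Algebra.commutes]
    congr 1
    rw [algebraMap_eq, algebraMap_eq, star_star]
    rfl

end Dbl

/-! ### Rings under `B` -/

section Cen

variable {B : Type u} [Ring B] [StarRing B] [Algebra ℂ B]
variable {R : Type u} [Ring R]

/-- The centralizer of the complex numbers in a ring under `B`. -/
def Cen (ι : B →+* R) : Subring R :=
  Subring.centralizer (Set.range fun z : ℂ => ι (algebraMap ℂ B z))

theorem mem_cen {ι : B →+* R} {x : R} :
    x ∈ Cen ι ↔ ∀ z : ℂ, ι (algebraMap ℂ B z) * x = x * ι (algebraMap ℂ B z) := by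
  simp [Cen, Subring.mem_centralizer_iff]

theorem base_mem_cen (ι : B →+* R) (b : B) : ι b ∈ Cen ι :=
  mem_cen.2 fun z => by rw [← map_mul, ← map_mul, Algebra.commutes]

instance (ι : B →+* R) : Algebra ℂ (Cen ι) := RingHom.toAlgebra'
  { toFun := fun z => ⟨ι (algebraMap ℂ B z), base_mem_cen ι _⟩
    map_one' := Subtype.ext (by simp)
    map_mul' := fun z w => Subtype.ext (by simp)
    map_zero' := Subtype.ext (by simp)
    map_add' := fun z w => Subtype.ext (by simp) }
  (fun z x => Subtype.ext (mem_cen.1 x.2 z))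

/-- The base change to the double of a ring under `B`. -/
def toDbl [StarModule ℂ B] (ι : B →+* R) : B →⋆ₐ[ℂ] Dbl (Cen ι) where
  toFun b := Dbl.mk ⟨ι b, base_mem_cen ι b⟩ ⟨ι (star b), base_mem_cen ι _⟩
  map_one' := Dbl.ext' (Subtype.ext (by simp)) (Subtype.ext (by simp))
  map_mul' b b' := Dbl.ext' (Subtype.ext (by simp)) (Subtype.ext (by simp))
  map_zero' := Dbl.ext' (Subtype.ext (by simp)) (Subtype.ext (by simp))
  map_add' b b' := Dbl.ext' (Subtype.ext (by simp)) (Subtype.ext (by simp))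
  commutes' z := by
    rw [Dbl.algebraMap_eq]
    refine Dbl.ext' rfl (Subtype.ext ?_)
    change ι (star (algebraMap ℂ B z)) = ι (algebraMap ℂ B (star z))
    rw [algebraMap_star_comm]
  map_star' b := Dbl.ext' rfl (Subtype.ext (by simp))

@[simp] theorem toDbl_fst [StarModule ℂ B] (ι : B →+* R) (b : B) :
    ((toDbl ι b).1 : R) = ι b := rfl
@[simp] theorem toDbl_snd [StarModule ℂ B] (ι : B →+* R) (b : B) :
    ((toDbl ι b).snd : R) = ι (star b) := rfl

variable {A A₁ A₂ : BAlg B}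

theorem ringHom_smul (f : Uni A →+* R) (b : B) (a : A) :
    f (ofA (b • a)) = f (ofB b) * f (ofA a) := by rw [ofA_smul, map_mul]

theorem ringHom_op_smul (f : Uni A →+* R) (b : B) (a : A) :
    f (ofA (a <• b)) = f (ofA a) * f (ofB b) := by rw [ofA_op_smul, map_mul]

/-- Here `complex_smul` enters: the scalars act alike from both sides, so the image of `A` commutes
with them even though the ring itself need not be a complex algebra. -/
theorem ringHom_mem_cen {ι : B →+* R} (f : Uni A →+* R) (hf : ∀ b, f (ofB b) = ι b) (a : A) :
    f (ofA a) ∈ Cen ι := mem_cen.2 fun z => by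
  rw [← hf, ← map_mul, ← map_mul, ← ofA_smul, ← ofA_op_smul, A.complex_smul]

/-- A ring homomorphism on `B ⊕ A` as a `*`-homomorphism into the double. -/
def dblHom [StarModule ℂ B] {ι : B →+* R} (f : Uni A →+* R) (hf : ∀ b, f (ofB b) = ι b) :
    Hom A (restrict (toDbl ι) (selfAlg (Dbl (Cen ι)))) where
  toFun a := Dbl.mk ⟨f (ofA a), ringHom_mem_cen f hf a⟩
    ⟨f (ofA (star a)), ringHom_mem_cen f hf (star a)⟩
  map_add a a' := Dbl.ext' (Subtype.ext (by simp [ofA_add]; rfl))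
    (Subtype.ext (by simp [ofA_add]; rfl))
  map_mul a a' := Dbl.ext' (Subtype.ext (by simp [ofA_mul]; rfl))
    (Subtype.ext (by simp [ofA_mul]; rfl))
  map_star a := Dbl.ext' (Subtype.ext (by simp; rfl)) (Subtype.ext (by simp; rfl))
  map_smul b a := by
    refine Dbl.ext' (Subtype.ext ?_) (Subtype.ext ?_)
    · change f (ofA (b • a)) = ι b * f (ofA a)
      rw [ringHom_smul, hf]
    · change f (ofA (star (b • a))) = f (ofA (star a)) * ι (star b)
      rw [A.star_smul, ringHom_op_smul, hf]
  map_op_smul b a := by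
    refine Dbl.ext' (Subtype.ext ?_) (Subtype.ext ?_)
    · change f (ofA (a <• b)) = f (ofA a) * ι b
      rw [ringHom_op_smul, hf]
    · change f (ofA (star (a <• b))) = ι (star b) * f (ofA (star a))
      rw [star_op_smul, ringHom_smul, hf]

/-- Homomorphisms from `B ⊕ A₁` and `B ⊕ A₂` to a ring that agree on `B` extend to
`B ⊕ (A₁ ⊔ A₂)`. -/
theorem exists_ringLift [StarModule ℂ B] (f₁ : Uni A₁ →+* R) (f₂ : Uni A₂ →+* R)
    (h : ∀ b, f₂ (ofB b) = f₁ (ofB b)) : ∃ F : Uni (coprod A₁ A₂) →+* R,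
      (∀ x, F (map (inl A₁ A₂) x) = f₁ x) ∧ ∀ x, F (map (inr A₁ A₂) x) = f₂ x := by
  let ι : B →+* R := f₁.comp (ofBHom A₁)
  -- The coproduct only knows homomorphisms into `*`-algebras over `B`. The double of the
  -- centralizer of the scalars is one, and its first component recovers the given ring
  -- homomorphisms.
  let G : Hom (coprod A₁ A₂) (restrict (toDbl ι) (selfAlg (Dbl (Cen ι)))) :=
    lift (dblHom f₁ fun _ => rfl) (dblHom f₂ h)
  let g : coprod A₁ A₂ → R := fun x => ((G x).1 : R)
  have g_add : ∀ x y, g (x + y) = g x + g y := fun x y => by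
    simp only [g, G.map_add]; rfl
  have g_mul : ∀ x y, g (x * y) = g x * g y := fun x y => by
    simp only [g, G.map_mul]; rfl
  have g_smul : ∀ b x, g (b • x) = ι b * g x := fun b x => by
    simp only [g, G.map_smul]; rfl
  have g_op : ∀ b x, g (x <• b) = g x * ι b := fun b x => by
    simp only [g, G.map_op_smul]; rfl
  have g_zero : g 0 = 0 := by
    have := g_add 0 0
    simpa using this
  refine ⟨{ toFun := fun x => ι x.1 + g x.2
            map_one' := by simp [g_zero]
            map_mul' := fun x y => by
              simp only [Uni.mul_fst, Uni.mul_snd, g_add, g_mul, g_smul, g_op, map_mul]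
              noncomm_ring
            map_zero' := by simp [g_zero]
            map_add' := fun x y => by
              simp only [Uni.add_fst, Uni.add_snd, g_add, map_add]
              abel }, fun x => ?_, fun x => ?_⟩
  · conv_rhs => rw [eq_add x, map_add]
    rfl
  · conv_rhs => rw [eq_add x, map_add, h]
    rfl

end Cen

end CondProb

/-! ### Dilation of expectations to matrices of operators on a Fock space. -/

namespace CondProb

open scoped RightActions

open Uni

/-! ### Full Fock spaces -/

section Fock

variable {B : Type u} [Ring B] {X : Type u} [AddCommGroup X] [Module B X] [Module Bᵐᵒᵖ X]

/-- The left action of `B` on functions on words: `b` acts on the first letter. -/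
def wordAct (b : B) (h : List X → B) : List X → B
  | [] => b * h []
  | x :: w => h ((x <• b) :: w)

/-- The functions on words that are additive and left `B`-linear in every letter. -/
def IsMultilinear (h : List X → B) : Prop :=
  ∀ u : List X, (∀ x y w, h (u ++ (x + y) :: w) = h (u ++ x :: w) + h (u ++ y :: w)) ∧
    ∀ (b : B) x w, h (u ++ (b • x) :: w) = wordAct b (fun w => h (u ++ x :: w)) w

variable (B X) in
/-- The (dual) full Fock space of the bimodule `X`. -/
def Fock : AddSubgroup (List X → B) where
  carrier := {h | IsMultilinear h}
  zero_mem' u := ⟨fun _ _ _ => by simp, fun b x w => by cases w <;> simp [wordAct]⟩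
  add_mem' {h k} hh hk u := by
    refine ⟨fun x y w => ?_, fun b x w => ?_⟩
    · simp only [Pi.add_apply, (hh u).1, (hk u).1]
      abel
    · simp only [Pi.add_apply, (hh u).2, (hk u).2]
      cases w <;> simp [wordAct, mul_add]
  neg_mem' {h} hh u := by
    refine ⟨fun x y w => ?_, fun b x w => ?_⟩
    · simp only [Pi.neg_apply, (hh u).1]
      abel
    · simp only [Pi.neg_apply, (hh u).2]
      cases w <;> simp [wordAct]

/-- An additive map as an endomorphism over the integers. -/
def addEnd {V : Type u} [AddCommGroup V] (f : V → V) (hf : ∀ x y, f (x + y) = f x + f y) :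
    Module.End ℤ V := (AddMonoidHom.mk' f hf).toIntLinearMap

@[simp] theorem addEnd_apply {V : Type u} [AddCommGroup V] (f : V → V) (hf) (x : V) :
    addEnd f hf x = f x := rfl

namespace Fock

theorem ext' {h k : Fock B X} (e : ∀ w, h.1 w = k.1 w) : h = k := Subtype.ext (funext e)

@[simp] theorem add_apply (h k : Fock B X) (w : List X) : (h + k).1 w = h.1 w + k.1 w := rfl

theorem head_add (h : Fock B X) (x y : X) (w : List X) :
    h.1 ((x + y) :: w) = h.1 (x :: w) + h.1 (y :: w) := (h.2 []).1 x y w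

variable [SMulCommClass B Bᵐᵒᵖ X]

set_option linter.unusedSectionVars false

/-- The left action of `B` on the Fock space. -/
def act (b : B) (h : Fock B X) : Fock B X := ⟨wordAct b h.1, fun u => by
  cases u with
  | nil =>
    refine ⟨fun x y w => ?_, fun b' x w => ?_⟩
    · simp [wordAct, head_add h]
    · have := (h.2 []).2 b' (x <• b) w
      simp only [List.nil_append] at this
      simp only [List.nil_append, wordAct]
      rw [← smul_comm b' (MulOpposite.op b) x, this]
      cases w <;> rfl
  | cons y u =>
    have := h.2 ((y <• b) :: u)
    exact this⟩

@[simp] theorem act_nil (b : B) (h : Fock B X) : (act b h).1 [] = b * h.1 [] := rfl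
@[simp] theorem act_cons (b : B) (h : Fock B X) (x : X) (w : List X) :
    (act b h).1 (x :: w) = h.1 ((x <• b) :: w) := rfl

variable (B X) in
/-- The left action of `B` on the Fock space as a ring homomorphism. -/
def base : B →+* Module.End ℤ (Fock B X) where
  toFun b := addEnd (act b) fun h k => ext' fun w => by cases w <;> simp [mul_add]
  map_one' := LinearMap.ext fun h => ext' fun w => by cases w <;> simp
  map_mul' b b' := LinearMap.ext fun h => ext' fun w => by
    cases w <;> simp [mul_assoc, mul_smul]
  map_zero' := LinearMap.ext fun h => ext' fun w => by
    cases w with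
    | nil => simp
    | cons x w =>
      have := head_add h 0 0 w
      simpa using this
  map_add' b b' := LinearMap.ext fun h => ext' fun w => by
    cases w <;> simp [add_mul, add_smul, head_add h]

@[simp] theorem base_apply (b : B) (h : Fock B X) : base B X b h = act b h := rfl

variable (B X) in
/-- The vacuum. -/
def vac : Fock B X := ⟨fun w => if w = [] then 1 else 0, fun u =>
  ⟨fun x y w => by simp, fun b x w => by cases w <;> simp [wordAct]⟩⟩

@[simp] theorem vac_nil : (vac B X).1 [] = 1 := rfl

theorem act_vac_nil (b : B) : (act b (vac B X)).1 [] = b := by simp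

/-- The vacuum separates the base: `b` is the coefficient of the empty word in `b` applied to the
vacuum. -/
theorem base_injective : Function.Injective (base B X) := fun b b' h => by
  have := congrArg (fun T : Module.End ℤ (Fock B X) => (T (vac B X)).1 []) h
  simpa using this

/-- Removal of the first letter. -/
def tail (x : X) (h : Fock B X) : Fock B X := ⟨fun w => h.1 (x :: w), fun u => h.2 (x :: u)⟩

@[simp] theorem tail_apply (x : X) (h : Fock B X) (w : List X) :
    (tail x h).1 w = h.1 (x :: w) := rfl

/-- The element of the Fock space with given tails. -/
def cons (k : X → Fock B X) (hadd : ∀ x y, k (x + y) = k x + k y)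
    (hsmul : ∀ (b : B) x, k (b • x) = act b (k x)) : Fock B X :=
  ⟨fun w => match w with
    | [] => 0
    | x :: w => (k x).1 w, fun u => by
  cases u with
  | nil =>
    refine ⟨fun x y w => ?_, fun b x w => ?_⟩
    · simp [hadd]
    · simp only [List.nil_append, hsmul]
      rfl
  | cons y u => exact (k y).2 u⟩

@[simp] theorem cons_nil (k : X → Fock B X) (h₁ h₂) : (cons k h₁ h₂).1 [] = 0 := rfl
@[simp] theorem cons_cons (k : X → Fock B X) (h₁ h₂) (x : X) (w : List X) :
    (cons k h₁ h₂).1 (x :: w) = (k x).1 w := rfl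

end Fock

end Fock

/-! ### Dilation of a conditional expectation to matrices -/

section Dilation

set_option linter.unusedSectionVars false

variable {B : Type u} [Ring B] [StarRing B] [Algebra ℂ B]

instance (A : BAlg B) : SMulCommClass B Bᵐᵒᵖ A :=
  ⟨fun b b' a => (A.smul_op_smul b b'.unop a).symm⟩

/-- The bimodule `A` is a direct summand of the bimodule `X`. -/
structure Summand (A : BAlg B) (X : Type u) [AddCommGroup X] [Module B X] [Module Bᵐᵒᵖ X] where
  incl : A →+ X
  proj : X →+ A
  proj_incl : ∀ a, proj (incl a) = a
  incl_smul : ∀ (b : B) a, incl (b • a) = b • incl a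
  incl_op_smul : ∀ (b : B) a, incl (a <• b) = incl a <• b
  proj_smul : ∀ (b : B) x, proj (b • x) = b • proj x
  proj_op_smul : ∀ (b : B) x, proj (x <• b) = proj x <• b

variable (A₁ A₂ : BAlg B)

/-- The first summand. -/
def summandLeft : Summand A₁ (A₁ × A₂) where
  incl := AddMonoidHom.inl A₁ A₂
  proj := AddMonoidHom.fst A₁ A₂
  proj_incl _ := rfl
  incl_smul b a := by ext <;> simp
  incl_op_smul b a := by ext <;> simp
  proj_smul _ _ := rfl
  proj_op_smul _ _ := rfl

/-- The second summand. -/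
def summandRight : Summand A₂ (A₁ × A₂) where
  incl := AddMonoidHom.inr A₁ A₂
  proj := AddMonoidHom.snd A₁ A₂
  proj_incl _ := rfl
  incl_smul b a := by ext <;> simp
  incl_op_smul b a := by ext <;> simp
  proj_smul _ _ := rfl
  proj_op_smul _ _ := rfl

variable {A₁ A₂} {A : BAlg B} {X : Type u} [AddCommGroup X] [Module B X] [Module Bᵐᵒᵖ X]
  [SMulCommClass B Bᵐᵒᵖ X] (r : Summand A X) (φ : Expectation A)

open Fock

namespace Summand

/-- The pairing of `B ⊕ A` with two copies of the Fock space. -/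
def pair (h : Fin 2 → Fock B X) (z : Uni A) : Fock B X :=
  act (φ.ext z) (h 0) + tail (r.incl z.2) (h 1)

theorem pair_add (h : Fin 2 → Fock B X) (z z' : Uni A) :
    r.pair φ h (z + z') = r.pair φ h z + r.pair φ h z' := by
  have e : act (φ.ext (z + z')) (h 0) = act (φ.ext z) (h 0) + act (φ.ext z') (h 0) := by
    rw [φ.ext_add]
    exact congrArg (fun T : Module.End ℤ (Fock B X) => T (h 0)) ((base B X).map_add _ _)
  rw [pair, e]
  refine ext' fun w => ?_
  simp [pair, head_add]
  abel

theorem pair_ofB_mul (h : Fin 2 → Fock B X) (b : B) (z : Uni A) :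
    r.pair φ h (ofB b * z) = act b (r.pair φ h z) := by
  have e : act (φ.ext (ofB b * z)) (h 0) = act b (act (φ.ext z) (h 0)) := by
    rw [φ.ext_ofB_mul]
    exact congrArg (fun T : Module.End ℤ (Fock B X) => T (h 0)) ((base B X).map_mul _ _)
  have e' : tail (r.incl (ofB b * z : Uni A).2) (h 1) = act b (tail (r.incl z.2) (h 1)) := by
    refine ext' fun w => ?_
    have := ((h 1).2 []).2 b (r.incl z.2) w
    simp only [List.nil_append] at this
    simp only [mul_snd, ofB_fst, ofB_snd, smul_zero, zero_mul, add_zero,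
      tail_apply, r.incl_smul]
    rw [this]
    cases w <;> rfl
  have e'' : ∀ k l : Fock B X, act b (k + l) = act b k + act b l := fun k l =>
    (base B X b).map_add k l
  rw [pair, e, e', pair, e'']

theorem pair_vec_add (h k : Fin 2 → Fock B X) (z : Uni A) :
    r.pair φ (h + k) z = r.pair φ h z + r.pair φ k z := by
  have e'' : ∀ b (k l : Fock B X), act b (k + l) = act b k + act b l := fun b k l =>
    (base B X b).map_add k l
  refine ext' fun w => ?_
  simp [pair, e'']
  abel

/-- The centred element corresponding to a letter. -/
def centred (x : X) : Uni A := ofA (r.proj x) - ofB (φ (r.proj x))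

theorem centred_add (x y : X) :
    r.centred φ (x + y) = r.centred φ x + r.centred φ y := by
  simp only [centred, map_add, φ.map_add, ofA_add, ofB_add]
  abel

theorem centred_smul (b : B) (x : X) : r.centred φ (b • x) = ofB b * r.centred φ x := by
  simp only [centred, r.proj_smul, φ.map_smul, ofA_smul, ofB_mul, mul_sub]

/-- The operator of right multiplication by `z` on the functions on `B ⊕ A`. -/
def translate (z : Uni A) (h : Fin 2 → Fock B X) : Fin 2 → Fock B X :=
  ![r.pair φ h z, cons (fun x => r.pair φ h (r.centred φ x * z))
    (fun x y => by rw [centred_add, add_mul, pair_add])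
    (fun b x => by rw [centred_smul, mul_assoc, pair_ofB_mul])]

@[simp] theorem translate_zero (z : Uni A) (h : Fin 2 → Fock B X) :
    r.translate φ z h 0 = r.pair φ h z := rfl

/-- A vector `h` is read as the left `B`-linear map `r.pair φ h` on `B ⊕ A`: `h 0` is its value at
`1`, and the tails of `h 1` at letters from `A` are its values at the centred elements `a - φ(a)`.
In this reading `translate` is precomposition with a right multiplication, and the claim follows by
splitting `z'` into its expectation and its centred part. -/
theorem pair_translate (z z' : Uni A) (h : Fin 2 → Fock B X) :
    r.pair φ (r.translate φ z h) z' = r.pair φ h (z' * z) := by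
  have e : tail (r.incl z'.2) (r.translate φ z h 1) =
      r.pair φ h ((ofA z'.2 - ofB (φ z'.2)) * z) := by
    refine ext' fun w => ?_
    simp [translate, centred, r.proj_incl]
  rw [pair, e, translate_zero, ← pair_ofB_mul, ← pair_add, ← add_mul]
  congr 2
  conv_rhs => rw [eq_add z']
  rw [Expectation.ext, ofB_add]
  abel

theorem translate_translate (z z' : Uni A) (h : Fin 2 → Fock B X) :
    r.translate φ z' (r.translate φ z h) = r.translate φ (z' * z) h := by
  funext i
  fin_cases i
  · exact r.pair_translate φ z z' h
  · refine ext' fun w => ?_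
    cases w with
    | nil => rfl
    | cons x w =>
      have := r.pair_translate φ z (r.centred φ x * z') h
      rw [mul_assoc] at this
      exact congrArg (fun k : Fock B X => k.1 w) this

theorem translate_add (z z' : Uni A) (h : Fin 2 → Fock B X) :
    r.translate φ (z + z') h = r.translate φ z h + r.translate φ z' h := by
  funext i
  fin_cases i
  · exact r.pair_add φ h z z'
  · refine ext' fun w => ?_
    cases w with
    | nil => simp [translate]
    | cons x w => simp [translate, mul_add, pair_add]

theorem translate_vec_add (z : Uni A) (h k : Fin 2 → Fock B X) :
    r.translate φ z (h + k) = r.translate φ z h + r.translate φ z k := by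
  funext i
  fin_cases i
  · exact r.pair_vec_add φ h k z
  · refine ext' fun w => ?_
    cases w with
    | nil => simp [translate]
    | cons x w => simp [translate, pair_vec_add]

/-- Together with `translate_act` this lets the diagonal action of `B` be absorbed into `translate`
on either side, as multiplicativity of `rep` requires. -/
theorem act_translate (b : B) (z : Uni A) (h : Fin 2 → Fock B X) :
    (fun i => act b (r.translate φ z h i)) = r.translate φ (ofB b * z) h := by
  funext i
  fin_cases i
  · exact (r.pair_ofB_mul φ h b z).symm
  · refine ext' fun w => ?_
    cases w with
    | nil => simp [translate]
    | cons x w =>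
      have e : r.centred φ (x <• b) * z = r.centred φ x * (ofB b * z) := by
        rw [← mul_assoc]
        congr 1
        simp only [centred, r.proj_op_smul, φ.map_op_smul, ofA_op_smul, ofB_mul, sub_mul]
      exact congrArg (fun y => (r.pair φ h y).1 w) e

theorem pair_act (b : B) (z : Uni A) (h : Fin 2 → Fock B X) :
    r.pair φ (fun i => act b (h i)) z = r.pair φ h (z * ofB b) := by
  have e : act (φ.ext (z * ofB b)) (h 0) = act (φ.ext z) (act b (h 0)) := by
    rw [φ.ext_mul_ofB]
    exact congrArg (fun T : Module.End ℤ (Fock B X) => T (h 0)) ((base B X).map_mul _ _)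
  rw [pair, pair, e]
  congr 1
  refine ext' fun w => ?_
  simp [r.incl_op_smul]

theorem translate_act (b : B) (z : Uni A) (h : Fin 2 → Fock B X) :
    r.translate φ z (fun i => act b (h i)) = r.translate φ (z * ofB b) h := by
  funext i
  fin_cases i
  · exact r.pair_act φ b z h
  · refine ext' fun w => ?_
    cases w with
    | nil => rfl
    | cons x w =>
      have e := r.pair_act φ b (r.centred φ x * z) h
      rw [mul_assoc] at e
      exact congrArg (fun k : Fock B X => k.1 w) e

/-- The representation of `B ⊕ A` on two copies of the Fock space. -/
def rep : Uni A →+* Module.End ℤ (Fin 2 → Fock B X) where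
  -- `translate` at `1` is only a projection: it forgets `h 1` at the empty word and at letters
  -- outside `A`. Hence only `A` acts through it, and `B` acts diagonally.
  toFun z := addEnd (fun h => (fun i => act z.1 (h i)) + r.translate φ (ofA z.2) h)
    fun h k => by
      have e : (fun i => act z.1 ((h + k) i)) = (fun i => act z.1 (h i)) +
          fun i => act z.1 (k i) := funext fun i => (base B X z.1).map_add (h i) (k i)
      rw [e, translate_vec_add]
      abel
  map_one' := LinearMap.ext fun h => by
    have e : (fun i => act (1 : B) (h i)) = h :=
      funext fun i => congrArg (fun T : Module.End ℤ (Fock B X) => T (h i)) (base B X).map_one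
    have e' : r.translate φ 0 h = 0 := by
      have := r.translate_add φ 0 0 h
      simpa using this
    simp [e, e']
  map_mul' z z' := LinearMap.ext fun h => by
    have e : ∀ k l : Fin 2 → Fock B X, (fun i => act z.1 ((k + l) i)) =
        (fun i => act z.1 (k i)) + fun i => act z.1 (l i) :=
      fun k l => funext fun i => (base B X z.1).map_add (k i) (l i)
    have e' : (fun i => act (z * z').1 (h i)) = fun i => act z.1 (act z'.1 (h i)) :=
      funext fun i => congrArg (fun T : Module.End ℤ (Fock B X) => T (h i))
        ((base B X).map_mul z.1 z'.1)
    have e'' : (ofA (z * z').2 : Uni A) = ofB z.1 * ofA z'.2 + ofA z.2 * ofB z'.1 +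
        ofA z.2 * ofA z'.2 := by
      rw [mul_snd, ofA_add, ofA_add, ofA_smul, ofA_op_smul, ofA_mul]
    simp only [addEnd_apply, Module.End.mul_apply]
    rw [e, translate_vec_add, translate_translate, translate_act, act_translate, e', e'',
      translate_add, translate_add]
    abel
  map_zero' := LinearMap.ext fun h => by
    have e : (fun i => act (0 : B) (h i)) = 0 :=
      funext fun i => congrArg (fun T : Module.End ℤ (Fock B X) => T (h i)) (base B X).map_zero
    have e' : r.translate φ 0 h = 0 := by
      have := r.translate_add φ 0 0 h
      simpa using this
    simp [e, e']
  map_add' z z' := LinearMap.ext fun h => by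
    have e : (fun i => act (z + z').1 (h i)) =
        (fun i => act z.1 (h i)) + fun i => act z'.1 (h i) :=
      funext fun i => congrArg (fun T : Module.End ℤ (Fock B X) => T (h i))
        ((base B X).map_add z.1 z'.1)
    simp only [addEnd_apply, LinearMap.add_apply]
    rw [e, add_snd, ofA_add, translate_add]
    abel

/-- The representation of `B ⊕ A` by `2 × 2` matrices of operators on the Fock space. -/
def matRep : Uni A →+* Matrix (Fin 2) (Fin 2) (Module.End ℤ (Fock B X)) :=
  (endVecRingEquivMatrixEnd (Fin 2) ℤ (Fock B X) : _ →+* _).comp (r.rep φ)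

theorem matRep_apply (z : Uni A) (i j : Fin 2) (h : Fock B X) :
    r.matRep φ z i j h = r.rep φ z (Pi.single j h) i := rfl

theorem matRep_ofB (b : B) (i j : Fin 2) :
    r.matRep φ (ofB b) i j = if i = j then base B X b else 0 := by
  refine LinearMap.ext fun h => ?_
  have e' : r.translate φ 0 (Pi.single j h) = 0 := by
    have := r.translate_add φ 0 0 (Pi.single j h)
    simpa using this
  have e : r.matRep φ (ofB b) i j h = base B X b (Pi.single (M := fun _ => Fock B X) j h i) +
      r.translate φ (ofA 0) (Pi.single j h) i := rfl
  rw [e, ofA_zero, e']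
  by_cases hij : i = j
  · subst hij
    simp
  · rw [Pi.single_eq_of_ne hij, map_zero]
    simp [hij]

/-- This makes the representation a dilation: on a vector with second component zero, the pairing at
`a` leaves only the action of `φ a`. -/
theorem matRep_ofA (a : A) : r.matRep φ (ofA a) 0 0 = base B X (φ a) := by
  refine LinearMap.ext fun h => ?_
  have e : r.matRep φ (ofA a) 0 0 h = base B X 0 h +
      (base B X (φ.ext (ofA a)) h + tail (r.incl a) 0) := rfl
  have e' : tail (r.incl a) (0 : Fock B X) = 0 := rfl
  rw [e, e', φ.ext_ofA, map_zero]
  simp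

variable [StarModule ℂ B]

/-- The entries have to lie in the centralizer of the scalars in order to belong to a complex
algebra, the new base. -/
theorem matRep_mem (a : A) (i j : Fin 2) : r.matRep φ (ofA a) i j ∈ Cen (base B X) :=
  mem_cen.2 fun z => by
    have h : r.matRep φ (ofB (algebraMap ℂ B z) * ofA a) =
        r.matRep φ (ofA a * ofB (algebraMap ℂ B z)) := by
      rw [← ofA_smul, ← ofA_op_smul, A.complex_smul]
    have h' := congrFun (congrFun h i) j
    simpa [map_mul, Matrix.mul_apply, matRep_ofB] using h'

/-- The dilation of a conditional expectation to matrices over a larger base. -/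
def dilation : Hom A (restrict (toDbl (base B X)) (matAlg (Dbl (Cen (base B X))))) where
  -- The second component carries `star a` with transposed indices, so that exchanging the
  -- components of all entries and transposing turns the image of `a` into that of `star a`.
  toFun a := mat fun i j => Dbl.mk ⟨r.matRep φ (ofA a) i j, r.matRep_mem φ a i j⟩
    ⟨r.matRep φ (ofA (star a)) j i, r.matRep_mem φ (star a) j i⟩
  map_add a a' := ent_ext fun i j => Dbl.ext'
    (Subtype.ext (congrFun (congrFun ((congrArg _ (ofA_add a a')).trans
      ((r.matRep φ).map_add _ _)) i) j))
    (Subtype.ext (by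
      rw [show star (a + a') = star a + star a' from star_add a a']
      exact congrFun (congrFun ((congrArg _ (ofA_add _ _)).trans
        ((r.matRep φ).map_add _ _)) j) i))
  map_mul a a' := ent_ext fun i j => by
    have h : ∀ (x y : A) (i j : Fin 2), r.matRep φ (ofA (x * y)) i j =
        r.matRep φ (ofA x) i 0 * r.matRep φ (ofA y) 0 j +
          r.matRep φ (ofA x) i 1 * r.matRep φ (ofA y) 1 j := fun x y i j => by
      rw [ofA_mul, map_mul, Matrix.mul_apply, Fin.sum_univ_two]
    refine (Eq.trans ?_ (ent_mul _ _ i j).symm)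
    refine Dbl.ext' (Subtype.ext (h a a' i j)) (Subtype.ext ?_)
    refine Eq.trans ?_ (h (star a') (star a) j i)
    rw [← star_mul]
    rfl
  map_star a := ent_ext fun i j => by
    have h : r.matRep φ (ofA (star (star a))) j i = r.matRep φ (ofA a) j i := by rw [star_star]
    refine Eq.trans ?_ (ent_star _ i j).symm
    refine Eq.trans ?_ (Dbl.star_mk _ _).symm
    exact congrArg (Dbl.mk _) (Subtype.ext h)
  map_smul b a := ent_ext fun i j => by
    refine Dbl.ext' (Subtype.ext ?_) (Subtype.ext ?_)
    · change r.matRep φ (ofA (b • a)) i j = base B X b * r.matRep φ (ofA a) i j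
      rw [ofA_smul, map_mul, Matrix.mul_apply]
      simp [matRep_ofB]
    · change r.matRep φ (ofA (star (b • a))) j i =
        r.matRep φ (ofA (star a)) j i * base B X (star b)
      rw [A.star_smul, ofA_op_smul, map_mul, Matrix.mul_apply]
      simp [matRep_ofB]
  map_op_smul b a := ent_ext fun i j => by
    refine Dbl.ext' (Subtype.ext ?_) (Subtype.ext ?_)
    · change r.matRep φ (ofA (a <• b)) i j = r.matRep φ (ofA a) i j * base B X b
      rw [ofA_op_smul, map_mul, Matrix.mul_apply]
      simp [matRep_ofB]
    · change r.matRep φ (ofA (star (a <• b))) j i =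
        base B X (star b) * r.matRep φ (ofA (star a)) j i
      rw [star_op_smul, ofA_smul, map_mul, Matrix.mul_apply]
      simp [matRep_ofB]

theorem matExp_dilation (a : A) :
    matExp _ (r.dilation φ a) = toDbl (base B X) (φ a) := by
  refine Dbl.ext' (Subtype.ext (r.matRep_ofA φ a)) (Subtype.ext ?_)
  refine (r.matRep_ofA φ (star a)).trans ?_
  rw [φ.map_star]
  rfl

end Summand

/-- No information is lost under the change of base, so identities in `B` may be tested after
dilation. -/
theorem toDbl_base_injective [StarModule ℂ B] : Function.Injective (toDbl (base B X)) :=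
  fun b b' h => base_injective (congrArg (fun x : Dbl (Cen (base B X)) => x.1.1) h)

end Dilation

end CondProb

/-! ### Letters in the coproduct, and the boolean product as an expectation. -/

namespace CondProb

open scoped RightActions

open Uni

section Words

set_option linter.unusedSectionVars false

variable {B : Type u} [Ring B] [StarRing B] [Algebra ℂ B]

/-- An element of `A₁`, as an element of `B ⊕ (A₁ ⊔ A₂)`. -/
def wl (A₁ A₂ : BAlg B) (a : A₁) : Uni (coprod A₁ A₂) := ofA (inl A₁ A₂ a)

/-- An element of `A₂`, as an element of `B ⊕ (A₁ ⊔ A₂)`. -/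
def wr (A₁ A₂ : BAlg B) (a : A₂) : Uni (coprod A₁ A₂) := ofA (inr A₁ A₂ a)

variable {A A₁ A₂ A₃ : BAlg B}

@[simp] theorem wl_zero : wl A₁ A₂ 0 = 0 := by rw [wl, (inl A₁ A₂).map_zero, ofA_zero]
@[simp] theorem wr_zero : wr A₁ A₂ 0 = 0 := by rw [wr, (inr A₁ A₂).map_zero, ofA_zero]
theorem wl_add (a a' : A₁) : wl A₁ A₂ (a + a') = wl A₁ A₂ a + wl A₁ A₂ a' := by
  rw [wl, (inl A₁ A₂).map_add, ofA_add, wl, wl]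
theorem wr_add (a a' : A₂) : wr A₁ A₂ (a + a') = wr A₁ A₂ a + wr A₁ A₂ a' := by
  rw [wr, (inr A₁ A₂).map_add, ofA_add, wr, wr]
theorem wl_mul (a a' : A₁) : wl A₁ A₂ (a * a') = wl A₁ A₂ a * wl A₁ A₂ a' := by
  rw [wl, (inl A₁ A₂).map_mul, ofA_mul, wl, wl]
theorem wr_mul (a a' : A₂) : wr A₁ A₂ (a * a') = wr A₁ A₂ a * wr A₁ A₂ a' := by
  rw [wr, (inr A₁ A₂).map_mul, ofA_mul, wr, wr]
theorem wl_smul (b : B) (a : A₁) : wl A₁ A₂ (b • a) = ofB b * wl A₁ A₂ a := by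
  rw [wl, (inl A₁ A₂).map_smul, ofA_smul, wl]
theorem wr_smul (b : B) (a : A₂) : wr A₁ A₂ (b • a) = ofB b * wr A₁ A₂ a := by
  rw [wr, (inr A₁ A₂).map_smul, ofA_smul, wr]
theorem wl_op_smul (b : B) (a : A₁) : wl A₁ A₂ (a <• b) = wl A₁ A₂ a * ofB b := by
  rw [wl, (inl A₁ A₂).map_op_smul, ofA_op_smul, wl]
theorem wr_op_smul (b : B) (a : A₂) : wr A₁ A₂ (a <• b) = wr A₁ A₂ a * ofB b := by
  rw [wr, (inr A₁ A₂).map_op_smul, ofA_op_smul, wr]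
theorem star_wl (a : A₁) : star (wl A₁ A₂ a) = wl A₁ A₂ (star a) := by
  rw [wl, wl, star_ofA, (inl A₁ A₂).map_star]
theorem star_wr (a : A₂) : star (wr A₁ A₂ a) = wr A₁ A₂ (star a) := by
  rw [wr, wr, star_ofA, (inr A₁ A₂).map_star]

theorem word_induction {p : Uni (coprod A₁ A₂) → Prop} (hB : ∀ b, p (ofB b))
    (hl : ∀ a, p (wl A₁ A₂ a)) (hr : ∀ a, p (wr A₁ A₂ a))
    (hadd : ∀ x y, p x → p y → p (x + y)) (hmul : ∀ x y, p x → p y → p (x * y))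
    (x : Uni (coprod A₁ A₂)) : p x :=
  uni_coprod_induction hB hl hr hadd hmul x

theorem map_inl_eq (x : Uni A₁) : map (inl A₁ A₂) x = ofB x.1 + wl A₁ A₂ x.2 :=
  eq_add _
theorem map_inr_eq (x : Uni A₂) : map (inr A₁ A₂) x = ofB x.1 + wr A₁ A₂ x.2 :=
  eq_add _

/-- The functional `x ↦ (L x*)*`. -/
def conjFun (L : Uni A →+ B) : Uni A →+ B :=
  AddMonoidHom.mk' (fun x => star (L (star x))) fun x y => by simp

@[simp] theorem conjFun_apply (L : Uni A →+ B) (x : Uni A) : conjFun L x = star (L (star x)) := rfl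

/-- Complete positivity needs to be checked only for representatives modulo a left kernel. -/
theorem positive_of_congr (L : Uni A →+ B) (hs : ∀ x, L (star x) = star (L x)) (S : Set (Uni A))
    (hS : ∀ x, ∃ r ∈ S, ∀ u, L (u * (x - r)) = 0)
    (hp : ∀ (n : ℕ) (x : Fin n → Uni A), (∀ i, x i ∈ S) →
      ∃ (m : ℕ) (c : Fin m → Fin n → B), ∀ i j,
        L (star (x i) * x j) = ∑ k, star (c k i) * c k j)
    (n : ℕ) (x : Fin n → Uni A) : ∃ (m : ℕ) (c : Fin m → Fin n → B), ∀ i j,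
      L (star (x i) * x j) = ∑ k, star (c k i) * c k j := by
  choose r hr hr' using hS
  obtain ⟨m, c, h⟩ := hp n (fun i => r (x i)) (fun i => hr _)
  refine ⟨m, c, fun i j => ?_⟩
  rw [← h i j]
  have h₁ : L (star (x i) * x j) = L (star (x i) * r (x j)) := by
    have := hr' (x j) (star (x i))
    rwa [mul_sub, map_sub, sub_eq_zero] at this
  -- The kernel is a left kernel, so representatives can be substituted in the right argument only;
  -- `hs` transfers this to the left argument.
  have h₂ : L (star (r (x j)) * x i) = L (star (r (x j)) * r (x i)) := by
    have := hr' (x i) (star (r (x j)))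
    rwa [mul_sub, map_sub, sub_eq_zero] at this
  have h₃ := congrArg star h₂
  rw [← hs, ← hs, star_mul, star_mul, star_star] at h₃
  rw [h₁, h₃]

/-- A family of elements whose matrix of inner products is a sum of two matrices of the form
`∑ c* c` has itself this form. -/
theorem exists_append {n m m' : ℕ} (c : Fin m → Fin n → B) (c' : Fin m' → Fin n → B) :
    ∃ (l : ℕ) (d : Fin l → Fin n → B), ∀ i j, ∑ k, star (d k i) * d k j =
      (∑ k, star (c k i) * c k j) + ∑ k, star (c' k i) * c' k j :=
  ⟨m + m', Fin.append c c', fun i j => by simp [Fin.sum_univ_add]⟩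

end Words

/-! ### The boolean product -/

section Boolean

set_option linter.unusedSectionVars false

variable {B : Type u} [Ring B] [StarRing B] [Algebra ℂ B]
variable {A₁ A₂ A₃ : BAlg B} (φ₁ : Expectation A₁) (φ₂ : Expectation A₂) (φ₃ : Expectation A₃)

/-- The action of `B ⊕ A₁` on `B ⊕ A₁ ⊕ A₂`. -/
def boolLeft : Uni A₁ →+* Module.End ℤ (B × A₁ × A₂) where
  toFun x := addEnd (fun v => (x.1 * v.1, x.1 • v.2.1 + x.2 <• v.1 + x.2 * v.2.1 +
      x.2 <• φ₂ v.2.2, x.1 • v.2.2)) fun v w => by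
    refine Prod.ext ?_ (Prod.ext ?_ ?_)
    · simp [mul_add]
    · simp [mul_add, add_smul, φ₂.map_add]
      abel
    · simp
  map_one' := LinearMap.ext fun v => by simp
  map_mul' x y := LinearMap.ext fun v => by
    refine Prod.ext ?_ (Prod.ext ?_ ?_)
    · simp [mul_assoc]
    · simp [mul_add, add_mul, mul_smul, A₁.smul_op_smul, A₁.smul_mul, A₁.mul_op_smul,
        A₁.op_smul_mul, φ₂.map_smul, mul_assoc]
      abel
    · simp [mul_smul]
  map_zero' := LinearMap.ext fun v => by simp
  map_add' x y := LinearMap.ext fun v => by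
    refine Prod.ext ?_ (Prod.ext ?_ ?_)
    · simp [add_mul]
    · simp [add_mul, add_smul]
      abel
    · simp [add_smul]

/-- The action of `B ⊕ A₂` on `B ⊕ A₁ ⊕ A₂`. -/
def boolRight : Uni A₂ →+* Module.End ℤ (B × A₁ × A₂) where
  toFun x := addEnd (fun v => (x.1 * v.1, x.1 • v.2.1, x.1 • v.2.2 + x.2 <• v.1 +
      x.2 * v.2.2 + x.2 <• φ₁ v.2.1)) fun v w => by
    refine Prod.ext ?_ (Prod.ext ?_ ?_)
    · simp [mul_add]
    · simp
    · simp [mul_add, add_smul, φ₁.map_add]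
      abel
  map_one' := LinearMap.ext fun v => by simp
  map_mul' x y := LinearMap.ext fun v => by
    refine Prod.ext ?_ (Prod.ext ?_ ?_)
    · simp [mul_assoc]
    · simp [mul_smul]
    · simp [mul_add, add_mul, mul_smul, A₂.smul_op_smul, A₂.smul_mul, A₂.mul_op_smul,
        A₂.op_smul_mul, φ₁.map_smul, mul_assoc]
      abel
  map_zero' := LinearMap.ext fun v => by simp
  map_add' x y := LinearMap.ext fun v => by
    refine Prod.ext ?_ (Prod.ext ?_ ?_)
    · simp [add_mul]
    · simp [add_smul]
    · simp [add_mul, add_smul]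
      abel

variable [StarModule ℂ B]

theorem exists_boolRep : ∃ F : Uni (coprod A₁ A₂) →+* Module.End ℤ (B × A₁ × A₂),
    (∀ x, F (map (inl A₁ A₂) x) = boolLeft φ₂ x) ∧
      ∀ x, F (map (inr A₁ A₂) x) = boolRight φ₁ x :=
  exists_ringLift (boolLeft φ₂) (boolRight φ₁) fun b => LinearMap.ext fun v => by
    simp [boolLeft, boolRight]

/-- The boolean representation of the coproduct. -/
noncomputable def boolRep : Uni (coprod A₁ A₂) →+* Module.End ℤ (B × A₁ × A₂) :=
  (exists_boolRep φ₁ φ₂).choose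

theorem boolRep_wl (a : A₁) (v : B × A₁ × A₂) : boolRep φ₁ φ₂ (wl A₁ A₂ a) v =
    (0, a <• v.1 + a * v.2.1 + a <• φ₂ v.2.2, 0) := by
  have := (exists_boolRep φ₁ φ₂).choose_spec.1 (ofA a)
  rw [map_ofA] at this
  rw [boolRep, wl, this]
  simp [boolLeft]

theorem boolRep_wr (a : A₂) (v : B × A₁ × A₂) : boolRep φ₁ φ₂ (wr A₁ A₂ a) v =
    (0, 0, a <• v.1 + a * v.2.2 + a <• φ₁ v.2.1) := by
  have := (exists_boolRep φ₁ φ₂).choose_spec.2 (ofA a)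
  rw [map_ofA] at this
  rw [boolRep, wr, this]
  simp [boolRight]

theorem boolRep_ofB (b : B) (v : B × A₁ × A₂) : boolRep φ₁ φ₂ (ofB b) v =
    (b * v.1, b • v.2.1, b • v.2.2) := by
  have := (exists_boolRep φ₁ φ₂).choose_spec.1 (ofB b)
  rw [map_ofB] at this
  rw [boolRep, this]
  simp [boolLeft]

/-- The vacuum expectation on `B ⊕ A₁ ⊕ A₂`. -/
def boolVac : B × A₁ × A₂ →+ B :=
  AddMonoidHom.mk' (fun v => v.1 + φ₁ v.2.1 + φ₂ v.2.2) fun v w => by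
    simp only [Prod.fst_add, Prod.snd_add, φ₁.map_add, φ₂.map_add]
    abel

theorem boolVac_apply (v : B × A₁ × A₂) : boolVac φ₁ φ₂ v = v.1 + φ₁ v.2.1 + φ₂ v.2.2 := rfl

/-- The boolean product functional. -/
noncomputable def boolFun : Uni (coprod A₁ A₂) →+ B :=
  AddMonoidHom.mk' (fun x => boolVac φ₁ φ₂ (boolRep φ₁ φ₂ x (1, 0, 0))) fun x y => by
    simp

theorem boolFun_apply (x : Uni (coprod A₁ A₂)) :
    boolFun φ₁ φ₂ x = boolVac φ₁ φ₂ (boolRep φ₁ φ₂ x (1, 0, 0)) := rfl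

theorem boolFun_ofB (b : B) : boolFun φ₁ φ₂ (ofB b) = b := by
  simp [boolFun_apply, boolRep_ofB, boolVac_apply, φ₁.map_zero, φ₂.map_zero]

theorem boolFun_wl (a : A₁) : boolFun φ₁ φ₂ (wl A₁ A₂ a) = φ₁ a := by
  simp only [boolFun_apply, boolRep_wl, boolVac_apply, φ₂.map_zero]
  simp

theorem boolFun_wr (a : A₂) : boolFun φ₁ φ₂ (wr A₁ A₂ a) = φ₂ a := by
  simp only [boolFun_apply, boolRep_wr, boolVac_apply, φ₁.map_zero]
  simp

theorem boolFun_ofB_mul (b : B) (x : Uni (coprod A₁ A₂)) :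
    boolFun φ₁ φ₂ (ofB b * x) = b * boolFun φ₁ φ₂ x := by
  simp only [boolFun_apply, map_mul, Module.End.mul_apply, boolRep_ofB, boolVac_apply,
    φ₁.map_smul, φ₂.map_smul, mul_add]

theorem boolRep_op_smul (x : Uni (coprod A₁ A₂)) : ∀ (v : B × A₁ × A₂) (b : B),
    boolRep φ₁ φ₂ x (v <• b) = boolRep φ₁ φ₂ x v <• b := by
  refine word_induction (p := fun x => ∀ (v : B × A₁ × A₂) (b : B),
    boolRep φ₁ φ₂ x (v <• b) = boolRep φ₁ φ₂ x v <• b) (fun b' v b => ?_) (fun a v b => ?_) (fun a v b => ?_)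
    (fun x y hx hy v b => ?_) (fun x y hx hy v b => ?_) x
  · simp only [boolRep_ofB]
    refine Prod.ext ?_ (Prod.ext ?_ ?_)
    · simp [mul_assoc]
    · simp [A₁.smul_op_smul]
    · simp [A₂.smul_op_smul]
  · simp only [boolRep_wl]
    refine Prod.ext ?_ (Prod.ext ?_ ?_)
    · simp
    · simp [mul_smul, A₁.mul_op_smul, φ₂.map_op_smul]
    · simp
  · simp only [boolRep_wr]
    refine Prod.ext ?_ (Prod.ext ?_ ?_)
    · simp
    · simp
    · simp [mul_smul, A₂.mul_op_smul, φ₁.map_op_smul]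
  · simp only [map_add, LinearMap.add_apply, hx, hy, smul_add]
  · simp only [map_mul, Module.End.mul_apply, hx, hy]

theorem boolFun_mul_ofB (x : Uni (coprod A₁ A₂)) (b : B) :
    boolFun φ₁ φ₂ (x * ofB b) = boolFun φ₁ φ₂ x * b := by
  have e : boolRep φ₁ φ₂ (ofB b) (1, 0, 0) = ((1, 0, 0) : B × A₁ × A₂) <• b := by
    rw [boolRep_ofB]
    refine Prod.ext ?_ (Prod.ext ?_ ?_) <;> simp
  rw [boolFun_apply, map_mul, Module.End.mul_apply, e, boolRep_op_smul]
  simp [boolFun_apply, boolVac_apply, φ₁.map_op_smul, φ₂.map_op_smul, add_mul]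

/-- The reduction rules for the boolean product. -/
structure IsBoolKernel {G : Type*} [AddCommGroup G] (L : Uni (coprod A₁ A₂) →+ G) : Prop where
  left : ∀ u c a, L (u * (wr A₁ A₂ c * wl A₁ A₂ a - wr A₁ A₂ c * ofB (φ₁ a))) = 0
  right : ∀ u a c, L (u * (wl A₁ A₂ a * wr A₁ A₂ c - wl A₁ A₂ a * ofB (φ₂ c))) = 0

/-- The rule already holds when both sides are applied to the cyclic vector `(1, 0, 0)`: each action
replaces a preceding element of the other algebra by its expectation. The element `u` plays no role.
-/
theorem boolFun_kernel : IsBoolKernel φ₁ φ₂ (boolFun φ₁ φ₂) := by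
  constructor
  · intro u c a
    have : boolRep φ₁ φ₂ (wr A₁ A₂ c * wl A₁ A₂ a - wr A₁ A₂ c * ofB (φ₁ a)) (1, 0, 0) = 0 := by
      simp [boolRep_wl, boolRep_wr, boolRep_ofB, φ₁.map_zero, φ₂.map_zero]
    rw [boolFun_apply, map_mul, Module.End.mul_apply, this, map_zero, map_zero]
  · intro u a c
    have : boolRep φ₁ φ₂ (wl A₁ A₂ a * wr A₁ A₂ c - wl A₁ A₂ a * ofB (φ₂ c)) (1, 0, 0) = 0 := by
      simp [boolRep_wl, boolRep_wr, boolRep_ofB, φ₁.map_zero, φ₂.map_zero]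
    rw [boolFun_apply, map_mul, Module.End.mul_apply, this, map_zero, map_zero]

/-- The left ideal generated by the reduction rules for the boolean product. -/
def boolIdeal : Ideal (Uni (coprod A₁ A₂)) := Ideal.span
  ({x | ∃ c a, x = wr A₁ A₂ c * wl A₁ A₂ a - wr A₁ A₂ c * ofB (φ₁ a)} ∪
    {x | ∃ a c, x = wl A₁ A₂ a * wr A₁ A₂ c - wl A₁ A₂ a * ofB (φ₂ c)})

omit [StarModule ℂ B] in
theorem IsBoolKernel.eq_zero {φ₁ : Expectation A₁} {φ₂ : Expectation A₂} {G : Type*}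
    [AddCommGroup G] {L : Uni (coprod A₁ A₂) →+ G}
    (h : IsBoolKernel φ₁ φ₂ L) {x : Uni (coprod A₁ A₂)} (hx : x ∈ boolIdeal φ₁ φ₂) :
    ∀ u, L (u * x) = 0 := by
  refine Submodule.span_induction (p := fun x _ => ∀ u, L (u * x) = 0) ?_ ?_ ?_ ?_ hx
  · rintro x (⟨c, a, rfl⟩ | ⟨a, c, rfl⟩) u
    · exact h.left u c a
    · exact h.right u a c
  · intro u
    simp
  · intro x y _ _ hx hy u
    rw [mul_add, map_add, hx, hy, add_zero]
  · intro r x _ hx u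
    rw [smul_eq_mul, ← mul_assoc, hx]

omit [StarModule ℂ B] in
-- Modulo the rules a word collapses to its first letter with a coefficient from `B`, so `B ⊕ A₁ ⊕
-- A₂` exhausts the quotient.
theorem exists_bool_reduction (z : Uni (coprod A₁ A₂)) : ∃ b a c,
    z - (ofB b + wl A₁ A₂ a + wr A₁ A₂ c) ∈ boolIdeal φ₁ φ₂ := by
  have hl : ∀ c a, wr A₁ A₂ c * wl A₁ A₂ a - wr A₁ A₂ c * ofB (φ₁ a) ∈ boolIdeal φ₁ φ₂ :=
    fun c a => Ideal.subset_span (Or.inl ⟨c, a, rfl⟩)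
  have hr : ∀ a c, wl A₁ A₂ a * wr A₁ A₂ c - wl A₁ A₂ a * ofB (φ₂ c) ∈ boolIdeal φ₁ φ₂ :=
    fun a c => Ideal.subset_span (Or.inr ⟨a, c, rfl⟩)
  -- Reducing `z` times a normal form, rather than `z` itself, makes the claim stable under
  -- products.
  have key : ∀ b a c, ∃ b' a' c', z * (ofB b + wl A₁ A₂ a + wr A₁ A₂ c) -
      (ofB b' + wl A₁ A₂ a' + wr A₁ A₂ c') ∈ boolIdeal φ₁ φ₂ := by
    refine word_induction (p := fun z => ∀ b a c, ∃ b' a' c',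
      z * (ofB b + wl A₁ A₂ a + wr A₁ A₂ c) -
        (ofB b' + wl A₁ A₂ a' + wr A₁ A₂ c') ∈ boolIdeal φ₁ φ₂) (fun b₀ b a c => ?_) (fun a₀ b a c => ?_) (fun c₀ b a c => ?_)
      (fun x y hx hy b a c => ?_) (fun x y hx hy b a c => ?_) z
    · refine ⟨b₀ * b, b₀ • a, b₀ • c, ?_⟩
      rw [ofB_mul, wl_smul, wr_smul, ← mul_add, ← mul_add, sub_self]
      exact zero_mem _
    · refine ⟨0, a₀ <• b + a₀ * a + a₀ <• φ₂ c, 0, ?_⟩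
      convert hr a₀ c using 1
      rw [wl_add, wl_add, wl_op_smul, wl_op_smul, wl_mul, ofB_zero, wr_zero]
      noncomm_ring
    · refine ⟨0, 0, c₀ <• b + c₀ * c + c₀ <• φ₁ a, ?_⟩
      convert hl c₀ a using 1
      rw [wr_add, wr_add, wr_op_smul, wr_op_smul, wr_mul, ofB_zero, wl_zero]
      noncomm_ring
    · obtain ⟨b', a', c', h'⟩ := hx b a c
      obtain ⟨b'', a'', c'', h''⟩ := hy b a c
      refine ⟨b' + b'', a' + a'', c' + c'', ?_⟩
      convert add_mem h' h'' using 1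
      rw [ofB_add, wl_add, wr_add]
      noncomm_ring
    · obtain ⟨b', a', c', h'⟩ := hy b a c
      obtain ⟨b'', a'', c'', h''⟩ := hx b' a' c'
      refine ⟨b'', a'', c'', ?_⟩
      convert add_mem (Ideal.mul_mem_left _ x h') h'' using 1
      noncomm_ring
  have := key 1 0 0
  rw [wl_zero, wr_zero, ofB_one] at this
  simpa using this

omit [StarModule ℂ B] in
theorem IsBoolKernel.ext {φ₁ : Expectation A₁} {φ₂ : Expectation A₂} {G : Type*} [AddCommGroup G]
    {L L' : Uni (coprod A₁ A₂) →+ G}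
    (h : IsBoolKernel φ₁ φ₂ L) (h' : IsBoolKernel φ₁ φ₂ L') (hB : ∀ b, L (ofB b) = L' (ofB b))
    (hl : ∀ a, L (wl A₁ A₂ a) = L' (wl A₁ A₂ a)) (hr : ∀ a, L (wr A₁ A₂ a) = L' (wr A₁ A₂ a))
    (x : Uni (coprod A₁ A₂)) : L x = L' x := by
  obtain ⟨b, a, c, hx⟩ := exists_bool_reduction φ₁ φ₂ x
  have e := h.eq_zero hx 1
  have e' := h'.eq_zero hx 1
  rw [one_mul, map_sub, sub_eq_zero] at e e'
  rw [e, e', map_add, map_add, map_add, map_add, hB, hl, hr]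

/-- The mirror image of the reduction rules: the first letter of a word may also be replaced by its
expectation. It follows from the vacuum expectation being taken at the end. -/
theorem boolFun_left (a : A₁) (c : A₂) (w : Uni (coprod A₁ A₂)) :
    boolFun φ₁ φ₂ ((wl A₁ A₂ a * wr A₁ A₂ c - ofB (φ₁ a) * wr A₁ A₂ c) * w) = 0 := by
  simp [boolFun_apply, boolRep_wl, boolRep_wr, boolRep_ofB, boolVac_apply, φ₁.map_zero,
    φ₂.map_zero, φ₁.map_op_smul, φ₂.map_smul, φ₂.map_add, φ₂.map_neg, MulOpposite.op_add, add_smul, φ₁.map_add]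

theorem boolFun_right (a : A₁) (c : A₂) (w : Uni (coprod A₁ A₂)) :
    boolFun φ₁ φ₂ ((wr A₁ A₂ c * wl A₁ A₂ a - ofB (φ₂ c) * wl A₁ A₂ a) * w) = 0 := by
  simp [boolFun_apply, boolRep_wl, boolRep_wr, boolRep_ofB, boolVac_apply, φ₁.map_zero,
    φ₂.map_zero, φ₂.map_op_smul, φ₁.map_smul, φ₁.map_add, φ₁.map_neg, MulOpposite.op_add, add_smul, φ₂.map_add]
  abel

/-- The functional `x ↦ (L x*)*` obeys the same reduction rules, by the mirrored rules for `L`, and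
agrees with `L` on normal forms. -/
theorem boolFun_star (x : Uni (coprod A₁ A₂)) :
    boolFun φ₁ φ₂ (star x) = star (boolFun φ₁ φ₂ x) := by
  have h : IsBoolKernel φ₁ φ₂ (conjFun (boolFun φ₁ φ₂)) := by
    constructor
    · intro u c a
      have := boolFun_left φ₁ φ₂ (star a) (star c) (star u)
      rw [conjFun_apply, star_eq_zero, star_mul, star_sub, star_mul, star_mul, star_wl, star_wr,
        star_ofB, ← φ₁.map_star]
      exact this
    · intro u a c
      have := boolFun_right φ₁ φ₂ (star a) (star c) (star u)
      rw [conjFun_apply, star_eq_zero, star_mul, star_sub, star_mul, star_mul, star_wl, star_wr,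
        star_ofB, ← φ₂.map_star]
      exact this
  have e := h.ext (boolFun_kernel φ₁ φ₂)
    (fun b => by rw [conjFun_apply, star_ofB, boolFun_ofB, boolFun_ofB, star_star])
    (fun a => by rw [conjFun_apply, star_wl, boolFun_wl, boolFun_wl, φ₁.map_star, star_star])
    (fun a => by rw [conjFun_apply, star_wr, boolFun_wr, boolFun_wr, φ₂.map_star, star_star]) x
  rw [conjFun_apply] at e
  rw [← e, star_star]

/-- The normal forms split orthogonally into a multiple of the vacuum and the centred parts from the
two algebras; each summand is visibly positive. -/
theorem boolFun_gram (b b' : B) (a a' : A₁) (c c' : A₂) :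
    boolFun φ₁ φ₂ (star (ofB b + wl A₁ A₂ a + wr A₁ A₂ c) *
      (ofB b' + wl A₁ A₂ a' + wr A₁ A₂ c')) =
    (star (b + φ₁ a + φ₂ c) * (b' + φ₁ a' + φ₂ c') +
      φ₁.ext (star (ofA a - ofB (φ₁ a)) * (ofA a' - ofB (φ₁ a')))) +
      φ₂.ext (star (ofA c - ofB (φ₂ c)) * (ofA c' - ofB (φ₂ c'))) := by
  have h₁ : ∀ (a : A₁) (c : A₂), boolFun φ₁ φ₂ (wl A₁ A₂ a * wr A₁ A₂ c) = φ₁ a * φ₂ c := by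
    intro a c
    have := (boolFun_kernel φ₁ φ₂).right 1 a c
    rw [one_mul, map_sub, sub_eq_zero, boolFun_mul_ofB, boolFun_wl] at this
    exact this
  have h₂ : ∀ (a : A₁) (c : A₂), boolFun φ₁ φ₂ (wr A₁ A₂ c * wl A₁ A₂ a) = φ₂ c * φ₁ a := by
    intro a c
    have := (boolFun_kernel φ₁ φ₂).left 1 c a
    rw [one_mul, map_sub, sub_eq_zero, boolFun_mul_ofB, boolFun_wr] at this
    exact this
  have h₃ : ∀ a a', boolFun φ₁ φ₂ (wl A₁ A₂ a * wl A₁ A₂ a') = φ₁ (a * a') := fun a a' => by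
    rw [← wl_mul, boolFun_wl]
  have h₄ : ∀ a a', boolFun φ₁ φ₂ (wr A₁ A₂ a * wr A₁ A₂ a') = φ₂ (a * a') := fun a a' => by
    rw [← wr_mul, boolFun_wr]
  simp only [star_add, star_sub, star_ofB, star_wl, star_wr, star_ofA, add_mul, mul_add, sub_mul,
    mul_sub, map_add, ← ofB_mul, ← ofA_mul, boolFun_ofB, boolFun_ofB_mul, boolFun_mul_ofB,
    boolFun_wl, boolFun_wr, h₁, h₂, h₃, h₄, φ₁.ext_sub, φ₂.ext_sub, φ₁.ext_ofA, φ₂.ext_ofA,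
    φ₁.ext_ofB, φ₂.ext_ofB, φ₁.ext_mul_ofB, φ₂.ext_mul_ofB, φ₁.ext_ofB_mul, φ₂.ext_ofB_mul,
    φ₁.map_star, φ₂.map_star]
  abel

/-- The boolean product of two conditional expectations. -/
noncomputable def boolProd : Expectation (coprod A₁ A₂) :=
  Expectation.ofExt (boolFun φ₁ φ₂) (boolFun_ofB φ₁ φ₂) (boolFun_ofB_mul φ₁ φ₂)
    (boolFun_mul_ofB φ₁ φ₂) <| by
    refine positive_of_congr _ (boolFun_star φ₁ φ₂)
      {x | ∃ b a c, x = ofB b + wl A₁ A₂ a + wr A₁ A₂ c} (fun x => ?_) fun n x hx => ?_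
    · obtain ⟨b, a, c, h⟩ := exists_bool_reduction φ₁ φ₂ x
      exact ⟨_, ⟨b, a, c, rfl⟩, (boolFun_kernel φ₁ φ₂).eq_zero h⟩
    · choose b a c hx using hx
      obtain ⟨m₁, c₁, h₁⟩ := φ₁.ext_positive n fun i => ofA (a i) - ofB (φ₁ (a i))
      obtain ⟨m₂, c₂, h₂⟩ := φ₂.ext_positive n fun i => ofA (c i) - ofB (φ₂ (c i))
      obtain ⟨m, d, h⟩ := exists_append
        (fun (_ : Fin 1) (i : Fin n) => b i + φ₁ (a i) + φ₂ (c i)) c₁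
      obtain ⟨l, e, h'⟩ := exists_append d c₂
      refine ⟨l, e, fun i j => ?_⟩
      rw [h', h, hx, hx, boolFun_gram, h₁, h₂, Fin.sum_univ_one]

theorem boolProd_ext (x : Uni (coprod A₁ A₂)) : (boolProd φ₁ φ₂).ext x = boolFun φ₁ φ₂ x :=
  Expectation.ofExt_ext ..

theorem boolProd_inl (a : A₁) : boolProd φ₁ φ₂ (inl A₁ A₂ a) = φ₁ a := boolFun_wl φ₁ φ₂ a

theorem boolProd_inr (a : A₂) : boolProd φ₁ φ₂ (inr A₁ A₂ a) = φ₂ a := boolFun_wr φ₁ φ₂ a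

theorem boolProd_kernel : IsBoolKernel φ₁ φ₂ (boolProd φ₁ φ₂).extHom := by
  have e : (boolProd φ₁ φ₂).extHom = boolFun φ₁ φ₂ := AddMonoidHom.ext (boolProd_ext φ₁ φ₂)
  rw [e]
  exact boolFun_kernel φ₁ φ₂

end Boolean

end CondProb

/-! ### Associativity, naturality and symmetry of the boolean product. -/

namespace CondProb

open scoped RightActions

open Uni

theorem Hom.map_sub {B : Type u} [Ring B] [StarRing B] [Algebra ℂ B] {A D : BAlg B} (f : Hom A D)
    (a a' : A) : f (a - a') = f a - f a' :=
  (AddMonoidHom.mk' f.toFun f.map_add).map_sub a a'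

/-! ### Change of base on unitizations -/

section BaseMap

variable {B B' : Type u} [Ring B] [StarRing B] [Algebra ℂ B]
  [Ring B'] [StarRing B'] [Algebra ℂ B']
variable (β : B →⋆ₐ[ℂ] B') {A A₁ A₂ : BAlg B} {D D₁ D₂ : BAlg B'}

/-- The map underlying a homomorphism over `B → B'`. -/
def under (f : Hom A (restrict β D)) (a : A) : D := f a

/-- The homomorphism `B ⊕ A → B' ⊕ D` induced by a homomorphism `A → D` over `B → B'`. -/
def baseMap (f : Hom A (restrict β D)) : Uni A →+* Uni D where
  toFun x := (β x.1, f x.2)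
  map_one' := Uni.ext' (map_one β) f.map_zero
  map_mul' x y := Uni.ext' (map_mul β _ _) <| by
    have h₁ := f.map_smul x.1 y.2
    have h₂ := f.map_op_smul y.1 x.2
    have h₃ := f.map_mul x.2 y.2
    show f (x * y).2 = _
    rw [mul_snd, f.map_add, f.map_add, h₁, h₂, h₃]
    rfl
  map_zero' := Uni.ext' (map_zero β) f.map_zero
  map_add' x y := Uni.ext' (map_add β _ _) (f.map_add _ _)

theorem baseMap_ofB (f : Hom A (restrict β D)) (b : B) : baseMap β f (ofB b) = ofB (β b) :=
  Uni.ext' rfl f.map_zero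

theorem baseMap_ofA (f : Hom A (restrict β D)) (a : A) : baseMap β f (ofA a) = ofA (under β f a) :=
  Uni.ext' (map_zero β) rfl

theorem ext_baseMap {φ : Expectation A} {ψ : Expectation D} {f : Hom A (restrict β D)}
    (h : ∀ a, ψ (under β f a) = β (φ a)) (x : Uni A) : ψ.ext (baseMap β f x) = β (φ.ext x) := by
  show β x.1 + ψ (under β f x.2) = β (x.1 + φ x.2)
  rw [h, map_add]

theorem baseMap_wl (f₁ : Hom A₁ (restrict β D₁)) (f₂ : Hom A₂ (restrict β D₂)) (a : A₁) :
    baseMap β (coprodMap β f₁ f₂) (wl A₁ A₂ a) = wl D₁ D₂ (under β f₁ a) := baseMap_ofA β _ _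

theorem baseMap_wr (f₁ : Hom A₁ (restrict β D₁)) (f₂ : Hom A₂ (restrict β D₂)) (a : A₂) :
    baseMap β (coprodMap β f₁ f₂) (wr A₁ A₂ a) = wr D₁ D₂ (under β f₂ a) := baseMap_ofA β _ _

end BaseMap

section Assoc

variable {B : Type u} [Ring B] [StarRing B] [Algebra ℂ B]

set_option linter.unusedSectionVars false

variable {A₁ A₂ A₃ : BAlg B}

/-- The inclusion `A₁ ⊔ A₂ → A₁ ⊔ (A₂ ⊔ A₃)`. -/
def assocInl (A₁ A₂ A₃ : BAlg B) : Hom (coprod A₁ A₂) (coprod A₁ (coprod A₂ A₃)) :=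
  lift (inl A₁ (coprod A₂ A₃)) ((inr A₁ (coprod A₂ A₃)).comp (inl A₂ A₃))

theorem map_assocInl_wl (a : A₁) :
    map (assocInl A₁ A₂ A₃) (wl A₁ A₂ a) = wl A₁ (coprod A₂ A₃) a := rfl

theorem map_assocInl_wr (a : A₂) :
    map (assocInl A₁ A₂ A₃) (wr A₁ A₂ a) = wr A₁ (coprod A₂ A₃) (inl A₂ A₃ a) := rfl

theorem map_assoc_wl (y : coprod A₁ A₂) :
    map (assoc A₁ A₂ A₃) (wl (coprod A₁ A₂) A₃ y) = map (assocInl A₁ A₂ A₃) (ofA y) := rfl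

theorem map_assoc_wr (a : A₃) :
    map (assoc A₁ A₂ A₃) (wr (coprod A₁ A₂) A₃ a) = wr A₁ (coprod A₂ A₃) (inr A₂ A₃ a) := rfl

end Assoc

/-! ### The complex numbers as a base algebra -/

instance : StarRing (ULift.{u} ℂ) where
  star z := ⟨star z.down⟩
  star_involutive z := ULift.ext _ _ (star_star z.down)
  star_mul z w := ULift.ext _ _ (star_mul z.down w.down)
  star_add z w := ULift.ext _ _ (star_add z.down w.down)

instance : StarModule ℂ (ULift.{u} ℂ) where
  star_smul z w := ULift.ext _ _ (star_smul z w.down)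

/-! ### Boolean independence -/

section Boolean

variable {B : Type u} [Ring B] [StarRing B] [Algebra ℂ B] [StarModule ℂ B]

set_option linter.unusedSectionVars false

variable {A₁ A₂ A₃ : BAlg B} (φ₁ : Expectation A₁) (φ₂ : Expectation A₂) (φ₃ : Expectation A₃)

/-- The vectors `(0, 0, c)` with `c` in the left kernel of `φ₂` form an invariant subspace on which
the vacuum expectation vanishes. Used with `φ₂` itself a product, it imports the rules of the inner
product into the outer one. -/
theorem boolFun_absorb (u : Uni (coprod A₁ A₂)) (n : A₂)
    (hn : ∀ d, φ₂.ext (d * ofA n) = 0) : boolFun φ₁ φ₂ (u * wr A₁ A₂ n) = 0 := by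
  have key : ∀ c : A₂, (∀ d, φ₂.ext (d * ofA c) = 0) →
      ∃ c', (∀ d, φ₂.ext (d * ofA c') = 0) ∧ boolRep φ₁ φ₂ u (0, 0, c) = (0, 0, c') := by
    refine word_induction (p := fun u => ∀ c : A₂, (∀ d, φ₂.ext (d * ofA c) = 0) →
      ∃ c', (∀ d, φ₂.ext (d * ofA c') = 0) ∧ boolRep φ₁ φ₂ u (0, 0, c) = (0, 0, c'))
      (fun b c h => ?_) (fun a c h => ?_) (fun a c h => ?_) (fun x y hx hy c h => ?_)
      (fun x y hx hy c h => ?_) u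
    · refine ⟨b • c, fun d => ?_, ?_⟩
      · rw [ofA_smul, ← mul_assoc, h]
      · simp [boolRep_ofB]
    · refine ⟨0, fun d => by simp, ?_⟩
      have := h 1
      rw [one_mul, φ₂.ext_ofA] at this
      simp [boolRep_wl, this]
    · refine ⟨a * c, fun d => ?_, ?_⟩
      · rw [ofA_mul, ← mul_assoc, h]
      · simp [boolRep_wr, φ₁.map_zero]
    · obtain ⟨c', h₁, h₂⟩ := hx c h
      obtain ⟨c'', h₃, h₄⟩ := hy c h
      refine ⟨c' + c'', fun d => ?_, ?_⟩
      · rw [ofA_add, mul_add, φ₂.ext_add, h₁, h₃, add_zero]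
      · simp [h₂, h₄]
    · obtain ⟨c', h₁, h₂⟩ := hy c h
      obtain ⟨c'', h₃, h₄⟩ := hx c' h₁
      exact ⟨c'', h₃, by rw [map_mul, Module.End.mul_apply, h₂, h₄]⟩
  obtain ⟨c', h₁, h₂⟩ := key n hn
  have e : boolRep φ₁ φ₂ (wr A₁ A₂ n) (1, 0, 0) = (0, 0, n) := by
    simp [boolRep_wr, φ₁.map_zero]
  have := h₁ 1
  rw [one_mul, φ₂.ext_ofA] at this
  rw [boolFun_apply, map_mul, Module.End.mul_apply, e, h₂, boolVac_apply, this, φ₁.map_zero]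
  simp

theorem boolFun_mul_left (u : Uni (coprod A₁ A₂)) (a : A₁) (c : A₂) :
    boolFun φ₁ φ₂ (u * (wr A₁ A₂ c * wl A₁ A₂ a)) = boolFun φ₁ φ₂ (u * (wr A₁ A₂ c * ofB (φ₁ a))) := by
  rw [← sub_eq_zero, ← map_sub, ← mul_sub]
  exact (boolFun_kernel φ₁ φ₂).left u c a

theorem boolFun_mul_right (u : Uni (coprod A₁ A₂)) (a : A₁) (c : A₂) :
    boolFun φ₁ φ₂ (u * (wl A₁ A₂ a * wr A₁ A₂ c)) = boolFun φ₁ φ₂ (u * (wl A₁ A₂ a * ofB (φ₂ c))) := by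
  rw [← sub_eq_zero, ← map_sub, ← mul_sub]
  exact (boolFun_kernel φ₁ φ₂).right u a c

/-- The product bracketed to the right obeys the reduction rules of the one bracketed to the left,
which is the main part of associativity. -/
theorem boolFun_assoc_kernel :
    IsBoolKernel (boolProd φ₁ φ₂) φ₃ ((boolFun φ₁ (boolProd φ₂ φ₃)).comp
      (mapHom (assoc A₁ A₂ A₃)).toAddMonoidHom) := by
  let Ψ := boolFun φ₁ (boolProd φ₂ φ₃)
  have absorb : ∀ u n, (∀ d, boolFun φ₂ φ₃ (d * ofA n) = 0) →
      Ψ (u * wr A₁ (coprod A₂ A₃) n) = 0 := fun u n h =>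
    boolFun_absorb φ₁ (boolProd φ₂ φ₃) u n fun d => by rw [boolProd_ext, h]
  constructor
  · intro u c y
    let v := map (assoc A₁ A₂ A₃) u * wr A₁ (coprod A₂ A₃) (inr A₂ A₃ c)
    -- `G` and `G'` place `x` and its expectation, respectively, behind a letter of `A₃`. Both obey
    -- the rules for `A₁ ⊔ A₂`, so only single letters have to be compared.
    let G : Uni (coprod A₁ A₂) →+ B :=
      (Ψ.comp (AddMonoidHom.mulLeft v)).comp (mapHom (assocInl A₁ A₂ A₃)).toAddMonoidHom
    let G' : Uni (coprod A₁ A₂) →+ B :=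
      (Ψ.comp (AddMonoidHom.mulLeft v)).comp
        ((ofBHom (coprod A₁ (coprod A₂ A₃))).toAddMonoidHom.comp (boolFun φ₁ φ₂))
    have hG : ∀ x, G x = Ψ (v * map (assocInl A₁ A₂ A₃) x) := fun _ => rfl
    have hG' : ∀ x, G' x = Ψ (v * ofB (boolFun φ₁ φ₂ x)) := fun _ => rfl
    have kG : IsBoolKernel φ₁ φ₂ G := by
      constructor
      · intro w c a
        rw [hG, Uni.map_mul, Uni.map_sub, Uni.map_mul, Uni.map_mul, ← mul_assoc, mul_sub, map_sub,
          sub_eq_zero, map_assocInl_wl, map_assocInl_wr, map_ofB]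
        exact boolFun_mul_left ..
      · intro w c a
        rw [hG, Uni.map_mul, Uni.map_sub, Uni.map_mul, Uni.map_mul, ← mul_assoc, mul_sub, map_sub,
          sub_eq_zero, map_assocInl_wl, map_assocInl_wr, map_ofB]
        rw [boolFun_mul_right, boolProd_inl]
    have kG' : IsBoolKernel φ₁ φ₂ G' := by
      constructor
      · intro w c a
        rw [hG', (boolFun_kernel φ₁ φ₂).left, ofB_zero, mul_zero, map_zero]
      · intro w c a
        rw [hG', (boolFun_kernel φ₁ φ₂).right, ofB_zero, mul_zero, map_zero]
    have e : G (ofA y) = G' (ofA y) := by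
      refine kG.ext kG' (fun b => ?_) (fun a => ?_) (fun c' => ?_) _
      · rw [hG, hG', map_ofB, boolFun_ofB]
      · rw [hG, hG', map_assocInl_wl, boolFun_wl, mul_assoc, boolFun_mul_left, mul_assoc]
      -- For a letter of `A₂` the difference lies in the left kernel of the product of `φ₂` and
      -- `φ₃`, so it is absorbed.
      · rw [hG, hG', map_assocInl_wr, boolFun_wr, ← sub_eq_zero, ← map_sub, mul_assoc, mul_assoc,
          ← mul_sub, ← wr_mul, ← wr_op_smul]
        rw [wr, wr, ← ofA_sub, ← (inr _ _).map_sub]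
        refine absorb _ _ fun d => ?_
        rw [ofA_sub, ofA_mul, ofA_op_smul]
        have := (boolFun_kernel φ₂ φ₃).left d c c'
        exact this
    have e' : boolFun φ₁ φ₂ (ofA y) = boolProd φ₁ φ₂ y := by
      rw [← boolProd_ext, Expectation.ext_ofA]
    rw [hG, hG', e'] at e
    show Ψ (map _ _) = 0
    rw [Uni.map_mul, Uni.map_sub, Uni.map_mul, Uni.map_mul, mul_sub, map_sub, sub_eq_zero,
      map_assoc_wl, map_assoc_wr, map_ofB, ← mul_assoc, ← mul_assoc]
    exact e
  · intro u y c
    show Ψ (map _ _) = 0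
    rw [Uni.map_mul, Uni.map_sub, Uni.map_mul, Uni.map_mul, map_assoc_wl, map_assoc_wr, map_ofB]
    generalize map (assoc A₁ A₂ A₃) u = v
    refine coprod_induction (p := fun y => ∀ v c,
      Ψ (v * (map (assocInl A₁ A₂ A₃) (ofA y) * wr A₁ (coprod A₂ A₃) (inr A₂ A₃ c) -
        map (assocInl A₁ A₂ A₃) (ofA y) * ofB (φ₃ c))) = 0) ?_ ?_ ?_ ?_ ?_ ?_ y v c
    · intro a v c
      have := boolFun_mul_right φ₁ (boolProd φ₂ φ₃) v a (inr A₂ A₃ c)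
      rw [boolProd_inr, ← sub_eq_zero, ← map_sub, ← mul_sub] at this
      exact this
    · intro a v c
      have := absorb v (inl A₂ A₃ a * inr A₂ A₃ c - inl A₂ A₃ a <• φ₃ c) fun d => by
        rw [ofA_sub, ofA_mul, ofA_op_smul]
        exact (boolFun_kernel φ₂ φ₃).right d a c
      rw [wr, (inr _ _).map_sub, ofA_sub, (inr _ _).map_mul, (inr _ _).map_op_smul, ofA_mul,
        ofA_op_smul] at this
      exact this
    · intro x y hx hy v c
      have := congrArg₂ (· + ·) (hx v c) (hy v c)
      simp only [← map_add, ← mul_add] at this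
      rw [← add_zero (0 : B), ← this, ofA_add, Uni.map_add]
      congr 2
      noncomm_ring
    · intro x y hx hy v c
      have := hy (v * map (assocInl A₁ A₂ A₃) (ofA x)) c
      rw [← this, ofA_mul, Uni.map_mul]
      congr 1
      noncomm_ring
    · intro b x hx v c
      have := hx (v * ofB b) c
      rw [← this, ofA_smul, Uni.map_mul, map_ofB]
      congr 1
      noncomm_ring
    · intro b x hx v c
      have := hx v (b • c)
      rw [← this, ofA_op_smul, Uni.map_mul, map_ofB, (inr A₂ A₃).map_smul, wr_smul, φ₃.map_smul,
        ofB_mul]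
      congr 1
      noncomm_ring

theorem boolProd_assoc (x : coprod (coprod A₁ A₂) A₃) :
    boolProd (boolProd φ₁ φ₂) φ₃ x = boolProd φ₁ (boolProd φ₂ φ₃) (assoc A₁ A₂ A₃ x) := by
  have key := (boolFun_kernel (boolProd φ₁ φ₂) φ₃).ext (boolFun_assoc_kernel φ₁ φ₂ φ₃)
    (fun b => ?_) (fun y => ?_) (fun a => ?_) (ofA x)
  · rw [← boolProd_ext, Expectation.ext_ofA] at key
    rw [key]
    show boolFun _ _ (map _ _) = _
    rw [← boolProd_ext, map_ofA, Expectation.ext_ofA]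
  · show _ = boolFun _ _ (map _ _)
    rw [map_ofB, boolFun_ofB, boolFun_ofB]
  · show _ = boolFun _ _ (map _ _)
    rw [map_assoc_wl, boolFun_wl]
    have k : IsBoolKernel φ₁ φ₂ ((boolFun φ₁ (boolProd φ₂ φ₃)).comp
        (mapHom (assocInl A₁ A₂ A₃)).toAddMonoidHom) := by
      constructor
      · intro w c a
        show boolFun _ _ (map _ _) = 0
        rw [Uni.map_mul, Uni.map_sub, Uni.map_mul, Uni.map_mul, mul_sub, map_sub,
          sub_eq_zero, map_assocInl_wl, map_assocInl_wr, map_ofB]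
        exact boolFun_mul_left ..
      · intro w c a
        show boolFun _ _ (map _ _) = 0
        rw [Uni.map_mul, Uni.map_sub, Uni.map_mul, Uni.map_mul, mul_sub, map_sub,
          sub_eq_zero, map_assocInl_wl, map_assocInl_wr, map_ofB]
        rw [boolFun_mul_right, boolProd_inl]
    have := k.ext (boolFun_kernel φ₁ φ₂) (fun b => ?_) (fun a => ?_) (fun c => ?_) (ofA y)
    · rw [← boolProd_ext φ₁ φ₂, Expectation.ext_ofA] at this
      exact this.symm
    · show boolFun _ _ (map _ _) = _
      rw [map_ofB, boolFun_ofB, boolFun_ofB]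
    · show boolFun _ _ (map _ _) = _
      rw [map_assocInl_wl, boolFun_wl, boolFun_wl]
    · show boolFun _ _ (map _ _) = _
      rw [map_assocInl_wr, boolFun_wr, boolFun_wr, boolProd_inl]
  · show _ = boolFun _ _ (map _ _)
    rw [map_assoc_wr, boolFun_wr, boolFun_wr, boolProd_inr]

theorem boolProd_natural {B' : Type u} [Ring B'] [StarRing B'] [Algebra ℂ B'] [StarModule ℂ B']
    (β : B →⋆ₐ[ℂ] B') {D₁ D₂ : BAlg B'} (ψ₁ : Expectation D₁) (ψ₂ : Expectation D₂)
    (f₁ : Hom A₁ (restrict β D₁)) (f₂ : Hom A₂ (restrict β D₂))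
    (h₁ : ∀ a, ψ₁ (under β f₁ a) = β (φ₁ a)) (h₂ : ∀ a, ψ₂ (under β f₂ a) = β (φ₂ a))
    (x : coprod A₁ A₂) : boolProd ψ₁ ψ₂ (under β (coprodMap β f₁ f₂) x) = β (boolProd φ₁ φ₂ x) := by
  let L : Uni (coprod A₁ A₂) →+ B' :=
    (boolFun ψ₁ ψ₂).comp (baseMap β (coprodMap β f₁ f₂)).toAddMonoidHom
  let L' : Uni (coprod A₁ A₂) →+ B' := (β : B →+* B').toAddMonoidHom.comp (boolFun φ₁ φ₂)
  have hL : ∀ x, L x = boolFun ψ₁ ψ₂ (baseMap β (coprodMap β f₁ f₂) x) := fun _ => rfl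
  have hL' : ∀ x, L' x = β (boolFun φ₁ φ₂ x) := fun _ => rfl
  have k : IsBoolKernel φ₁ φ₂ L := by
    constructor
    · intro u c a
      rw [hL, map_mul (baseMap β _), map_sub (baseMap β _), map_mul (baseMap β _),
        map_mul (baseMap β _), mul_sub, map_sub, sub_eq_zero, baseMap_wl,
        baseMap_wr, baseMap_ofB, boolFun_mul_left, h₁]
    · intro u a c
      rw [hL, map_mul (baseMap β _), map_sub (baseMap β _), map_mul (baseMap β _),
        map_mul (baseMap β _), mul_sub, map_sub, sub_eq_zero, baseMap_wl,
        baseMap_wr, baseMap_ofB, boolFun_mul_right, h₂]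
  have k' : IsBoolKernel φ₁ φ₂ L' := by
    constructor
    · intro u c a
      rw [hL', (boolFun_kernel φ₁ φ₂).left, map_zero]
    · intro u c a
      rw [hL', (boolFun_kernel φ₁ φ₂).right, map_zero]
  have e := k.ext k' (fun b => ?_) (fun a => ?_) (fun a => ?_) (ofA x)
  · rw [hL, hL', baseMap_ofA, ← boolProd_ext, ← boolProd_ext, Expectation.ext_ofA,
      Expectation.ext_ofA] at e
    exact e
  · rw [hL, hL', baseMap_ofB, boolFun_ofB, boolFun_ofB]
  · rw [hL, hL', baseMap_wl, boolFun_wl, boolFun_wl, h₁]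
  · rw [hL, hL', baseMap_wr, boolFun_wr, boolFun_wr, h₂]

theorem boolProd_swap (x : coprod A₁ A₂) :
    boolProd φ₁ φ₂ x = boolProd φ₂ φ₁ (swap A₁ A₂ x) := by
  let L : Uni (coprod A₁ A₂) →+ B := (boolFun φ₂ φ₁).comp (mapHom (swap A₁ A₂)).toAddMonoidHom
  have hL : ∀ x, L x = boolFun φ₂ φ₁ (map (swap A₁ A₂) x) := fun _ => rfl
  have e₁ : ∀ a, map (swap A₁ A₂) (wl A₁ A₂ a) = wr A₂ A₁ a := fun _ => rfl
  have e₂ : ∀ a, map (swap A₁ A₂) (wr A₁ A₂ a) = wl A₂ A₁ a := fun _ => rfl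
  have k : IsBoolKernel φ₁ φ₂ L := by
    constructor
    · intro u c a
      rw [hL, Uni.map_mul, Uni.map_sub, Uni.map_mul, Uni.map_mul, mul_sub, map_sub, sub_eq_zero, e₁,
        e₂, map_ofB, boolFun_mul_right]
    · intro u c a
      rw [hL, Uni.map_mul, Uni.map_sub, Uni.map_mul, Uni.map_mul, mul_sub, map_sub, sub_eq_zero, e₁,
        e₂, map_ofB, boolFun_mul_left]
  have e := (boolFun_kernel φ₁ φ₂).ext k (fun b => ?_) (fun a => ?_) (fun a => ?_) (ofA x)
  · rw [hL, ← boolProd_ext, ← boolProd_ext, map_ofA, Expectation.ext_ofA,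
      Expectation.ext_ofA] at e
    exact e
  · rw [hL, map_ofB, boolFun_ofB, boolFun_ofB]
  · rw [hL, e₁, boolFun_wl, boolFun_wr]
  · rw [hL, e₂, boolFun_wl, boolFun_wr]

end Boolean

namespace Independence

/-- Conditional boolean independence. -/
noncomputable def boolean : Independence.{u} where
  prod φ₁ φ₂ := boolProd φ₁ φ₂
  prod_inl φ₁ φ₂ a := boolProd_inl φ₁ φ₂ a
  prod_inr φ₁ φ₂ a := boolProd_inr φ₁ φ₂ a
  associative φ₁ φ₂ φ₃ x := boolProd_assoc φ₁ φ₂ φ₃ x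
  natural β _ _ _ _ φ₁ φ₂ φ₁' φ₂' f₁ f₂ h₁ h₂ x := boolProd_natural φ₁ φ₂ β φ₁' φ₂' f₁ f₂ h₁ h₂ x

theorem boolean_isSymmetric : boolean.{u}.IsSymmetric := fun φ₁ φ₂ x => boolProd_swap φ₁ φ₂ x

theorem boolean_isBoolean : boolean.{u}.IsBoolean := by
  intro B _ _ _ _ A₁ A₂ φ₁ φ₂ w hw hc
  show (boolProd φ₁ φ₂).ext _ = _
  induction w with
  | nil => exact absurd rfl hw
  | cons s w ih =>
    cases w with
    | nil =>
      rw [boolProd_ext]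
      cases s with
      | inl a => simpa [wl] using boolFun_wl φ₁ φ₂ a
      | inr a => simpa [wr] using boolFun_wr φ₁ φ₂ a
    | cons t w =>
      rw [List.isChain_cons_cons] at hc
      have ih' := ih (List.cons_ne_nil _ _) hc.2
      rw [boolProd_ext] at ih' ⊢
      rw [List.map_cons, List.prod_cons] at ih'
      -- Only the first letter is replaced by its expectation, by the mirrored rules; the induction
      -- hypothesis treats the rest.
      rw [List.map_cons, List.map_cons, List.prod_cons, List.prod_cons, List.map_cons,
        List.prod_cons, ← ih', ← boolFun_ofB_mul, ← sub_eq_zero, ← map_sub, ← mul_assoc, ← mul_assoc,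
        ← sub_mul]
      cases s with
      | inl a =>
        cases t with
        | inl c => simp at hc
        | inr c => exact boolFun_left φ₁ φ₂ a c _
      | inr a =>
        cases t with
        | inl c => exact boolFun_right φ₁ φ₂ c a _
        | inr c => simp at hc

end Independence

end CondProb

/-! ### Gram matrices and the monotone product. -/

namespace CondProb

open scoped RightActions

open Uni

/-! ### Gram matrices -/

section Gram

variable {B : Type u} [Ring B] [StarRing B]

/-- The matrix `M` is a finite sum of matrices with entries `c i* c j`. -/
def IsGram {ι : Type*} (M : ι → ι → B) : Prop :=
  ∃ (m : ℕ) (c : Fin m → ι → B), ∀ i j, M i j = ∑ k, star (c k i) * c k j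

theorem IsGram.of_fintype {ι κ : Type*} [Fintype κ] {M : ι → ι → B} (c : κ → ι → B)
    (h : ∀ i j, M i j = ∑ k, star (c k i) * c k j) : IsGram M :=
  ⟨Fintype.card κ, fun k => c ((Fintype.equivFin κ).symm k), fun i j => by
    rw [h, ← (Fintype.equivFin κ).symm.sum_comp]⟩

theorem IsGram.sum {ι κ : Type*} [Fintype κ] {M : κ → ι → ι → B} (h : ∀ p, IsGram (M p)) :
    IsGram fun i j => ∑ p, M p i j := by
  choose m c hc using h
  refine IsGram.of_fintype (κ := Σ p, Fin (m p)) (fun k i => c k.1 k.2 i) fun i j => ?_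
  rw [Fintype.sum_sigma]
  exact Finset.sum_congr rfl fun p _ => hc p i j

theorem Expectation.isGram [Algebra ℂ B] {A : BAlg B} (φ : Expectation A) {ι : Type*} [Fintype ι]
    (x : ι → Uni A) : IsGram fun i j => φ.ext (star (x i) * x j) := by
  obtain ⟨m, c, h⟩ := φ.ext_positive _ fun i => x ((Fintype.equivFin ι).symm i)
  refine ⟨m, fun k i => c k (Fintype.equivFin ι i), fun i j => ?_⟩
  rw [← h, Equiv.symm_apply_apply, Equiv.symm_apply_apply]

end Gram

/-! ### The monotone product -/

section Monotone

variable {B : Type u} [Ring B] [StarRing B] [Algebra ℂ B]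

set_option linter.unusedSectionVars false

variable {A₁ A₂ A₃ : BAlg B} (φ₁ : Expectation A₁) (φ₂ : Expectation A₂) (φ₃ : Expectation A₃)

variable (A₁ A₂) in
/-- The left `B`-linear maps `B ⊕ A₁ → B ⊕ A₂`. -/
def LinMap : AddSubgroup (Uni A₁ → Uni A₂) where
  carrier := {h | (∀ x y, h (x + y) = h x + h y) ∧ ∀ b x, h (ofB b * x) = ofB b * h x}
  zero_mem' := ⟨fun _ _ => by simp, fun _ _ => by simp⟩
  add_mem' {h k} hh hk := ⟨fun x y => by
    simp only [Pi.add_apply, hh.1, hk.1]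
    abel, fun b x => by simp only [Pi.add_apply, hh.2, hk.2, mul_add]⟩
  neg_mem' {h} hh := ⟨fun x y => by
    simp only [Pi.neg_apply, hh.1]
    abel, fun b x => by simp only [Pi.neg_apply, hh.2, mul_neg]⟩

namespace LinMap

theorem ext' {h k : LinMap A₁ A₂} (e : ∀ w, h.1 w = k.1 w) : h = k := Subtype.ext (funext e)

protected theorem add_apply (h k : LinMap A₁ A₂) (x : Uni A₁) : (h + k).1 x = h.1 x + k.1 x := rfl

theorem apply_ofB (h : LinMap A₁ A₂) (b : B) : h.1 (ofB b) = ofB b * h.1 1 := by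
  rw [← h.2.2, mul_one]

/-- The map `x ↦ φ₁(x) y`. -/
def scale (y : Uni A₂) : LinMap A₁ A₂ := ⟨fun x => ofB (φ₁.ext x) * y,
  fun x x' => by beta_reduce; rw [φ₁.ext_add, ofB_add, add_mul],
  fun b x => by beta_reduce; rw [φ₁.ext_ofB_mul, ofB_mul, mul_assoc]⟩

theorem scale_apply (y : Uni A₂) (x : Uni A₁) : (scale φ₁ y).1 x = ofB (φ₁.ext x) * y := rfl

/-- Precomposition with a right multiplication. -/
def shift (x : Uni A₁) (h : LinMap A₁ A₂) : LinMap A₁ A₂ := ⟨fun y => h.1 (y * x),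
  fun y y' => by beta_reduce; rw [add_mul, h.2.1], fun b y => by beta_reduce; rw [mul_assoc, h.2.2]⟩

theorem shift_apply (x : Uni A₁) (h : LinMap A₁ A₂) (y : Uni A₁) :
    (shift x h).1 y = h.1 (y * x) := rfl

end LinMap

open LinMap

/-- The action of `B ⊕ A₁` by shifts. -/
def monoLeft : Uni A₁ →+* Module.End ℤ (LinMap A₁ A₂) where
  toFun x := addEnd (shift x) fun h k => LinMap.ext' fun y => rfl
  map_one' := LinearMap.ext fun h => LinMap.ext' fun y => congrArg h.1 (mul_one y)
  map_mul' x x' := LinearMap.ext fun h => LinMap.ext' fun y => congrArg h.1 (mul_assoc y x x').symm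
  map_zero' := LinearMap.ext fun h => LinMap.ext' fun y => by
    have := h.2.1 0 0
    simp only [addEnd_apply, shift_apply, mul_zero]
    simpa using this
  map_add' x x' := LinearMap.ext fun h => LinMap.ext' fun y => by
    show h.1 (y * (x + x')) = h.1 (y * x) + h.1 (y * x')
    rw [mul_add, h.2.1]

/-- The action of `B ⊕ A₂`. -/
def monoRight : Uni A₂ →+* Module.End ℤ (LinMap A₁ A₂) where
  toFun y := addEnd (fun h => shift (ofB y.1) h + scale φ₁ (ofA y.2 * h.1 1)) fun h k =>
    LinMap.ext' fun x => by
      simp only [LinMap.add_apply, shift_apply, scale_apply, mul_add]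
      abel
  map_one' := LinearMap.ext fun h => LinMap.ext' fun x => by
    simp [LinMap.add_apply, shift_apply, scale_apply]
  map_mul' y y' := LinearMap.ext fun h => LinMap.ext' fun x => by
    simp only [addEnd_apply, Module.End.mul_apply, LinMap.add_apply, shift_apply, scale_apply, mul_fst,
      mul_snd, φ₁.ext_one, ofB_one, one_mul, ofB_mul, φ₁.ext_mul_ofB, apply_ofB, ofA_add, ofA_smul,
      ofA_op_smul, ofA_mul]
    noncomm_ring
  map_zero' := LinearMap.ext fun h => LinMap.ext' fun x => by
    have := h.2.1 0 0
    simp only [addEnd_apply, LinMap.add_apply, shift_apply, scale_apply]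
    simpa using this
  map_add' y y' := LinearMap.ext fun h => LinMap.ext' fun x => by
    simp only [addEnd_apply, LinMap.add_apply, shift_apply, scale_apply, LinearMap.add_apply, add_fst,
      add_snd, ofB_add, ofA_add, mul_add, add_mul, h.2.1]
    abel

variable [StarModule ℂ B]

theorem exists_monoRep : ∃ F : Uni (coprod A₁ A₂) →+* Module.End ℤ (LinMap A₁ A₂),
    (∀ x, F (map (inl A₁ A₂) x) = monoLeft x) ∧
      ∀ x, F (map (inr A₁ A₂) x) = monoRight φ₁ x :=
  exists_ringLift monoLeft (monoRight φ₁) fun b => LinearMap.ext fun h => LinMap.ext' fun x => by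
    simp [monoLeft, monoRight, LinMap.add_apply, shift_apply, scale_apply]

/-- The monotone representation of the coproduct. -/
noncomputable def monoRep : Uni (coprod A₁ A₂) →+* Module.End ℤ (LinMap A₁ A₂) :=
  (exists_monoRep φ₁).choose

theorem monoRep_inl (x : Uni A₁) (h : LinMap A₁ A₂) :
    monoRep φ₁ (map (inl A₁ A₂) x) h = shift x h := by
  rw [monoRep, (exists_monoRep φ₁).choose_spec.1]
  rfl

theorem monoRep_inr (y : Uni A₂) (h : LinMap A₁ A₂) :
    monoRep φ₁ (map (inr A₁ A₂) y) h = shift (ofB y.1) h + scale φ₁ (ofA y.2 * h.1 1) := by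
  rw [monoRep, (exists_monoRep φ₁).choose_spec.2]
  rfl

theorem monoRep_wr (c : A₂) (h : LinMap A₁ A₂) :
    monoRep φ₁ (wr A₁ A₂ c) h = scale φ₁ (ofA c * h.1 1) := by
  have e : wr A₁ A₂ c = map (inr A₁ A₂) (ofA c) := rfl
  have h0 := h.2.1 0 0
  rw [e, monoRep_inr]
  refine LinMap.ext' fun x => ?_
  simp only [LinMap.add_apply, shift_apply, ofA_fst, ofB_zero, mul_zero, ofA_snd]
  have : h.1 0 = 0 := by simpa using h0
  rw [this, zero_add]

theorem monoRep_inr_scale (y w : Uni A₂) :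
    monoRep φ₁ (map (inr A₁ A₂) y) (scale φ₁ w) = scale φ₁ (y * w) := by
  rw [monoRep_inr]
  refine LinMap.ext' fun x => ?_
  rw [LinMap.add_apply, shift_apply, scale_apply, scale_apply, scale_apply, scale_apply, φ₁.ext_mul_ofB,
    φ₁.ext_one, ofB_one, one_mul, ofB_mul]
  conv_rhs => rw [eq_add y]
  noncomm_ring

/-- The compression of the monotone representation: it replaces the elements of `A₁` by their
expectations. -/
noncomputable def monoEv : Uni (coprod A₁ A₂) →+ Uni A₂ :=
  AddMonoidHom.mk' (fun z => (monoRep φ₁ z (scale φ₁ 1)).1 1) fun x y => by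
    rw [_root_.map_add, LinearMap.add_apply, LinMap.add_apply]

theorem monoEv_apply (z : Uni (coprod A₁ A₂)) :
    monoEv φ₁ z = (monoRep φ₁ z (scale φ₁ 1)).1 1 := rfl

/-- A letter of `A₂` leaves a multiple of `scale φ₁`, so an element of `B ⊕ A₁` to its left is seen
only through its expectation. This is the defining property of monotone independence. -/
theorem monoEv_inl_mul_wr_mul (x : Uni A₁) (c : A₂) (z : Uni (coprod A₁ A₂)) :
    monoEv φ₁ (map (inl A₁ A₂) x * wr A₁ A₂ c * z) = ofB (φ₁.ext x) * ofA c * monoEv φ₁ z := by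
  rw [monoEv_apply, map_mul, map_mul, Module.End.mul_apply, Module.End.mul_apply, monoRep_inl,
    monoRep_wr, shift_apply, scale_apply, one_mul, mul_assoc]
  rfl

theorem monoEv_inr_mul (y : Uni A₂) (z : Uni (coprod A₁ A₂)) :
    monoEv φ₁ (map (inr A₁ A₂) y * z) = y * monoEv φ₁ z := by
  rw [monoEv_apply, map_mul, Module.End.mul_apply, monoRep_inr, LinMap.add_apply, shift_apply, scale_apply,
    one_mul, apply_ofB, φ₁.ext_one, ofB_one, one_mul, ← add_mul, ← eq_add]
  rfl

theorem monoEv_inl_mul_inr (x : Uni A₁) (y : Uni A₂) :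
    monoEv φ₁ (map (inl A₁ A₂) x * map (inr A₁ A₂) y) = ofB (φ₁.ext x) * y := by
  rw [monoEv_apply, map_mul, Module.End.mul_apply, monoRep_inr_scale, monoRep_inl, shift_apply,
    scale_apply, one_mul, mul_one]

theorem monoEv_inl (x : Uni A₁) : monoEv φ₁ (map (inl A₁ A₂) x) = ofB (φ₁.ext x) := by
  have := monoEv_inl_mul_inr φ₁ x (1 : Uni A₂)
  rwa [Uni.map_one, mul_one, mul_one] at this

theorem monoEv_inr (y : Uni A₂) : monoEv φ₁ (map (inr A₁ A₂) y) = y := by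
  have := monoEv_inl_mul_inr φ₁ 1 y
  rwa [Uni.map_one, one_mul, φ₁.ext_one, ofB_one, one_mul] at this

/-- The representation commutes with right multiplication of the values by `B`, and on the initial
vector `scale φ₁ 1` the base acts by such a multiplication. -/
theorem monoEv_mul_ofB (z : Uni (coprod A₁ A₂)) (b : B) :
    monoEv φ₁ (z * ofB b) = monoEv φ₁ z * ofB b := by
  have key : ∀ (h k : LinMap A₁ A₂), (∀ x, k.1 x = h.1 x * ofB b) →
      ∀ x, (monoRep φ₁ z k).1 x = (monoRep φ₁ z h).1 x * ofB b := by
    refine word_induction (p := fun z => ∀ (h k : LinMap A₁ A₂), (∀ x, k.1 x = h.1 x * ofB b) →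
      ∀ x, (monoRep φ₁ z k).1 x = (monoRep φ₁ z h).1 x * ofB b) (fun b' h k e x => ?_)
      (fun a h k e x => ?_) (fun a h k e x => ?_) (fun y y' hy hy' h k e x => ?_)
      (fun y y' hy hy' h k e x => ?_) z
    · rw [← map_ofB (inl A₁ A₂), monoRep_inl, monoRep_inl, shift_apply, shift_apply, e]
    · have e' : wl A₁ A₂ a = map (inl A₁ A₂) (ofA a) := rfl
      rw [e', monoRep_inl, monoRep_inl, shift_apply, shift_apply, e]
    · rw [monoRep_wr, monoRep_wr, scale_apply, scale_apply, e, mul_assoc, mul_assoc]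
    · rw [_root_.map_add, LinearMap.add_apply, LinearMap.add_apply, LinMap.add_apply, LinMap.add_apply,
        hy h k e, hy' h k e, add_mul]
    · rw [map_mul, Module.End.mul_apply, Module.End.mul_apply]
      exact hy _ _ (hy' h k e) x
  rw [monoEv_apply, map_mul, Module.End.mul_apply]
  refine key _ _ (fun x => ?_) 1
  rw [← map_ofB (inr A₁ A₂), monoRep_inr_scale, scale_apply, scale_apply, mul_one, mul_one]

/-- The left rule for the monotone product: together with the values on the products
`x y` it determines a functional. -/
def IsMonoKernel {G : Type*} [AddCommGroup G] (L : Uni (coprod A₁ A₂) →+ G) : Prop :=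
  ∀ u c x w, L (u * (wr A₁ A₂ c * map (inl A₁ A₂) (x - ofB (φ₁.ext x)) * map (inr A₁ A₂) w)) = 0

/-- The left ideal generated by the rule for the monotone product. -/
def monoIdeal : Ideal (Uni (coprod A₁ A₂)) := Ideal.span
  {z | ∃ c x w, z = wr A₁ A₂ c * map (inl A₁ A₂) (x - ofB (φ₁.ext x)) * map (inr A₁ A₂) w}

theorem monoEv_kernel : IsMonoKernel φ₁ (monoEv (A₂ := A₂) φ₁) := by
  intro u c x w
  rw [monoEv_apply, map_mul, Module.End.mul_apply, map_mul, map_mul, Module.End.mul_apply,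
    Module.End.mul_apply, monoRep_inr_scale, monoRep_inl, monoRep_wr, shift_apply, scale_apply,
    one_mul, φ₁.ext_sub, φ₁.ext_ofB, sub_self, ofB_zero, zero_mul, mul_zero]
  have : scale φ₁ (0 : Uni A₂) = 0 := LinMap.ext' fun x => mul_zero _
  rw [this, _root_.map_zero]
  rfl

theorem IsMonoKernel.eq_zero {φ₁ : Expectation A₁} {G : Type*} [AddCommGroup G]
    {L : Uni (coprod A₁ A₂) →+ G} (h : IsMonoKernel φ₁ L) {z : Uni (coprod A₁ A₂)}
    (hz : z ∈ monoIdeal φ₁) : ∀ u, L (u * z) = 0 := by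
  refine Submodule.span_induction (p := fun z _ => ∀ u, L (u * z) = 0) ?_ ?_ ?_ ?_ hz
  · rintro z ⟨c, x, w, rfl⟩ u
    exact h u c x w
  · intro u
    simp
  · intro x y _ _ hx hy u
    rw [mul_add, _root_.map_add, hx, hy, add_zero]
  · intro r x _ hx u
    rw [smul_eq_mul, ← mul_assoc, hx]

/-- An element of `B ⊕ A₁` enclosed between a letter of `A₂` and an element of `B ⊕ A₂` becomes its
expectation, so only products of one element of `B ⊕ A₁` and one of `B ⊕ A₂` remain. -/
theorem exists_mono_reduction (z : Uni (coprod A₁ A₂)) :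
    ∃ (n : ℕ) (x : Fin n → Uni A₁) (y : Fin n → Uni A₂),
      z - ∑ k, map (inl A₁ A₂) (x k) * map (inr A₁ A₂) (y k) ∈ monoIdeal φ₁ := by
  have key : ∀ (x : Uni A₁) (y : Uni A₂), ∃ (n : ℕ) (x' : Fin n → Uni A₁) (y' : Fin n → Uni A₂),
      z * (map (inl A₁ A₂) x * map (inr A₁ A₂) y) -
        ∑ k, map (inl A₁ A₂) (x' k) * map (inr A₁ A₂) (y' k) ∈ monoIdeal φ₁ := by
    refine word_induction (p := fun z => ∀ (x : Uni A₁) (y : Uni A₂),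
      ∃ (n : ℕ) (x' : Fin n → Uni A₁) (y' : Fin n → Uni A₂),
      z * (map (inl A₁ A₂) x * map (inr A₁ A₂) y) -
        ∑ k, map (inl A₁ A₂) (x' k) * map (inr A₁ A₂) (y' k) ∈ monoIdeal φ₁)
      (fun b x y => ?_) (fun a x y => ?_) (fun c x y => ?_)
      (fun z z' hz hz' x y => ?_) (fun z z' hz hz' x y => ?_) z
    · refine ⟨1, fun _ => ofB b * x, fun _ => y, ?_⟩
      rw [Fin.sum_univ_one, Uni.map_mul, map_ofB, mul_assoc, sub_self]
      exact zero_mem _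
    · refine ⟨1, fun _ => ofA a * x, fun _ => y, ?_⟩
      rw [Fin.sum_univ_one, Uni.map_mul, map_ofA, mul_assoc, wl, sub_self]
      exact zero_mem _
    · refine ⟨1, fun _ => 1, fun _ => ofA c * ofB (φ₁.ext x) * y, ?_⟩
      rw [Fin.sum_univ_one, Uni.map_one, one_mul, Uni.map_mul, Uni.map_mul, map_ofB, map_ofA]
      refine Ideal.subset_span ⟨c, x, y, ?_⟩
      rw [Uni.map_sub, map_ofB, wr]
      noncomm_ring
    · obtain ⟨n, x', y', h⟩ := hz x y
      obtain ⟨n', x'', y'', h'⟩ := hz' x y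
      refine ⟨n + n', Fin.append x' x'', Fin.append y' y'', ?_⟩
      convert add_mem h h' using 1
      simp only [Fin.sum_univ_add, Fin.append_left, Fin.append_right]
      rw [add_mul]
      abel
    · obtain ⟨n, x', y', h⟩ := hz' x y
      choose n' x'' y'' h' using fun k => hz (x' k) (y' k)
      let e := Fintype.equivFin (Σ k, Fin (n' k))
      refine ⟨_, fun i => x'' (e.symm i).1 (e.symm i).2, fun i => y'' (e.symm i).1 (e.symm i).2, ?_⟩
      rw [e.symm.sum_comp fun i => map (inl A₁ A₂) (x'' i.1 i.2) * map (inr A₁ A₂) (y'' i.1 i.2),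
        Fintype.sum_sigma]
      have h'' := sum_mem fun k (_ : k ∈ Finset.univ) => h' k
      convert add_mem (Ideal.mul_mem_left _ z h) h'' using 1
      rw [Finset.sum_sub_distrib, mul_sub, Finset.mul_sum, mul_assoc]
      abel
  have := key 1 1
  rwa [Uni.map_one, Uni.map_one, mul_one, mul_one] at this

theorem IsMonoKernel.ext {φ₁ : Expectation A₁} {G : Type*} [AddCommGroup G]
    {L L' : Uni (coprod A₁ A₂) →+ G} (h : IsMonoKernel φ₁ L) (h' : IsMonoKernel φ₁ L')
    (e : ∀ x y, L (map (inl A₁ A₂) x * map (inr A₁ A₂) y) =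
      L' (map (inl A₁ A₂) x * map (inr A₁ A₂) y)) (z : Uni (coprod A₁ A₂)) : L z = L' z := by
  obtain ⟨n, x, y, hz⟩ := exists_mono_reduction φ₁ z
  have e₁ := h.eq_zero hz 1
  have e₂ := h'.eq_zero hz 1
  rw [one_mul, _root_.map_sub, sub_eq_zero] at e₁ e₂
  rw [e₁, e₂, map_sum, map_sum]
  exact Finset.sum_congr rfl fun k _ => e _ _

/-- The monotone product functional. -/
noncomputable def monoFun : Uni (coprod A₁ A₂) →+ B := φ₂.extHom.comp (monoEv φ₁)

theorem monoFun_apply (z : Uni (coprod A₁ A₂)) :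
    monoFun φ₁ φ₂ z = φ₂.ext (monoEv φ₁ z) := rfl

theorem monoFun_kernel : IsMonoKernel φ₁ (monoFun φ₁ φ₂) := fun u c x w => by
  rw [monoFun_apply, monoEv_kernel, φ₂.ext_zero]

/-- The conjugate functional satisfies the same rule because `monoEv` also kills a centred element
in front of a letter of `A₂`. -/
theorem monoFun_star (z : Uni (coprod A₁ A₂)) :
    monoFun φ₁ φ₂ (star z) = star (monoFun φ₁ φ₂ z) := by
  have h : IsMonoKernel φ₁ (conjFun (monoFun φ₁ φ₂)) := by
    intro u c x w
    have e : monoEv φ₁ (map (inl A₁ A₂) (star (x - ofB (φ₁.ext x))) * wr A₁ A₂ (star c) * star u) =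
        0 := by
      rw [monoEv_inl_mul_wr_mul, φ₁.ext_star, φ₁.ext_sub, φ₁.ext_ofB, sub_self, star_zero, ofB_zero,
        zero_mul, zero_mul]
    rw [conjFun_apply, star_eq_zero, star_mul, star_mul, star_mul, ← Uni.map_star, ← Uni.map_star,
      star_wr, monoFun_apply, mul_assoc, monoEv_inr_mul, e, mul_zero, φ₂.ext_zero]
  have e := h.ext (monoFun_kernel φ₁ φ₂) (fun x y => by
    rw [conjFun_apply, star_mul, ← Uni.map_star, ← Uni.map_star, monoFun_apply, monoFun_apply,
      monoEv_inl_mul_inr, monoEv_inr_mul, monoEv_inl, φ₂.ext_mul_ofB, φ₂.ext_ofB_mul, φ₂.ext_star,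
      φ₁.ext_star, star_mul, star_star, star_star]) z
  rw [conjFun_apply] at e
  rw [← e, star_star]

theorem monoFun_gram (x x' : Uni A₁) (y y' : Uni A₂) :
    monoFun φ₁ φ₂ (star (map (inl A₁ A₂) x * map (inr A₁ A₂) y) *
      (map (inl A₁ A₂) x' * map (inr A₁ A₂) y')) =
    φ₂.ext (star y * (ofB (φ₁.ext (star x * x')) * y')) := by
  rw [star_mul, ← Uni.map_star, ← Uni.map_star, mul_assoc, ← mul_assoc (map _ (star x)),
    ← Uni.map_mul, monoFun_apply, monoEv_inr_mul, monoEv_inl_mul_inr]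

/-- The inner product of `x y` and `x' y'` is the expectation of `y* φ₁(x* x') y'`. Writing the
matrix `φ₁(x* x')` as a sum of `c* c` turns it into a sum of Gram matrices of `φ₂` for the elements
`c y`. -/
theorem monoFun_isGram {n : ℕ} (N : Fin n → ℕ) (x : ∀ i, Fin (N i) → Uni A₁)
    (y : ∀ i, Fin (N i) → Uni A₂) : IsGram fun i j => monoFun φ₁ φ₂
      (star (∑ k, map (inl A₁ A₂) (x i k) * map (inr A₁ A₂) (y i k)) *
        ∑ k, map (inl A₁ A₂) (x j k) * map (inr A₁ A₂) (y j k)) := by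
  obtain ⟨m, c, hc⟩ := φ₁.isGram fun p : Σ i, Fin (N i) => x p.1 p.2
  have h := IsGram.sum fun l : Fin m => φ₂.isGram fun i : Fin n =>
    ∑ k, ofB (c l ⟨i, k⟩) * y i k
  convert h using 3 with i j
  have hc' : ∀ k l, φ₁.ext (star (x i k) * x j l) = _ := fun k l => hc ⟨i, k⟩ ⟨j, l⟩
  have e : ∀ k l, monoFun φ₁ φ₂ (star (map (inl A₁ A₂) (x i k) * map (inr A₁ A₂) (y i k)) *
      (map (inl A₁ A₂) (x j l) * map (inr A₁ A₂) (y j l))) =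
      ∑ p, φ₂.ext (star (ofB (c p ⟨i, k⟩) * y i k) * (ofB (c p ⟨j, l⟩) * y j l)) := fun k l => by
    rw [monoFun_gram, hc', ← ofBHom_apply, map_sum, Finset.sum_mul, Finset.mul_sum, φ₂.ext_sum]
    refine Finset.sum_congr rfl fun p _ => ?_
    rw [ofBHom_apply, ofB_mul, star_mul, star_ofB]
    congr 1
    noncomm_ring
  -- What remains is to interchange finite sums so that the index of `c` becomes the outermost one.
  simp only [star_sum, Finset.sum_mul_sum, map_sum, φ₂.ext_sum, e]
  rw [Finset.sum_comm]
  refine (Finset.sum_congr rfl fun k _ => Finset.sum_comm).trans ?_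
  rw [Finset.sum_comm]
  refine Finset.sum_congr rfl fun k _ => ?_
  rw [Finset.sum_comm]

/-- The monotone product of two conditional expectations. -/
noncomputable def monoProd : Expectation (coprod A₁ A₂) :=
  Expectation.ofExt (monoFun φ₁ φ₂)
    (fun b => by rw [monoFun_apply, ← map_ofB (inr A₁ A₂), monoEv_inr, φ₂.ext_ofB])
    (fun b z => by
      rw [monoFun_apply, ← map_ofB (inr A₁ A₂), monoEv_inr_mul, φ₂.ext_ofB_mul, monoFun_apply])
    (fun z b => by rw [monoFun_apply, monoEv_mul_ofB, φ₂.ext_mul_ofB, monoFun_apply]) <| by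
    refine positive_of_congr _ (monoFun_star φ₁ φ₂)
      {z | ∃ (n : ℕ) (x : Fin n → Uni A₁) (y : Fin n → Uni A₂),
        z = ∑ k, map (inl A₁ A₂) (x k) * map (inr A₁ A₂) (y k)} (fun z => ?_) fun n z hz => ?_
    · obtain ⟨n, x, y, h⟩ := exists_mono_reduction φ₁ z
      exact ⟨_, ⟨n, x, y, rfl⟩, (monoFun_kernel φ₁ φ₂).eq_zero h⟩
    · choose N x y hz using hz
      obtain ⟨m, c, h⟩ := monoFun_isGram φ₁ φ₂ N x y
      exact ⟨m, c, fun i j => by rw [← h, hz, hz]⟩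

theorem monoProd_ext (z : Uni (coprod A₁ A₂)) : (monoProd φ₁ φ₂).ext z = monoFun φ₁ φ₂ z :=
  Expectation.ofExt_ext ..

theorem monoProd_apply (z : coprod A₁ A₂) : monoProd φ₁ φ₂ z = φ₂.ext (monoEv φ₁ (ofA z)) := rfl

theorem monoProd_inl (a : A₁) : monoProd φ₁ φ₂ (inl A₁ A₂ a) = φ₁ a := by
  rw [monoProd_apply, ← map_ofA, monoEv_inl, φ₂.ext_ofB, φ₁.ext_ofA]

theorem monoProd_inr (a : A₂) : monoProd φ₁ φ₂ (inr A₁ A₂ a) = φ₂ a := by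
  rw [monoProd_apply, ← map_ofA, monoEv_inr, φ₂.ext_ofA]

/-- The maps with values in a left ideal of `B ⊕ A₂` form a subrepresentation. -/
theorem monoEv_absorb (J : Ideal (Uni A₂)) (u : Uni (coprod A₁ A₂)) : ∀ h : LinMap A₁ A₂,
    (∀ x, h.1 x ∈ J) → ∀ x, (monoRep φ₁ u h).1 x ∈ J := by
  refine word_induction (p := fun u => ∀ h : LinMap A₁ A₂,
    (∀ x, h.1 x ∈ J) → ∀ x, (monoRep φ₁ u h).1 x ∈ J) (fun b h hh x => ?_) (fun a h hh x => ?_)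
    (fun a h hh x => ?_) (fun y y' hy hy' h hh x => ?_) (fun y y' hy hy' h hh x => ?_) u
  · rw [← map_ofB (inl A₁ A₂), monoRep_inl]
    exact hh _
  · have e' : wl A₁ A₂ a = map (inl A₁ A₂) (ofA a) := rfl
    rw [e', monoRep_inl]
    exact hh _
  · rw [monoRep_wr, scale_apply]
    exact J.mul_mem_left _ (J.mul_mem_left _ (hh _))
  · rw [_root_.map_add, LinearMap.add_apply, LinMap.add_apply]
    exact J.add_mem (hy h hh x) (hy' h hh x)
  · rw [map_mul, Module.End.mul_apply]
    exact hy _ (hy' h hh) x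

/-- Compression of `A₁` ignores what stands to the right as long as it comes from `A₂ ⊔ A₃`: both
sides satisfy the same rule in `y`. -/
theorem monoEv_assocInl (y : Uni (coprod A₁ A₂)) (w : Uni (coprod A₂ A₃)) :
    monoEv φ₁ (map (assocInl A₁ A₂ A₃) y * map (inr A₁ (coprod A₂ A₃)) w) =
      map (inl A₂ A₃) (monoEv φ₁ y) * w := by
  let L : Uni (coprod A₁ A₂) →+ Uni (coprod A₂ A₃) := ((monoEv φ₁).comp
    (AddMonoidHom.mulRight (map (inr A₁ (coprod A₂ A₃)) w))).comp
      (mapHom (assocInl A₁ A₂ A₃)).toAddMonoidHom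
  let L' : Uni (coprod A₁ A₂) →+ Uni (coprod A₂ A₃) := (AddMonoidHom.mulRight w).comp
    ((mapHom (inl A₂ A₃)).toAddMonoidHom.comp (monoEv φ₁))
  have hl : ∀ x : Uni A₁, map (assocInl A₁ A₂ A₃) (map (inl A₁ A₂) x) =
    map (inl A₁ (coprod A₂ A₃)) x := fun _ => rfl
  have hr : ∀ x : Uni A₂, map (assocInl A₁ A₂ A₃) (map (inr A₁ A₂) x) =
    map (inr A₁ (coprod A₂ A₃)) (map (inl A₂ A₃) x) := fun _ => rfl
  have k : IsMonoKernel φ₁ L := by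
    intro u c x v
    show monoEv φ₁ (map _ _ * _) = 0
    rw [Uni.map_mul, Uni.map_mul, Uni.map_mul, hl, hr, mul_assoc, mul_assoc, ← Uni.map_mul,
      map_assocInl_wr]
    exact monoEv_kernel φ₁ _ _ _ _
  have k' : IsMonoKernel φ₁ L' := by
    intro u c x v
    show map (inl A₂ A₃) (monoEv φ₁ _) * w = 0
    rw [monoEv_kernel, Uni.map_zero, zero_mul]
  refine k.ext k' (fun x v => ?_) y
  show monoEv φ₁ (map _ _ * _) = map (inl A₂ A₃) (monoEv φ₁ _) * w
  rw [Uni.map_mul, hl, hr, mul_assoc, ← Uni.map_mul, monoEv_inl_mul_inr, monoEv_inl_mul_inr,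
    Uni.map_mul, map_ofB, mul_assoc]

/-- Associativity in its sharp form: compressing `A₁ ⊔ A₂` in one step is compressing `A₁` and
afterwards `A₂`. -/
theorem monoEv_assoc (z : Uni (coprod (coprod A₁ A₂) A₃)) :
    monoEv (monoProd φ₁ φ₂) z = monoEv φ₂ (monoEv φ₁ (map (assoc A₁ A₂ A₃) z)) := by
  let L : Uni (coprod (coprod A₁ A₂) A₃) →+ Uni A₃ := (monoEv φ₂).comp ((monoEv φ₁).comp
    (mapHom (assoc A₁ A₂ A₃)).toAddMonoidHom)
  have hl : ∀ y : Uni (coprod A₁ A₂), map (assoc A₁ A₂ A₃) (map (inl (coprod A₁ A₂) A₃) y) =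
    map (assocInl A₁ A₂ A₃) y := fun _ => rfl
  have hr : ∀ y : Uni A₃, map (assoc A₁ A₂ A₃) (map (inr (coprod A₁ A₂) A₃) y) =
    map (inr A₁ (coprod A₂ A₃)) (map (inr A₂ A₃) y) := fun _ => rfl
  have k : IsMonoKernel (monoProd φ₁ φ₂) L := by
    intro u c y w
    show monoEv φ₂ (monoEv φ₁ (map _ _)) = 0
    rw [Uni.map_mul, Uni.map_mul, Uni.map_mul, hl, hr, map_assoc_wr, mul_assoc]
    -- An element centred for the product of `φ₁` and `φ₂` is compressed to one centred for `φ₂`.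
    -- The compressed word therefore lies in the ideal of the rule for `φ₂`, and `monoEv_absorb`
    -- takes care of `u`.
    have h0 : φ₂.ext (monoEv φ₁ (y - ofB ((monoProd φ₁ φ₂).ext y))) = 0 := by
      rw [_root_.map_sub, φ₂.ext_sub, monoProd_ext, ← map_ofB (inr A₁ A₂), monoEv_inr, φ₂.ext_ofB]
      exact sub_self _
    generalize y - ofB ((monoProd φ₁ φ₂).ext y) = y' at h0
    have hJ := monoEv_absorb φ₁ (monoIdeal φ₂ (A₂ := A₃)) (map (assoc A₁ A₂ A₃) u)
      (monoRep φ₁ (wr A₁ (coprod A₂ A₃) (inr A₂ A₃ c) * (map (assocInl A₁ A₂ A₃) y' *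
        map (inr A₁ (coprod A₂ A₃)) (map (inr A₂ A₃) w))) (scale φ₁ 1)) (fun x => by
        rw [map_mul, Module.End.mul_apply, monoRep_wr, scale_apply, ← monoEv_apply, monoEv_assocInl]
        refine Ideal.mul_mem_left _ _ (Ideal.subset_span ⟨c, monoEv φ₁ y', w, ?_⟩)
        rw [h0, ofB_zero, sub_zero, ← mul_assoc]
        rfl) 1
    rw [← Module.End.mul_apply, ← map_mul, ← monoEv_apply] at hJ
    have := (monoEv_kernel φ₂).eq_zero hJ 1
    rwa [one_mul] at this
  refine (monoEv_kernel _).ext k (fun y w => ?_) z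
  show _ = monoEv φ₂ (monoEv φ₁ (map _ _))
  rw [Uni.map_mul, hl, hr, monoEv_assocInl, monoEv_inl_mul_inr, monoEv_inl_mul_inr, monoProd_ext,
    monoFun_apply]

theorem monoProd_assoc (x : coprod (coprod A₁ A₂) A₃) :
    monoProd (monoProd φ₁ φ₂) φ₃ x = monoProd φ₁ (monoProd φ₂ φ₃) (assoc A₁ A₂ A₃ x) := by
  rw [monoProd_apply, monoProd_apply, monoEv_assoc, monoProd_ext, monoFun_apply, map_ofA]

theorem monoEv_natural {B' : Type u} [Ring B'] [StarRing B'] [Algebra ℂ B'] [StarModule ℂ B']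
    (β : B →⋆ₐ[ℂ] B') {D₁ D₂ : BAlg B'} (ψ₁ : Expectation D₁)
    (f₁ : Hom A₁ (restrict β D₁)) (f₂ : Hom A₂ (restrict β D₂))
    (h₁ : ∀ a, ψ₁ (under β f₁ a) = β (φ₁ a)) (z : Uni (coprod A₁ A₂)) :
    monoEv ψ₁ (baseMap β (coprodMap β f₁ f₂) z) = baseMap β f₂ (monoEv φ₁ z) := by
  let L : Uni (coprod A₁ A₂) →+ Uni D₂ :=
    (monoEv ψ₁).comp (baseMap β (coprodMap β f₁ f₂)).toAddMonoidHom
  let L' : Uni (coprod A₁ A₂) →+ Uni D₂ := (baseMap β f₂).toAddMonoidHom.comp (monoEv φ₁)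
  have hl : ∀ x, baseMap β (coprodMap β f₁ f₂) (map (inl A₁ A₂) x) =
    map (inl D₁ D₂) (baseMap β f₁ x) := fun _ => rfl
  have hr : ∀ x, baseMap β (coprodMap β f₁ f₂) (map (inr A₁ A₂) x) =
    map (inr D₁ D₂) (baseMap β f₂ x) := fun _ => rfl
  have k : IsMonoKernel φ₁ L := by
    intro u c x v
    show monoEv ψ₁ (baseMap β _ _) = 0
    rw [map_mul (baseMap β _), map_mul (baseMap β _), map_mul (baseMap β _), hl, hr, baseMap_wr,
      map_sub (baseMap β _), baseMap_ofB, ← ext_baseMap β h₁]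
    exact monoEv_kernel ψ₁ _ _ _ _
  have k' : IsMonoKernel φ₁ L' := by
    intro u c x v
    show baseMap β f₂ (monoEv φ₁ _) = 0
    rw [monoEv_kernel, _root_.map_zero]
  refine k.ext k' (fun x v => ?_) z
  show monoEv ψ₁ (baseMap β _ _) = baseMap β f₂ (monoEv φ₁ _)
  rw [map_mul (baseMap β _), hl, hr, monoEv_inl_mul_inr, monoEv_inl_mul_inr,
    map_mul (baseMap β _), baseMap_ofB, ext_baseMap β h₁]

theorem monoProd_natural {B' : Type u} [Ring B'] [StarRing B'] [Algebra ℂ B'] [StarModule ℂ B']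
    (β : B →⋆ₐ[ℂ] B') {D₁ D₂ : BAlg B'} (ψ₁ : Expectation D₁) (ψ₂ : Expectation D₂)
    (f₁ : Hom A₁ (restrict β D₁)) (f₂ : Hom A₂ (restrict β D₂))
    (h₁ : ∀ a, ψ₁ (under β f₁ a) = β (φ₁ a)) (h₂ : ∀ a, ψ₂ (under β f₂ a) = β (φ₂ a))
    (x : coprod A₁ A₂) :
    monoProd ψ₁ ψ₂ (under β (coprodMap β f₁ f₂) x) = β (monoProd φ₁ φ₂ x) := by
  rw [monoProd_apply, monoProd_apply, ← baseMap_ofA, monoEv_natural φ₁ β ψ₁ f₁ f₂ h₁,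
    ext_baseMap β h₂]

end Monotone

namespace Independence

/-- Conditional monotone independence. -/
noncomputable def monotone : Independence.{u} where
  prod φ₁ φ₂ := monoProd φ₁ φ₂
  prod_inl φ₁ φ₂ a := monoProd_inl φ₁ φ₂ a
  prod_inr φ₁ φ₂ a := monoProd_inr φ₁ φ₂ a
  associative φ₁ φ₂ φ₃ x := monoProd_assoc φ₁ φ₂ φ₃ x
  natural β _ _ _ _ φ₁ φ₂ φ₁' φ₂' f₁ f₂ h₁ h₂ x := monoProd_natural φ₁ φ₂ β φ₁' φ₂' f₁ f₂ h₁ h₂ x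

theorem monotone_isMonotone : monotone.{u}.IsMonotone := by
  intro B _ _ _ _ A₁ A₂ φ₁ φ₂ x z y w
  have key : ∀ v, monoEv φ₁ ((w.map (fun p => map (inl A₁ A₂) p.1 * ofA (inr A₁ A₂ p.2))).prod *
      v) = (w.map (fun p => (ofB (φ₁.ext p.1) * ofA p.2 : Uni A₂))).prod * monoEv φ₁ v := by
    intro v
    induction w with
    | nil => simp
    | cons p w ih =>
      rw [List.map_cons, List.map_cons, List.prod_cons, List.prod_cons, mul_assoc _ _ v, mul_assoc _ _ (monoEv φ₁ v),
        ← ih]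
      exact monoEv_inl_mul_wr_mul φ₁ p.1 p.2 _
  have e := monoEv_inl_mul_wr_mul φ₁ x y
    ((w.map (fun p => map (inl A₁ A₂) p.1 * ofA (inr A₁ A₂ p.2))).prod * map (inl A₁ A₂) z)
  rw [key, monoEv_inl, wr, ← mul_assoc] at e
  show (monoProd φ₁ φ₂).ext _ = _
  rw [monoProd_ext, monoFun_apply, e, ← mul_assoc, φ₂.ext_mul_ofB, mul_assoc, φ₂.ext_ofB_mul]

end Independence

end CondProb

/-! ### Combinatorics of alternating products of centred elements. -/

namespace CondProb

open scoped RightActions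

open Uni

/-! ### Alternating products -/

section Alternating

variable {ι κ R R' : Type*} [Ring R] [Ring R']

/-- The alternating products of elements of the sets `Z i`, where `i` ranges over `S`. The index
is that of the first factor. -/
inductive IsAlt (S : Set ι) (Z : ι → AddSubgroup R) : ι → R → Prop
  | single {i : ι} {x : R} (hi : i ∈ S) (hx : x ∈ Z i) : IsAlt S Z i x
  | mul {i j : ι} {x y : R} (hi : i ∈ S) (hij : i ≠ j) (hx : x ∈ Z i) (hy : IsAlt S Z j y) :
      IsAlt S Z i (x * y)

variable {S : Set ι} {Z : ι → AddSubgroup R}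

theorem IsAlt.mem {i : ι} {x : R} (h : IsAlt S Z i x) : i ∈ S := by
  cases h <;> assumption

theorem IsAlt.map {S' : Set κ} {Z' : κ → AddSubgroup R'} (F : R →+* R') (p : ι → κ)
    (hp : ∀ i ∈ S, ∀ j ∈ S, p i = p j → i = j) (hS : ∀ i ∈ S, p i ∈ S')
    (hZ : ∀ i ∈ S, ∀ x ∈ Z i, F x ∈ Z' (p i)) {i : ι} {x : R} (h : IsAlt S Z i x) :
    IsAlt S' Z' (p i) (F x) := by
  induction h with
  | single hi hx => exact .single (hS _ hi) (hZ _ hi _ hx)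
  | mul hi hij hx hy ih =>
    rw [map_mul]
    exact .mul (hS _ hi) (fun e => hij (hp _ hi _ hy.mem e)) (hZ _ hi _ hx) ih

theorem IsAlt.mono {S' : Set ι} (hS : S ⊆ S') {i : ι} {x : R} (h : IsAlt S Z i x) :
    IsAlt S' Z i x := by
  induction h with
  | single hi hx => exact .single (hS hi) hx
  | mul hi hij hx _ ih => exact .mul (hS hi) hij hx ih

theorem IsAlt.mem_of_subsingleton (hS : ∀ i ∈ S, ∀ j ∈ S, i = j) {i : ι} {x : R}
    (h : IsAlt S Z i x) : x ∈ Z i := by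
  cases h with
  | single _ hx => exact hx
  | mul hi hij _ hy => exact absurd (hS _ hi _ hy.mem) hij

theorem IsAlt.exists_lift {Z' : κ → AddSubgroup R'} (F : R' →+* R) (p : ι → κ)
    (hp : ∀ i ∈ S, ∀ j ∈ S, p i = p j → i = j)
    (hZ : ∀ i ∈ S, ∀ x ∈ Z i, ∃ x' ∈ Z' (p i), F x' = x) {i : ι} {x : R} (h : IsAlt S Z i x) :
    ∃ x', IsAlt Set.univ Z' (p i) x' ∧ F x' = x := by
  induction h with
  | single hi hx =>
    obtain ⟨x', hx', rfl⟩ := hZ _ hi _ hx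
    exact ⟨x', .single trivial hx', rfl⟩
  | mul hi hij hx hy ih =>
    obtain ⟨x', hx', rfl⟩ := hZ _ hi _ hx
    obtain ⟨y', hy', rfl⟩ := ih
    exact ⟨x' * y', .mul trivial (fun e => hij (hp _ hi _ hy.mem e)) hx' hy', map_mul F _ _⟩

/-- Factors of an alternating product may be grouped. -/
theorem IsAlt.group {Y : κ → AddSubgroup R} (p : ι → κ)
    (hY : ∀ i y, IsAlt {j | p j = p i} Z i y → y ∈ Y (p i)) {i : ι} {x : R}
    (h : IsAlt Set.univ Z i x) : IsAlt Set.univ Y (p i) x := by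
  -- The first block is kept apart from the grouped remainder, so that it can still grow by a factor
  -- on the left.
  have key : ∃ y, IsAlt {j | p j = p i} Z i y ∧
      (x = y ∨ ∃ l w, p i ≠ l ∧ IsAlt Set.univ Y l w ∧ x = y * w) := by
    induction h with
    | single hi hx => exact ⟨_, .single rfl hx, Or.inl rfl⟩
    | @mul i j x y hi hij hx hy ih =>
      obtain ⟨y', hy', h'⟩ := ih
      by_cases hp : p i = p j
      · rw [← hp] at hy' h'
        refine ⟨x * y', .mul rfl hij hx hy', ?_⟩
        rcases h' with rfl | ⟨l, w, hl, hw, rfl⟩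
        · exact Or.inl rfl
        · exact Or.inr ⟨l, w, hl, hw, (mul_assoc _ _ _).symm⟩
      · refine ⟨x, .single rfl hx, Or.inr ⟨p j, y, hp, ?_, rfl⟩⟩
        rcases h' with rfl | ⟨l, w, hl, hw, rfl⟩
        · exact .single trivial (hY _ _ hy')
        · exact .mul trivial hl (hY _ _ hy') hw
  obtain ⟨y, hy, rfl | ⟨l, w, hl, hw, rfl⟩⟩ := key
  · exact .single trivial (hY _ _ hy)
  · exact .mul trivial hl (hY _ _ hy) hw

variable (Z) in
/-- The additive span of the alternating products that begin with a factor from `Z i`. -/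
def altSpan (i : ι) : AddSubgroup R := AddSubgroup.closure {x | IsAlt Set.univ Z i x}

/-- The rules that allow to reduce all products to alternating products. -/
structure IsCentred {B : Type*} [Ring B] (β : B →+* R) (Z : ι → AddSubgroup R) : Prop where
  left : ∀ b i, ∀ x ∈ Z i, β b * x ∈ Z i
  right : ∀ b i, ∀ x ∈ Z i, x * β b ∈ Z i
  mul : ∀ i, ∀ x ∈ Z i, ∀ y ∈ Z i, ∃ b, x * y - β b ∈ Z i

namespace IsCentred

variable {B : Type*} [Ring B] {β : B →+* R} (h : IsCentred β Z)

include h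

theorem base_mul {b : B} {i : ι} {x : R} (hx : x ∈ altSpan Z i) : β b * x ∈ altSpan Z i := by
  refine AddSubgroup.closure_induction (p := fun x _ => β b * x ∈ altSpan Z i) ?_ ?_ ?_ ?_ hx
  · rintro x hx
    refine AddSubgroup.subset_closure ?_
    cases hx with
    | single hi hx => exact .single hi (h.left _ _ _ hx)
    | mul hi hij hx hy =>
      rw [Set.mem_ofPred_eq, ← mul_assoc]
      exact .mul hi hij (h.left _ _ _ hx) hy
  · rw [mul_zero]
    exact zero_mem _
  · intro x y _ _ hx hy
    rw [mul_add]
    exact add_mem hx hy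
  · intro x _ hx
    rw [mul_neg]
    exact neg_mem hx

theorem mul_base {b : B} {i : ι} {x : R} (hx : IsAlt Set.univ Z i x) :
    IsAlt Set.univ Z i (x * β b) := by
  induction hx with
  | single hi hx => exact .single hi (h.right _ _ _ hx)
  | mul hi hij hx hy ih =>
    rw [mul_assoc]
    exact .mul hi hij hx ih

omit h in
theorem mul_mem_altSpan {i j : ι} (hij : i ≠ j) {x y : R} (hx : x ∈ Z i)
    (hy : y ∈ altSpan Z j) : x * y ∈ altSpan Z i := by
  refine AddSubgroup.closure_induction (p := fun y _ => x * y ∈ altSpan Z i) ?_ ?_ ?_ ?_ hy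
  · intro y hy
    exact AddSubgroup.subset_closure (.mul trivial hij hx hy)
  · rw [mul_zero]
    exact zero_mem _
  · intro y y' _ _ hy hy'
    rw [mul_add]
    exact add_mem hy hy'
  · intro y _ hy
    rw [mul_neg]
    exact neg_mem hy

/-- The elements of the span of the base and of the alternating products form a left module. -/
theorem mul_mem {i : ι} {x v : R} (hx : x ∈ Z i)
    (hv : v ∈ β.toAddMonoidHom.range ⊔ ⨆ i, altSpan Z i) :
    x * v ∈ β.toAddMonoidHom.range ⊔ ⨆ i, altSpan Z i := by
  have hA : ∀ j, altSpan Z j ≤ β.toAddMonoidHom.range ⊔ ⨆ i, altSpan Z i := fun j =>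
    (le_iSup (altSpan Z) j).trans le_sup_right
  have hZ : ∀ j, Z j ≤ altSpan Z j := fun j y hy => AddSubgroup.subset_closure (.single trivial hy)
  let T := (β.toAddMonoidHom.range ⊔ ⨆ i, altSpan Z i).comap (AddMonoidHom.mulLeft x)
  suffices β.toAddMonoidHom.range ⊔ ⨆ i, altSpan Z i ≤ T from this hv
  refine sup_le ?_ (iSup_le fun j => ?_)
  · rintro _ ⟨b, rfl⟩
    exact hA i (hZ i (h.right b i x hx))
  · refine (AddSubgroup.closure_le _).2 fun y hy => ?_
    show x * y ∈ β.toAddMonoidHom.range ⊔ ⨆ i, altSpan Z i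
    by_cases hij : i = j
    · subst hij
      cases hy with
      | single _ hy =>
        obtain ⟨b, hb⟩ := h.mul i x hx y hy
        have := add_mem (hA i (hZ i hb)) (AddSubgroup.mem_sup_left (T := ⨆ i, altSpan Z i)
          (⟨b, rfl⟩ : β b ∈ β.toAddMonoidHom.range))
        rwa [sub_add_cancel] at this
      | @mul _ j y w _ hij hy hw =>
        -- `x y w = (x y - b) w + b w`: the first summand alternates and begins with `i`; in the
        -- second the coefficient `b` is absorbed into `w`, which begins with `j`.
        obtain ⟨b, hb⟩ := h.mul i x hx y hy
        have hw' : w ∈ altSpan Z j := AddSubgroup.subset_closure hw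
        have := add_mem (hA i (mul_mem_altSpan hij hb hw')) (hA j (h.base_mul (b := b) hw'))
        rwa [sub_mul, sub_add_cancel, mul_assoc] at this
    · exact hA i (AddSubgroup.subset_closure (.mul trivial hij hx hy))

theorem base_mem {b : B} {v : R} (hv : v ∈ β.toAddMonoidHom.range ⊔ ⨆ i, altSpan Z i) :
    β b * v ∈ β.toAddMonoidHom.range ⊔ ⨆ i, altSpan Z i := by
  let T := (β.toAddMonoidHom.range ⊔ ⨆ i, altSpan Z i).comap (AddMonoidHom.mulLeft (β b))
  suffices β.toAddMonoidHom.range ⊔ ⨆ i, altSpan Z i ≤ T from this hv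
  refine sup_le ?_ (iSup_le fun j y hy => ?_)
  · rintro _ ⟨b', rfl⟩
    exact AddSubgroup.mem_sup_left ⟨b * b', map_mul β b b'⟩
  · exact AddSubgroup.mem_sup_right (le_iSup (altSpan Z) j (h.base_mul hy))

omit h in
/-- If the ring is generated by the base and the sets `Z i`, then functionals that vanish on
alternating products are determined by their values on the base. -/
theorem eq_of_vanish {G : Type*} [AddCommGroup G] {L L' : R →+ G}
    (hR : ∀ x : R, x ∈ β.toAddMonoidHom.range ⊔ ⨆ i, altSpan Z i)
    (hL : ∀ i x, IsAlt Set.univ Z i x → L x = 0) (hL' : ∀ i x, IsAlt Set.univ Z i x → L' x = 0)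
    (hB : ∀ b, L (β b) = L' (β b)) (x : R) : L x = L' x := by
  suffices β.toAddMonoidHom.range ⊔ ⨆ i, altSpan Z i ≤ (L - L').ker from
    sub_eq_zero.1 (this (hR x))
  refine sup_le ?_ (iSup_le fun j => ?_)
  · rintro _ ⟨b, rfl⟩
    exact sub_eq_zero.2 (hB b)
  · refine (AddSubgroup.closure_le _).2 fun y hy => ?_
    exact sub_eq_zero.2 ((hL _ _ hy).trans (hL' _ _ hy).symm)

end IsCentred

end Alternating

/-! ### Centred elements -/

section Centred

variable {B : Type u} [Ring B] [StarRing B] [Algebra ℂ B]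

set_option linter.unusedSectionVars false

variable {A A₁ A₂ A₃ : BAlg B} {R : Type*} [Ring R]

/-- The images of the centred elements. -/
def centred (φ : Expectation A) (g : Uni A →+* R) : AddSubgroup R :=
  φ.extHom.ker.map g.toAddMonoidHom

theorem mem_centred (φ : Expectation A) (g : Uni A →+* R) {x : Uni A} (hx : φ.ext x = 0) :
    g x ∈ centred φ g := ⟨x, hx, rfl⟩

theorem exists_of_mem_centred {φ : Expectation A} {g : Uni A →+* R} {y : R}
    (hy : y ∈ centred φ g) : ∃ x, φ.ext x = 0 ∧ g x = y := hy

theorem isCentred_of_eq {ι : Type*} {Z : ι → AddSubgroup R} {β : B →+* R}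
    (h : ∀ i, ∃ (A : BAlg B) (φ : Expectation A) (g : Uni A →+* R),
      (∀ b, g (ofB b) = β b) ∧ Z i = centred φ g) : IsCentred β Z := by
  constructor
  · intro b i y hy
    obtain ⟨A, φ, g, hg, e⟩ := h i
    rw [e] at hy ⊢
    obtain ⟨x, hx, rfl⟩ := exists_of_mem_centred hy
    rw [← hg, ← map_mul]
    exact mem_centred φ g (by rw [φ.ext_ofB_mul, hx, mul_zero])
  · intro b i y hy
    obtain ⟨A, φ, g, hg, e⟩ := h i
    rw [e] at hy ⊢
    obtain ⟨x, hx, rfl⟩ := exists_of_mem_centred hy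
    rw [← hg, ← map_mul]
    exact mem_centred φ g (by rw [φ.ext_mul_ofB, hx, zero_mul])
  · intro i y hy z hz
    obtain ⟨A, φ, g, hg, e⟩ := h i
    rw [e] at hy hz ⊢
    obtain ⟨x, hx, rfl⟩ := exists_of_mem_centred hy
    obtain ⟨w, hw, rfl⟩ := exists_of_mem_centred hz
    refine ⟨φ.ext (x * w), ?_⟩
    rw [← hg, ← map_mul, ← map_sub]
    exact mem_centred φ g (by rw [φ.ext_sub, φ.ext_ofB, sub_self])

/-- Left multiplication by the image of `B ⊕ A` preserves the span of alternating products. -/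
theorem IsCentred.ring_mul_mem {ι : Type*} {Z : ι → AddSubgroup R} {β : B →+* R}
    (h : IsCentred β Z) (i : ι) (φ : Expectation A) (g : Uni A →+* R) (hg : ∀ b, g (ofB b) = β b)
    (hZ : Z i = centred φ g) (x : Uni A) {v : R}
    (hv : v ∈ β.toAddMonoidHom.range ⊔ ⨆ i, altSpan Z i) :
    g x * v ∈ β.toAddMonoidHom.range ⊔ ⨆ i, altSpan Z i := by
  have e : g x * v = g (x - ofB (φ.ext x)) * v + β (φ.ext x) * v := by
    rw [map_sub, hg]
    noncomm_ring
  rw [e]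
  refine add_mem (h.mul_mem (i := i) ?_ hv) (h.base_mem hv)
  rw [hZ]
  exact mem_centred φ g (by rw [φ.ext_sub, φ.ext_ofB, sub_self])

variable (φ₁ : Expectation A₁) (φ₂ : Expectation A₂) (φ₃ : Expectation A₃)

/-- The centred elements of the two factors of a coproduct; `true` stands for the first one. -/
def centredPair (s : Bool) : AddSubgroup (Uni (coprod A₁ A₂)) :=
  bif s then centred φ₁ (mapHom (inl A₁ A₂)) else centred φ₂ (mapHom (inr A₁ A₂))

theorem centredPair_isCentred : IsCentred (ofBHom (coprod A₁ A₂)) (centredPair φ₁ φ₂) := by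
  refine isCentred_of_eq fun s => ?_
  cases s
  · exact ⟨A₂, φ₂, mapHom (inr A₁ A₂), map_ofB _, rfl⟩
  · exact ⟨A₁, φ₁, mapHom (inl A₁ A₂), map_ofB _, rfl⟩

/-- The span contains `1` and is stable under left multiplication by the base and by both algebras,
which generate the ring. -/
theorem centredPair_span (x : Uni (coprod A₁ A₂)) :
    x ∈ (ofBHom (coprod A₁ A₂)).toAddMonoidHom.range ⊔ ⨆ s, altSpan (centredPair φ₁ φ₂) s := by
  have h := centredPair_isCentred φ₁ φ₂
  have key : ∀ v ∈ (ofBHom (coprod A₁ A₂)).toAddMonoidHom.range ⊔ ⨆ s, altSpan (centredPair φ₁ φ₂) s,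
      x * v ∈ (ofBHom (coprod A₁ A₂)).toAddMonoidHom.range ⊔ ⨆ s, altSpan (centredPair φ₁ φ₂) s := by
    refine word_induction (p := fun x => ∀ v ∈ (ofBHom (coprod A₁ A₂)).toAddMonoidHom.range ⊔
      ⨆ s, altSpan (centredPair φ₁ φ₂) s, x * v ∈ (ofBHom (coprod A₁ A₂)).toAddMonoidHom.range ⊔
      ⨆ s, altSpan (centredPair φ₁ φ₂) s) (fun b v hv => ?_) (fun a v hv => ?_) (fun a v hv => ?_)
      (fun x y hx hy v hv => ?_) (fun x y hx hy v hv => ?_) x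
    · exact h.base_mem hv
    · exact h.ring_mul_mem true φ₁ (mapHom (inl A₁ A₂)) (map_ofB _) rfl (ofA a) hv
    · exact h.ring_mul_mem false φ₂ (mapHom (inr A₁ A₂)) (map_ofB _) rfl (ofA a) hv
    · rw [add_mul]
      exact add_mem (hx v hv) (hy v hv)
    · rw [mul_assoc]
      exact hx _ (hy v hv)
  have := key 1 (AddSubgroup.mem_sup_left ⟨1, map_one (ofBHom _)⟩)
  rwa [mul_one] at this

end Centred

end CondProb

/-! ### The free product functional, its values on words, and orthogonality. -/

namespace CondProb

open scoped RightActions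

open Uni

/-! ### The free product -/

section InvolRep

variable {F : Type u} [AddCommGroup F] {R : Type*} [Ring R]

/-- Matrices of operators, acting on functions on the integers along the orbits of an
involution without fixed points; `s` distinguishes the two elements of an orbit. -/
def involRep (σ : ℤ → ℤ) (s : ℤ → Fin 2) (hσ : ∀ k, σ (σ k) = k) (hs : ∀ k, s (σ k) ≠ s k)
    (θ : R →+* Matrix (Fin 2) (Fin 2) (Module.End ℤ F)) : R →+* Module.End ℤ (ULift.{u} ℤ → F) :=
  have sum_two : ∀ (a b : Fin 2) (f : Fin 2 → Module.End ℤ F), b ≠ a → ∑ i, f i = f a + f b := by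
    intro a b f hab
    fin_cases a <;> fin_cases b <;> simp_all [Fin.sum_univ_two, add_comm]
  { toFun := fun x => addEnd (fun f k => θ x (s k.down) (s k.down) (f k) +
      θ x (s k.down) (s (σ k.down)) (f ⟨σ k.down⟩)) fun f g => funext fun k => by
        simp only [Pi.add_apply, map_add]
        abel
    map_one' := LinearMap.ext fun f => funext fun k => by
      simp [Matrix.one_apply_ne (hs k.down).symm]
    map_mul' := fun x y => LinearMap.ext fun f => funext fun k => by
      simp only [addEnd_apply, map_mul, Matrix.mul_apply, Module.End.mul_apply, map_add, hσ,
        sum_two _ _ _ (hs k.down), LinearMap.add_apply]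
      abel
    map_zero' := LinearMap.ext fun f => funext fun k => by simp
    map_add' := fun x y => LinearMap.ext fun f => funext fun k => by
      simp only [addEnd_apply, map_add, Matrix.add_apply, LinearMap.add_apply, Pi.add_apply]
      abel }

theorem involRep_apply (σ : ℤ → ℤ) (s : ℤ → Fin 2) (hσ : ∀ k, σ (σ k) = k)
    (hs : ∀ k, s (σ k) ≠ s k) (θ : R →+* Matrix (Fin 2) (Fin 2) (Module.End ℤ F)) (x : R)
    (f : ULift.{u} ℤ → F) (k : ULift.{u} ℤ) : involRep σ s hσ hs θ x f k =
      θ x (s k.down) (s k.down) (f k) + θ x (s k.down) (s (σ k.down)) (f ⟨σ k.down⟩) := rfl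

end InvolRep

section Free

variable {B : Type u} [Ring B] [StarRing B] [Algebra ℂ B]

set_option linter.unusedSectionVars false

variable {A A₁ A₂ A₃ : BAlg B} (φ : Expectation A) (φ₁ : Expectation A₁) (φ₂ : Expectation A₂)
  (φ₃ : Expectation A₃)

/-- The `(0, 0)`-entry is the expectation, so a centred element cannot leave a vector in its
component of index `0`. -/
theorem Summand.matRep_centred {X : Type u} [AddCommGroup X] [Module B X] [Module Bᵐᵒᵖ X]
    [SMulCommClass B Bᵐᵒᵖ X] (r : Summand A X) {x : Uni A} (hx : φ.ext x = 0) :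
    r.matRep φ x 0 0 = 0 := by
  rw [eq_add x, map_add, Matrix.add_apply, r.matRep_ofA, r.matRep_ofB, if_pos rfl, ← map_add]
  exact (congrArg _ hx).trans (map_zero _)

/-- The action of `B ⊕ A₁` for the free product. -/
noncomputable def freeLeft : Uni A₁ →+* Module.End ℤ (ULift.{u} ℤ → Fock B (A₁ × A₂)) :=
  -- `k ↦ 1 - k` exchanges the half-lines `k ≤ 0` and `k > 0`; the reflection `k ↦ -1 - k` for `A₂`
  -- exchanges `k ≥ 0` and `k < 0`. The half-lines carrying the matrix index `0` meet only at the
  -- position `0` of the vacuum.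
  involRep (fun k => 1 - k) (fun k => if k ≤ 0 then 0 else 1) (fun k => by ring)
    (fun k => by split_ifs <;> omega) (Summand.matRep (summandLeft A₁ A₂) φ₁)

/-- The action of `B ⊕ A₂` for the free product. -/
noncomputable def freeRight : Uni A₂ →+* Module.End ℤ (ULift.{u} ℤ → Fock B (A₁ × A₂)) :=
  involRep (fun k => -1 - k) (fun k => if 0 ≤ k then 0 else 1) (fun k => by ring)
    (fun k => by split_ifs <;> omega) (Summand.matRep (summandRight A₁ A₂) φ₂)

theorem freeLeft_ofB (b : B) (f : ULift.{u} ℤ → Fock B (A₁ × A₂)) (k : ULift.{u} ℤ) :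
    freeLeft φ₁ (ofB b) f k = Fock.base B _ b (f k) := by
  rw [freeLeft, involRep_apply, Summand.matRep_ofB, Summand.matRep_ofB, if_pos rfl, if_neg, 
    LinearMap.zero_apply, add_zero]
  split_ifs <;> omega

theorem freeRight_ofB (b : B) (f : ULift.{u} ℤ → Fock B (A₁ × A₂)) (k : ULift.{u} ℤ) :
    freeRight φ₂ (ofB b) f k = Fock.base B _ b (f k) := by
  rw [freeRight, involRep_apply, Summand.matRep_ofB, Summand.matRep_ofB, if_pos rfl, if_neg, 
    LinearMap.zero_apply, add_zero]
  split_ifs <;> omega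

variable [StarModule ℂ B]

theorem exists_freeRep :
    ∃ F : Uni (coprod A₁ A₂) →+* Module.End ℤ (ULift.{u} ℤ → Fock B (A₁ × A₂)),
      (∀ x, F (map (inl A₁ A₂) x) = freeLeft φ₁ x) ∧
        ∀ x, F (map (inr A₁ A₂) x) = freeRight φ₂ x :=
  exists_ringLift (freeLeft φ₁) (freeRight φ₂) fun b => LinearMap.ext fun f => funext fun k => by
    rw [freeLeft_ofB, freeRight_ofB]

/-- The free representation of the coproduct. -/
noncomputable def freeRep :
    Uni (coprod A₁ A₂) →+* Module.End ℤ (ULift.{u} ℤ → Fock B (A₁ × A₂)) :=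
  (exists_freeRep φ₁ φ₂).choose

theorem freeRep_inl (x : Uni A₁) : freeRep φ₁ φ₂ (map (inl A₁ A₂) x) = freeLeft φ₁ x :=
  (exists_freeRep φ₁ φ₂).choose_spec.1 x

theorem freeRep_inr (x : Uni A₂) : freeRep φ₁ φ₂ (map (inr A₁ A₂) x) = freeRight φ₂ x :=
  (exists_freeRep φ₁ φ₂).choose_spec.2 x

theorem freeRep_ofB (b : B) (f : ULift.{u} ℤ → Fock B (A₁ × A₂)) (k : ULift.{u} ℤ) :
    freeRep φ₁ φ₂ (ofB b) f k = Fock.base B _ b (f k) := by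
  rw [← map_ofB (inl A₁ A₂), freeRep_inl, freeLeft_ofB]

/-- The vacuum vector. -/
def freeVac (B : Type u) [Ring B] (X : Type u) [AddCommGroup X] [Module B X] [Module Bᵐᵒᵖ X] :
    ULift.{u} ℤ → Fock B X := fun k => if k.down = 0 then Fock.vac B X else 0

/-- The free product functional. -/
noncomputable def freeFun : Uni (coprod A₁ A₂) →+ B :=
  AddMonoidHom.mk' (fun z => (freeRep φ₁ φ₂ z (freeVac B _) ⟨0⟩).1 []) fun x y => by
    rw [_root_.map_add]
    rfl

theorem freeFun_apply (z : Uni (coprod A₁ A₂)) :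
    freeFun φ₁ φ₂ z = (freeRep φ₁ φ₂ z (freeVac B _) ⟨0⟩).1 [] := rfl

theorem freeFun_ofB (b : B) : freeFun φ₁ φ₂ (ofB b) = b := by
  rw [freeFun_apply, freeRep_ofB, freeVac, if_pos rfl]
  exact Fock.act_vac_nil b

theorem freeFun_ofB_mul (b : B) (z : Uni (coprod A₁ A₂)) :
    freeFun φ₁ φ₂ (ofB b * z) = b * freeFun φ₁ φ₂ z := by
  rw [freeFun_apply, map_mul, Module.End.mul_apply, freeRep_ofB]
  rfl

/-- A centred element of `A₁` moves vectors supported on `k ≤ 0` to `k > 0`, and one of `A₂` moves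
those supported on `k ≥ 0` to `k < 0`. The vacuum at `0` qualifies for both, and an alternating
product never brings it back to `0`. -/
theorem freeRep_alt {s : Bool} {z : Uni (coprod A₁ A₂)}
    (h : IsAlt Set.univ (centredPair φ₁ φ₂) s z) (k : ULift.{u} ℤ)
    (hk : if s then k.down ≤ 0 else 0 ≤ k.down) : freeRep φ₁ φ₂ z (freeVac B _) k = 0 := by
  have hl : ∀ x : Uni A₁, φ₁.ext x = 0 → ∀ f : ULift.{u} ℤ → Fock B (A₁ × A₂),
      (∀ k : ULift.{u} ℤ, 0 < k.down → f k = 0) → ∀ k : ULift.{u} ℤ, k.down ≤ 0 →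
      freeRep φ₁ φ₂ (map (inl A₁ A₂) x) f k = 0 := by
    intro x hx f hf k hk
    rw [freeRep_inl, freeLeft, involRep_apply, if_pos hk, Summand.matRep_centred φ₁ _ hx,
      hf ⟨1 - k.down⟩ (by simp only; omega), LinearMap.zero_apply, _root_.map_zero, add_zero]
  have hr : ∀ x : Uni A₂, φ₂.ext x = 0 → ∀ f : ULift.{u} ℤ → Fock B (A₁ × A₂),
      (∀ k : ULift.{u} ℤ, k.down < 0 → f k = 0) → ∀ k : ULift.{u} ℤ, 0 ≤ k.down →
      freeRep φ₁ φ₂ (map (inr A₁ A₂) x) f k = 0 := by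
    intro x hx f hf k hk
    rw [freeRep_inr, freeRight, involRep_apply, if_pos hk, Summand.matRep_centred φ₂ _ hx,
      hf ⟨-1 - k.down⟩ (by simp only; omega), LinearMap.zero_apply, _root_.map_zero, add_zero]
  induction h generalizing k with
  | @single s x _ hx =>
    cases s with
    | true =>
      obtain ⟨x, hx', rfl⟩ := exists_of_mem_centred (φ := φ₁) (g := mapHom (inl A₁ A₂)) hx
      exact hl x hx' _ (fun k hk => if_neg hk.ne') k hk
    | false =>
      obtain ⟨x, hx', rfl⟩ := exists_of_mem_centred (φ := φ₂) (g := mapHom (inr A₁ A₂)) hx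
      exact hr x hx' _ (fun k hk => if_neg hk.ne) k (by simpa using hk)
  | @mul s t x y _ hst hx _ ih =>
    rw [map_mul, Module.End.mul_apply]
    cases s with
    | true =>
      obtain ⟨x, hx', rfl⟩ := exists_of_mem_centred (φ := φ₁) (g := mapHom (inl A₁ A₂)) hx
      obtain rfl : t = false := by simpa using hst
      exact hl x hx' _ (fun k hk => ih k (by simpa using hk.le)) k hk
    | false =>
      obtain ⟨x, hx', rfl⟩ := exists_of_mem_centred (φ := φ₂) (g := mapHom (inr A₁ A₂)) hx
      obtain rfl : t = true := by simpa using hst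
      exact hr x hx' _ (fun k hk => ih k hk.le) k (by simpa using hk)

theorem freeFun_alt {s : Bool} {z : Uni (coprod A₁ A₂)}
    (h : IsAlt Set.univ (centredPair φ₁ φ₂) s z) : freeFun φ₁ φ₂ z = 0 := by
  rw [freeFun_apply, freeRep_alt φ₁ φ₂ h ⟨0⟩ (by simp)]
  rfl

/-- A functional that vanishes on alternating products is determined by its values on `B`. -/
theorem eq_of_vanish_centredPair {G : Type*} [AddCommGroup G] {L L' : Uni (coprod A₁ A₂) →+ G}
    (hL : ∀ s z, IsAlt Set.univ (centredPair φ₁ φ₂) s z → L z = 0)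
    (hL' : ∀ s z, IsAlt Set.univ (centredPair φ₁ φ₂) s z → L' z = 0)
    (hB : ∀ b, L (ofB b) = L' (ofB b)) (z : Uni (coprod A₁ A₂)) : L z = L' z :=
  IsCentred.eq_of_vanish (centredPair_span φ₁ φ₂) hL hL' hB z

theorem freeFun_mul_ofB (z : Uni (coprod A₁ A₂)) (b : B) :
    freeFun φ₁ φ₂ (z * ofB b) = freeFun φ₁ φ₂ z * b := by
  refine eq_of_vanish_centredPair φ₁ φ₂
    (L := (freeFun φ₁ φ₂).comp (AddMonoidHom.mulRight (ofB b)))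
    (L' := (AddMonoidHom.mulRight b).comp (freeFun φ₁ φ₂)) (fun s z h => ?_) (fun s z h => ?_)
    (fun b' => ?_) z
  · exact freeFun_alt φ₁ φ₂ ((centredPair_isCentred φ₁ φ₂).mul_base h)
  · show freeFun φ₁ φ₂ z * b = 0
    rw [freeFun_alt φ₁ φ₂ h, zero_mul]
  · show freeFun φ₁ φ₂ (ofB b' * ofB b) = freeFun φ₁ φ₂ (ofB b') * b
    rw [← ofB_mul, freeFun_ofB, freeFun_ofB]

theorem freeFun_inl (x : Uni A₁) : freeFun φ₁ φ₂ (map (inl A₁ A₂) x) = φ₁.ext x := by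
  have : map (inl A₁ A₂) x = map (inl A₁ A₂) (x - ofB (φ₁.ext x)) + ofB (φ₁.ext x) := by
    rw [Uni.map_sub, map_ofB, sub_add_cancel]
  rw [this, _root_.map_add, freeFun_ofB, freeFun_alt φ₁ φ₂ (s := true), zero_add]
  exact .single trivial (mem_centred φ₁ (mapHom _) (by rw [φ₁.ext_sub, φ₁.ext_ofB, sub_self]))

theorem freeFun_inr (x : Uni A₂) : freeFun φ₁ φ₂ (map (inr A₁ A₂) x) = φ₂.ext x := by
  have : map (inr A₁ A₂) x = map (inr A₁ A₂) (x - ofB (φ₂.ext x)) + ofB (φ₂.ext x) := by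
    rw [Uni.map_sub, map_ofB, sub_add_cancel]
  rw [this, _root_.map_add, freeFun_ofB, freeFun_alt φ₁ φ₂ (s := false), zero_add]
  exact .single trivial (mem_centred φ₂ (mapHom _) (by rw [φ₂.ext_sub, φ₂.ext_ofB, sub_self]))

/-! ### Positivity of the free product -/

theorem star_mem_centredPair {s : Bool} {x : Uni (coprod A₁ A₂)} (hx : x ∈ centredPair φ₁ φ₂ s) :
    star x ∈ centredPair φ₁ φ₂ s := by
  cases s with
  | true =>
    obtain ⟨x, hx', rfl⟩ := exists_of_mem_centred (φ := φ₁) (g := mapHom (inl A₁ A₂)) hx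
    rw [mapHom_apply, ← Uni.map_star]
    exact mem_centred φ₁ (mapHom (inl A₁ A₂)) (by rw [φ₁.ext_star, hx', star_zero])
  | false =>
    obtain ⟨x, hx', rfl⟩ := exists_of_mem_centred (φ := φ₂) (g := mapHom (inr A₁ A₂)) hx
    rw [mapHom_apply, ← Uni.map_star]
    exact mem_centred φ₂ (mapHom (inr A₁ A₂)) (by rw [φ₂.ext_star, hx', star_zero])

/-- The span of `B` and the alternating products that begin with a factor of the given kind. -/
def unitalSpan (s : Bool) : AddSubgroup (Uni (coprod A₁ A₂)) :=
  (ofBHom (coprod A₁ A₂)).toAddMonoidHom.range ⊔ altSpan (centredPair φ₁ φ₂) s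

theorem ofB_mem_unitalSpan (s : Bool) (b : B) : ofB b ∈ unitalSpan φ₁ φ₂ s :=
  AddSubgroup.mem_sup_left ⟨b, rfl⟩

theorem alt_mem_unitalSpan {s : Bool} {z : Uni (coprod A₁ A₂)}
    (h : IsAlt Set.univ (centredPair φ₁ φ₂) s z) : z ∈ unitalSpan φ₁ φ₂ s :=
  AddSubgroup.mem_sup_right (AddSubgroup.subset_closure h)

theorem unitalSpan_induction {s : Bool} {p : Uni (coprod A₁ A₂) → Prop}
    (hB : ∀ b, p (ofB b)) (hA : ∀ z, IsAlt Set.univ (centredPair φ₁ φ₂) s z → p z)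
    (hadd : ∀ x y, p x → p y → p (x + y)) (hneg : ∀ x, p x → p (-x))
    {z : Uni (coprod A₁ A₂)} (hz : z ∈ unitalSpan φ₁ φ₂ s) : p z := by
  let T : AddSubgroup (Uni (coprod A₁ A₂)) := ⟨⟨⟨{z | p z}, fun {x y} => hadd x y⟩, hB 0⟩,
    fun {x} => hneg x⟩
  suffices unitalSpan φ₁ φ₂ s ≤ T from this hz
  refine sup_le ?_ ((AddSubgroup.closure_le _).2 hA)
  rintro _ ⟨b, rfl⟩
  exact hB b

theorem centred_mul_unitalSpan {s t : Bool} (hst : s ≠ t) {x v : Uni (coprod A₁ A₂)}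
    (hx : x ∈ centredPair φ₁ φ₂ s) (hv : v ∈ unitalSpan φ₁ φ₂ t) :
    x * v ∈ altSpan (centredPair φ₁ φ₂) s := by
  refine unitalSpan_induction φ₁ φ₂ (p := fun v => x * v ∈ altSpan (centredPair φ₁ φ₂) s)
    (fun b => ?_) (fun z hz => ?_) (fun v w hv hw => ?_)
    (fun v hv => ?_) hv
  · exact AddSubgroup.subset_closure (.single trivial ((centredPair_isCentred φ₁ φ₂).right _ _ _ hx))
  · exact AddSubgroup.subset_closure (.mul trivial hst hx hz)
  · rw [mul_add]
    exact add_mem hv hw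
  · rw [mul_neg]
    exact neg_mem hv

theorem freeFun_altSpan {s : Bool} {z : Uni (coprod A₁ A₂)}
    (h : z ∈ altSpan (centredPair φ₁ φ₂) s) : freeFun φ₁ φ₂ z = 0 := by
  suffices altSpan (centredPair φ₁ φ₂) s ≤ (freeFun φ₁ φ₂).ker from this h
  exact (AddSubgroup.closure_le _).2 fun z hz => freeFun_alt φ₁ φ₂ hz

/-- Orthogonality of different beginnings: `star v` ends with a factor of kind `t`, while `w` begins
with one of kind `s`, so the product is again a combination of alternating products; a summand of
`v` from `B` only changes the coefficient of `w`. -/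
theorem freeFun_star_mul {s t : Bool} (hst : s ≠ t) {v w : Uni (coprod A₁ A₂)}
    (hv : v ∈ unitalSpan φ₁ φ₂ t) (hw : w ∈ altSpan (centredPair φ₁ φ₂) s) :
    freeFun φ₁ φ₂ (star v * w) = 0 := by
  have key : ∀ {t : Bool} {v : Uni (coprod A₁ A₂)}, IsAlt Set.univ (centredPair φ₁ φ₂) t v →
      ∀ {s : Bool} {w : Uni (coprod A₁ A₂)}, s ≠ t → w ∈ altSpan (centredPair φ₁ φ₂) s →
      freeFun φ₁ φ₂ (star v * w) = 0 := by
    intro t v hv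
    induction hv with
    | single _ hx =>
      intro s w hst hw
      exact freeFun_altSpan φ₁ φ₂ (IsCentred.mul_mem_altSpan hst.symm
        (star_mem_centredPair φ₁ φ₂ hx) hw)
    | mul _ hij hx _ ih =>
      intro s w hst hw
      rw [star_mul, mul_assoc]
      exact ih hij (IsCentred.mul_mem_altSpan hst.symm (star_mem_centredPair φ₁ φ₂ hx) hw)
  refine unitalSpan_induction φ₁ φ₂ (p := fun v => freeFun φ₁ φ₂ (star v * w) = 0)
    (fun b => ?_) (fun z hz => key hz hst hw)
    (fun v v' hv hv' => ?_) (fun v hv => ?_) hv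
  · rw [star_ofB]
    exact freeFun_altSpan φ₁ φ₂ ((centredPair_isCentred φ₁ φ₂).base_mul hw)
  · rw [star_add, add_mul, _root_.map_add, hv, hv', add_zero]
  · rw [star_neg, neg_mul, _root_.map_neg, hv, neg_zero]

/-- Positivity passes from a family of vectors `v` to sums of vectors `g x * v` if `v* g x v'`
depends on the expectation of `x` only. -/
theorem isGram_of_reduction {R : Type*} [Ring R] [StarRing R] (L : R →+ B) (g : Uni A →+* R)
    (hg : ∀ x, g (star x) = star (g x)) (V : AddSubgroup R)
    (hV : ∀ b, ∀ v ∈ V, g (ofB b) * v ∈ V)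
    (h0 : ∀ x, φ.ext x = 0 → ∀ v ∈ V, ∀ w ∈ V, L (star v * (g x * w)) = 0)
    (ih : ∀ (n : ℕ) (v : Fin n → R), (∀ i, v i ∈ V) → IsGram fun i j => L (star (v i) * v j))
    {n : ℕ} (N : Fin n → ℕ) (x : ∀ i, Fin (N i) → Uni A) (v : ∀ i, Fin (N i) → R)
    (hv : ∀ i k, v i k ∈ V) : IsGram fun i j =>
      L (star (∑ k, g (x i k) * v i k) * ∑ k, g (x j k) * v j k) := by
  obtain ⟨m, c, hc⟩ := φ.isGram fun p : Σ i, Fin (N i) => x p.1 p.2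
  have h := IsGram.sum fun l : Fin m => ih n (fun i => ∑ k, g (ofB (c l ⟨i, k⟩)) * v i k)
    fun i => sum_mem fun k _ => hV _ _ (hv i k)
  convert h using 3 with i j
  have hc' : ∀ k l, φ.ext (star (x i k) * x j l) = _ := fun k l => hc ⟨i, k⟩ ⟨j, l⟩
  have e : ∀ k l, L (star (g (x i k) * v i k) * (g (x j l) * v j l)) =
      ∑ p, L (star (g (ofB (c p ⟨i, k⟩)) * v i k) * (g (ofB (c p ⟨j, l⟩)) * v j l)) :=
    fun k l => by
      -- The centred part of `x* x'` contributes nothing, so `x* x'` may be replaced by its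
      -- expectation, which is a sum of `c* c`.
      have e₁ := h0 (star (x i k) * x j l - ofB (φ.ext (star (x i k) * x j l)))
        (by rw [φ.ext_sub, φ.ext_ofB, sub_self]) _ (hv i k) _ (hv j l)
      rw [map_sub, sub_mul, mul_sub, map_sub, sub_eq_zero] at e₁
      rw [star_mul, mul_assoc, ← mul_assoc (star _) (g _), ← hg, ← map_mul g, e₁, hc', ← ofBHom_apply,
        map_sum, map_sum, Finset.sum_mul, Finset.mul_sum, map_sum]
      refine Finset.sum_congr rfl fun p _ => ?_
      rw [ofBHom_apply, ofB_mul, star_mul, ← hg, star_ofB, map_mul g]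
      congr 1
      noncomm_ring
  -- Finite sums are interchanged so that the index of `c` becomes the outermost one.
  simp only [star_sum, Finset.sum_mul_sum, map_sum, e]
  rw [Finset.sum_comm]
  refine (Finset.sum_congr rfl fun k _ => Finset.sum_comm).trans ?_
  rw [Finset.sum_comm]
  refine Finset.sum_congr rfl fun k _ => ?_
  rw [Finset.sum_comm]

end Free

end CondProb

/-! ### Positivity, naturality, associativity and unitality of the free product. -/

namespace CondProb

open scoped RightActions

open Uni

section Free

variable {B : Type u} [Ring B] [StarRing B] [Algebra ℂ B]

set_option linter.unusedSectionVars false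

variable {A A₁ A₂ A₃ : BAlg B} (φ : Expectation A) (φ₁ : Expectation A₁) (φ₂ : Expectation A₂)
  (φ₃ : Expectation A₃)

variable [StarModule ℂ B]

/-- The span of `B` and the alternating products of length at most `n` that begin with a factor
of the given kind. -/
def wordSpan : ℕ → Bool → AddSubgroup (Uni (coprod A₁ A₂))
  | 0, _ => (ofBHom (coprod A₁ A₂)).toAddMonoidHom.range
  | n + 1, s => (ofBHom (coprod A₁ A₂)).toAddMonoidHom.range ⊔ AddSubgroup.closure
      {z | ∃ x ∈ centredPair φ₁ φ₂ s, ∃ v ∈ wordSpan n (!s), z = x * v}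

theorem ofB_mem_wordSpan (n : ℕ) (s : Bool) (b : B) : ofB b ∈ wordSpan φ₁ φ₂ n s := by
  cases n with
  | zero => exact ⟨b, rfl⟩
  | succ n => exact AddSubgroup.mem_sup_left ⟨b, rfl⟩

theorem mul_mem_wordSpan {n : ℕ} {s : Bool} {x v : Uni (coprod A₁ A₂)}
    (hx : x ∈ centredPair φ₁ φ₂ s) (hv : v ∈ wordSpan φ₁ φ₂ n (!s)) :
    x * v ∈ wordSpan φ₁ φ₂ (n + 1) s :=
  AddSubgroup.mem_sup_right (AddSubgroup.subset_closure ⟨x, hx, v, hv, rfl⟩)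

theorem wordSpan_succ_le {n : ℕ} {s : Bool} {T : AddSubgroup (Uni (coprod A₁ A₂))}
    (hB : ∀ b, ofB b ∈ T)
    (hT : ∀ x ∈ centredPair φ₁ φ₂ s, ∀ v ∈ wordSpan φ₁ φ₂ n (!s), x * v ∈ T) :
    wordSpan φ₁ φ₂ (n + 1) s ≤ T := by
  refine sup_le ?_ ((AddSubgroup.closure_le _).2 ?_)
  · rintro _ ⟨b, rfl⟩
    exact hB b
  · rintro _ ⟨x, hx, v, hv, rfl⟩
    exact hT x hx v hv

theorem wordSpan_le_succ (n : ℕ) : ∀ s, wordSpan φ₁ φ₂ n s ≤ wordSpan φ₁ φ₂ (n + 1) s := by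
  induction n with
  | zero => exact fun s => le_sup_left
  | succ n ih =>
    exact fun s => wordSpan_succ_le φ₁ φ₂ (ofB_mem_wordSpan φ₁ φ₂ _ s) fun x hx v hv =>
      mul_mem_wordSpan φ₁ φ₂ hx (ih _ hv)

theorem wordSpan_mono (s : Bool) : Monotone fun n => wordSpan φ₁ φ₂ n s :=
  monotone_nat_of_le_succ fun n => wordSpan_le_succ φ₁ φ₂ n s

theorem base_mul_wordSpan (n : ℕ) (s : Bool) (b : B) {v : Uni (coprod A₁ A₂)}
    (hv : v ∈ wordSpan φ₁ φ₂ n s) : ofB b * v ∈ wordSpan φ₁ φ₂ n s := by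
  cases n with
  | zero =>
    obtain ⟨b', rfl⟩ := hv
    exact ⟨b * b', ofB_mul b b'⟩
  | succ n =>
    suffices wordSpan φ₁ φ₂ (n + 1) s ≤ (wordSpan φ₁ φ₂ (n + 1) s).comap
      (AddMonoidHom.mulLeft (ofB b)) from this hv
    refine wordSpan_succ_le φ₁ φ₂ (fun b' => ?_) fun x hx v hv => ?_
    · show ofB b * ofB b' ∈ wordSpan φ₁ φ₂ (n + 1) s
      rw [← ofB_mul]
      exact ofB_mem_wordSpan φ₁ φ₂ _ _ _
    · show ofB b * (x * v) ∈ wordSpan φ₁ φ₂ (n + 1) s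
      rw [← mul_assoc]
      exact mul_mem_wordSpan φ₁ φ₂ ((centredPair_isCentred φ₁ φ₂).left b s x hx) hv

theorem wordSpan_le_unitalSpan (n : ℕ) : ∀ s, wordSpan φ₁ φ₂ n s ≤ unitalSpan φ₁ φ₂ s := by
  induction n with
  | zero => exact fun s => le_sup_left
  | succ n ih =>
    exact fun s => wordSpan_succ_le φ₁ φ₂ (ofB_mem_unitalSpan φ₁ φ₂ s) fun x hx v hv =>
      AddSubgroup.mem_sup_right (centred_mul_unitalSpan φ₁ φ₂ (by cases s <;> simp) hx (ih _ hv))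

theorem exists_mem_wordSpan {s : Bool} {z : Uni (coprod A₁ A₂)}
    (h : IsAlt Set.univ (centredPair φ₁ φ₂) s z) : ∃ n, z ∈ wordSpan φ₁ φ₂ n s := by
  induction h with
  | single _ hx =>
    have := mul_mem_wordSpan φ₁ φ₂ hx (ofB_mem_wordSpan φ₁ φ₂ 0 _ 1)
    rw [ofB_one, mul_one] at this
    exact ⟨1, this⟩
  | @mul s t x y _ hst hx _ ih =>
    obtain ⟨n, hn⟩ := ih
    obtain rfl : t = !s := by cases s <;> cases t <;> simp_all
    exact ⟨n + 1, mul_mem_wordSpan φ₁ φ₂ hx hn⟩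

/-- The sums of products of elements of `B ⊕ A` and elements of `V`. -/
theorem exists_sum_of_mem_wordSpan {s : Bool} {n : ℕ} (g : Uni A →+* Uni (coprod A₁ A₂))
    (hg : ∀ b, g (ofB b) = ofB b) (hZ : centredPair φ₁ φ₂ s = centred φ g)
    {z : Uni (coprod A₁ A₂)} (hz : z ∈ wordSpan φ₁ φ₂ (n + 1) s ⊔ wordSpan φ₁ φ₂ n (!s)) :
    ∃ (N : ℕ) (x : Fin N → Uni A) (v : Fin N → Uni (coprod A₁ A₂)),
      (∀ k, v k ∈ wordSpan φ₁ φ₂ n (!s)) ∧ z = ∑ k, g (x k) * v k := by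
  let T : AddSubgroup (Uni (coprod A₁ A₂)) :=
    { carrier := {z | ∃ (N : ℕ) (x : Fin N → Uni A) (v : Fin N → Uni (coprod A₁ A₂)),
        (∀ k, v k ∈ wordSpan φ₁ φ₂ n (!s)) ∧ z = ∑ k, g (x k) * v k}
      zero_mem' := ⟨0, Fin.elim0, Fin.elim0, fun k => k.elim0, by simp⟩
      add_mem' := by
        rintro _ _ ⟨N, x, v, hv, rfl⟩ ⟨N', x', v', hv', rfl⟩
        refine ⟨N + N', Fin.append x x', Fin.append v v', fun k => ?_, ?_⟩
        · refine Fin.addCases (fun k => ?_) (fun k => ?_) k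
          · rw [Fin.append_left]
            exact hv k
          · rw [Fin.append_right]
            exact hv' k
        · simp [Fin.sum_univ_add]
      neg_mem' := by
        rintro _ ⟨N, x, v, hv, rfl⟩
        exact ⟨N, fun k => -x k, v, hv, by simp⟩ }
  have hT : ∀ (x : Uni A), ∀ v ∈ wordSpan φ₁ φ₂ n (!s), g x * v ∈ T := fun x v hv =>
    ⟨1, fun _ => x, fun _ => v, fun _ => hv, by simp⟩
  suffices wordSpan φ₁ φ₂ (n + 1) s ⊔ wordSpan φ₁ φ₂ n (!s) ≤ T from this hz
  refine sup_le (wordSpan_succ_le φ₁ φ₂ (fun b => ?_) fun x hx v hv => ?_) fun v hv => ?_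
  · have := hT (ofB b) 1 (ofB_one (A := coprod A₁ A₂) ▸ ofB_mem_wordSpan φ₁ φ₂ n (!s) 1)
    rwa [hg, mul_one] at this
  · rw [hZ] at hx
    obtain ⟨x, _, rfl⟩ := exists_of_mem_centred hx
    exact hT x v hv
  · have := hT 1 v hv
    rwa [map_one, one_mul] at this

/-- The induction on the length of words: the given elements are sums of `g x * v` with shorter
words `v` of the other kind, and by orthogonality the inner product of two such products sees only
the expectation of `x* x'`. -/
theorem isGram_of_mem_sup {s : Bool} {n : ℕ} (g : Uni A →+* Uni (coprod A₁ A₂))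
    (hg : ∀ b, g (ofB b) = ofB b) (hs : ∀ x, g (star x) = star (g x))
    (hZ : centredPair φ₁ φ₂ s = centred φ g)
    (ih : ∀ (m : ℕ) (z : Fin m → Uni (coprod A₁ A₂)), (∀ i, z i ∈ wordSpan φ₁ φ₂ n (!s)) →
      IsGram fun i j => freeFun φ₁ φ₂ (star (z i) * z j))
    {m : ℕ} (z : Fin m → Uni (coprod A₁ A₂))
    (hz : ∀ i, z i ∈ wordSpan φ₁ φ₂ (n + 1) s ⊔ wordSpan φ₁ φ₂ n (!s)) :
    IsGram fun i j => freeFun φ₁ φ₂ (star (z i) * z j) := by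
  choose N x v hv hz using fun i => exists_sum_of_mem_wordSpan φ φ₁ φ₂ g hg hZ (hz i)
  have := isGram_of_reduction φ (freeFun φ₁ φ₂) g hs (wordSpan φ₁ φ₂ n (!s))
    (fun b v hv => by rw [hg]; exact base_mul_wordSpan φ₁ φ₂ n _ b hv)
    (fun x hx v hv w hw => freeFun_star_mul φ₁ φ₂ (by cases s <;> simp)
      (wordSpan_le_unitalSpan φ₁ φ₂ n _ hv)
      (centred_mul_unitalSpan φ₁ φ₂ (by cases s <;> simp) (hZ ▸ mem_centred φ g hx)
        (wordSpan_le_unitalSpan φ₁ φ₂ n _ hw))) ih N x v hv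
  simpa only [← hz] using this

theorem isGram_wordSpan (n : ℕ) : ∀ (s : Bool) (m : ℕ) (z : Fin m → Uni (coprod A₁ A₂)),
    (∀ i, z i ∈ wordSpan φ₁ φ₂ n s) → IsGram fun i j => freeFun φ₁ φ₂ (star (z i) * z j) := by
  induction n with
  | zero =>
    intro s m z hz
    choose b hb using hz
    refine ⟨1, fun _ => b, fun i j => ?_⟩
    beta_reduce
    rw [← hb, ← hb, Fin.sum_univ_one]
    show freeFun φ₁ φ₂ (star (ofB (b i)) * ofB (b j)) = _
    rw [star_ofB, ← ofB_mul, freeFun_ofB]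
  | succ n ih =>
    intro s m z hz
    cases s with
    | true =>
      exact isGram_of_mem_sup φ₁ φ₁ φ₂ (mapHom (inl A₁ A₂)) (map_ofB _) (Uni.map_star _) rfl (ih _) z
        fun i => AddSubgroup.mem_sup_left (hz i)
    | false =>
      exact isGram_of_mem_sup φ₂ φ₁ φ₂ (mapHom (inr A₁ A₂)) (map_ofB _) (Uni.map_star _) rfl (ih _) z
        fun i => AddSubgroup.mem_sup_left (hz i)

theorem isGram_freeFun {m : ℕ} (z : Fin m → Uni (coprod A₁ A₂)) :
    IsGram fun i j => freeFun φ₁ φ₂ (star (z i) * z j) := by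
  have hmono : Monotone fun n => wordSpan φ₁ φ₂ n true ⊔ wordSpan φ₁ φ₂ n false := fun n n' h =>
    sup_le_sup (wordSpan_mono φ₁ φ₂ _ h) (wordSpan_mono φ₁ φ₂ _ h)
  have key : ∀ z : Uni (coprod A₁ A₂), ∃ n, z ∈ wordSpan φ₁ φ₂ n true ⊔ wordSpan φ₁ φ₂ n false := by
    intro z
    rw [← AddSubgroup.mem_iSup_of_directed hmono.directed_le]
    suffices (ofBHom (coprod A₁ A₂)).toAddMonoidHom.range ⊔ ⨆ s, altSpan (centredPair φ₁ φ₂) s ≤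
      ⨆ n, wordSpan φ₁ φ₂ n true ⊔ wordSpan φ₁ φ₂ n false from this (centredPair_span φ₁ φ₂ z)
    refine sup_le ?_ (iSup_le fun s => (AddSubgroup.closure_le _).2 fun z hz => ?_)
    · exact le_sup_left.trans
        (le_iSup (fun n => wordSpan φ₁ φ₂ n true ⊔ wordSpan φ₁ φ₂ n false) 0)
    · obtain ⟨n, hn⟩ := exists_mem_wordSpan φ₁ φ₂ hz
      refine le_iSup (fun n => wordSpan φ₁ φ₂ n true ⊔ wordSpan φ₁ φ₂ n false) n ?_
      cases s with
      | true => exact AddSubgroup.mem_sup_left hn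
      | false => exact AddSubgroup.mem_sup_right hn
  choose n hn using fun i => key (z i)
  -- A common bound for the lengths exists since there are finitely many elements. Words beginning
  -- in `A₁` may be one letter longer than those beginning in `A₂`, so enlarging the first span
  -- suffices.
  refine isGram_of_mem_sup φ₁ φ₁ φ₂ (s := true) (n := Finset.univ.sup n) (mapHom (inl A₁ A₂)) (map_ofB _)
    (Uni.map_star _) rfl (isGram_wordSpan φ₁ φ₂ _ _) z fun i => ?_
  exact sup_le_sup_right (wordSpan_le_succ φ₁ φ₂ _ _) _
    (hmono (Finset.le_sup (f := n) (Finset.mem_univ i)) (hn i))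

/-- The free product of two conditional expectations. -/
noncomputable def freeProd : Expectation (coprod A₁ A₂) :=
  Expectation.ofExt (freeFun φ₁ φ₂) (freeFun_ofB φ₁ φ₂) (freeFun_ofB_mul φ₁ φ₂)
    (freeFun_mul_ofB φ₁ φ₂) fun _ z => isGram_freeFun φ₁ φ₂ z

theorem freeProd_ext (z : Uni (coprod A₁ A₂)) : (freeProd φ₁ φ₂).ext z = freeFun φ₁ φ₂ z :=
  Expectation.ofExt_ext ..

theorem freeProd_apply (z : coprod A₁ A₂) : freeProd φ₁ φ₂ z = freeFun φ₁ φ₂ (ofA z) := rfl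

theorem freeProd_inl (a : A₁) : freeProd φ₁ φ₂ (inl A₁ A₂ a) = φ₁ a := by
  rw [freeProd_apply, ← map_ofA, freeFun_inl, φ₁.ext_ofA]

theorem freeProd_inr (a : A₂) : freeProd φ₁ φ₂ (inr A₁ A₂ a) = φ₂ a := by
  rw [freeProd_apply, ← map_ofA, freeFun_inr, φ₂.ext_ofA]

/-- The two homomorphisms map centred elements to centred ones, hence alternating products to
alternating products, so both functionals vanish on these and agree on `B`. -/
theorem freeProd_natural {B' : Type u} [Ring B'] [StarRing B'] [Algebra ℂ B'] [StarModule ℂ B']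
    (β : B →⋆ₐ[ℂ] B') {D₁ D₂ : BAlg B'} (ψ₁ : Expectation D₁) (ψ₂ : Expectation D₂)
    (f₁ : Hom A₁ (restrict β D₁)) (f₂ : Hom A₂ (restrict β D₂))
    (h₁ : ∀ a, ψ₁ (under β f₁ a) = β (φ₁ a)) (h₂ : ∀ a, ψ₂ (under β f₂ a) = β (φ₂ a))
    (x : coprod A₁ A₂) :
    freeProd ψ₁ ψ₂ (under β (coprodMap β f₁ f₂) x) = β (freeProd φ₁ φ₂ x) := by
  have hl : ∀ x, baseMap β (coprodMap β f₁ f₂) (map (inl A₁ A₂) x) =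
    map (inl D₁ D₂) (baseMap β f₁ x) := fun _ => rfl
  have hr : ∀ x, baseMap β (coprodMap β f₁ f₂) (map (inr A₁ A₂) x) =
    map (inr D₁ D₂) (baseMap β f₂ x) := fun _ => rfl
  have e := eq_of_vanish_centredPair φ₁ φ₂
    (L := (freeFun ψ₁ ψ₂).comp (baseMap β (coprodMap β f₁ f₂)).toAddMonoidHom)
    (L' := (β : B →+* B').toAddMonoidHom.comp (freeFun φ₁ φ₂)) (fun s z h => ?_) (fun s z h => ?_)
    (fun b => ?_) (ofA x)
  · rw [freeProd_apply, freeProd_apply, ← baseMap_ofA]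
    exact e
  · refine freeFun_alt ψ₁ ψ₂ (s := s) (h.map (S' := Set.univ) (baseMap β (coprodMap β f₁ f₂)) id (fun _ _ _ _ => id) (fun _ _ => trivial) ?_)
    intro s _ x hx
    cases s with
    | true =>
      obtain ⟨x, hx', rfl⟩ := exists_of_mem_centred (φ := φ₁) (g := mapHom (inl A₁ A₂)) hx
      exact mem_centred ψ₁ (mapHom (inl D₁ D₂)) (by rw [ext_baseMap β h₁, hx', _root_.map_zero])
    | false =>
      obtain ⟨x, hx', rfl⟩ := exists_of_mem_centred (φ := φ₂) (g := mapHom (inr A₁ A₂)) hx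
      exact mem_centred ψ₂ (mapHom (inr D₁ D₂)) (by rw [ext_baseMap β h₂, hx', _root_.map_zero])
  · show β (freeFun φ₁ φ₂ z) = 0
    rw [freeFun_alt φ₁ φ₂ h, _root_.map_zero]
  · show freeFun ψ₁ ψ₂ (baseMap β _ (ofB b)) = β (freeFun φ₁ φ₂ (ofB b))
    rw [baseMap_ofB, freeFun_ofB, freeFun_ofB]

theorem freeProd_swap (x : coprod A₁ A₂) :
    freeProd φ₁ φ₂ x = freeProd φ₂ φ₁ (swap A₁ A₂ x) := by
  refine eq_of_vanish_centredPair φ₁ φ₂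
    (L' := (freeFun φ₂ φ₁).comp (mapHom (swap A₁ A₂)).toAddMonoidHom)
    (fun s z h => freeFun_alt φ₁ φ₂ h) (fun s z h => ?_) (fun b => ?_) (ofA x)
  · refine freeFun_alt φ₂ φ₁ (s := !s) (h.map (S' := Set.univ) (mapHom (swap A₁ A₂)) (fun s => !s) (fun _ _ _ _ => Bool.not_inj)
      (fun _ _ => trivial) ?_)
    intro s _ x hx
    cases s with
    | true =>
      obtain ⟨x, hx', rfl⟩ := exists_of_mem_centred (φ := φ₁) (g := mapHom (inl A₁ A₂)) hx
      exact mem_centred φ₁ (mapHom (inr A₂ A₁)) hx'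
    | false =>
      obtain ⟨x, hx', rfl⟩ := exists_of_mem_centred (φ := φ₂) (g := mapHom (inr A₁ A₂)) hx
      exact mem_centred φ₂ (mapHom (inl A₂ A₁)) hx'
  · show _ = freeFun φ₂ φ₁ (map _ (ofB b))
    rw [map_ofB, freeFun_ofB, freeFun_ofB]

/-! ### Associativity of the free product -/

/-- The centred elements of the three factors of an iterated coproduct. -/
def centredTriple {R : Type*} [Ring R] (g₁ : Uni A₁ →+* R) (g₂ : Uni A₂ →+* R)
    (g₃ : Uni A₃ →+* R) : Fin 3 → AddSubgroup R :=
  ![centred φ₁ g₁, centred φ₂ g₂, centred φ₃ g₃]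

theorem centredTriple_mem {R : Type*} [Ring R] {g₁ : Uni A₁ →+* R} {g₂ : Uni A₂ →+* R}
    {g₃ : Uni A₃ →+* R} {P : Fin 3 → R → Prop} (h₁ : ∀ x, φ₁.ext x = 0 → P 0 (g₁ x))
    (h₂ : ∀ x, φ₂.ext x = 0 → P 1 (g₂ x)) (h₃ : ∀ x, φ₃.ext x = 0 → P 2 (g₃ x)) (i : Fin 3) (y : R)
    (hy : y ∈ centredTriple φ₁ φ₂ φ₃ g₁ g₂ g₃ i) : P i y := by
  fin_cases i
  · obtain ⟨x, hx, rfl⟩ := exists_of_mem_centred (φ := φ₁) (g := g₁) hy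
    exact h₁ x hx
  · obtain ⟨x, hx, rfl⟩ := exists_of_mem_centred (φ := φ₂) (g := g₂) hy
    exact h₂ x hx
  · obtain ⟨x, hx, rfl⟩ := exists_of_mem_centred (φ := φ₃) (g := g₃) hy
    exact h₃ x hx

/-- Consecutive factors from `A₁` and `A₂` are grouped. Each group is an alternating product in `A₁
⊔ A₂`, hence centred for the product of `φ₁` and `φ₂`. -/
theorem freeFun_triple_left {z : Uni (coprod (coprod A₁ A₂) A₃)} {i : Fin 3}
    (h : IsAlt Set.univ (centredTriple φ₁ φ₂ φ₃
      ((mapHom (inl (coprod A₁ A₂) A₃)).comp (mapHom (inl A₁ A₂)))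
      ((mapHom (inl (coprod A₁ A₂) A₃)).comp (mapHom (inr A₁ A₂)))
      (mapHom (inr (coprod A₁ A₂) A₃))) i z) :
    freeFun (freeProd φ₁ φ₂) φ₃ z = 0 := by
  refine freeFun_alt _ _ (h.group (Y := centredPair (freeProd φ₁ φ₂) φ₃) ![true, true, false] ?_)
  have key : ∀ i y, i ≠ 2 → IsAlt {j | j ≠ 2} (centredTriple φ₁ φ₂ φ₃
      ((mapHom (inl (coprod A₁ A₂) A₃)).comp (mapHom (inl A₁ A₂)))
      ((mapHom (inl (coprod A₁ A₂) A₃)).comp (mapHom (inr A₁ A₂)))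
      (mapHom (inr (coprod A₁ A₂) A₃))) i y →
      y ∈ centred (freeProd φ₁ φ₂) (mapHom (inl (coprod A₁ A₂) A₃)) := by
    intro i y hi hy
    obtain ⟨y', hy', rfl⟩ := hy.exists_lift (Z' := centredPair φ₁ φ₂) (mapHom (inl _ A₃))
      ![true, false, false] (show ∀ i : Fin 3, i ≠ 2 → ∀ j : Fin 3, j ≠ 2 →
        (![true, false, false] : Fin 3 → Bool) i = ![true, false, false] j → i = j by decide)
      (fun j hj x hx => centredTriple_mem φ₁ φ₂ φ₃
        (P := fun j x => j ≠ 2 → ∃ x' ∈ centredPair φ₁ φ₂ (![true, false, false] j),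
          mapHom (inl _ A₃) x' = x)
        (fun x hx _ => ⟨_, mem_centred φ₁ (mapHom (inl A₁ A₂)) hx, rfl⟩)
        (fun x hx _ => ⟨_, mem_centred φ₂ (mapHom (inr A₁ A₂)) hx, rfl⟩)
        (fun x hx h => absurd rfl h) j x hx hj)
    exact mem_centred _ _ (by rw [freeProd_ext, freeFun_alt φ₁ φ₂ hy'])
  intro i y hy
  fin_cases i
  · exact key 0 y (by decide) (hy.mono (by rintro _ hj rfl; exact absurd (show false = true from hj) (by decide)))
  · exact key 1 y (by decide) (hy.mono (by rintro _ hj rfl; exact absurd (show false = true from hj) (by decide)))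
  · exact hy.mem_of_subsingleton (by decide)

theorem freeFun_triple_right {z : Uni (coprod A₁ (coprod A₂ A₃))} {i : Fin 3}
    (h : IsAlt Set.univ (centredTriple φ₁ φ₂ φ₃ (mapHom (inl A₁ (coprod A₂ A₃)))
      ((mapHom (inr A₁ (coprod A₂ A₃))).comp (mapHom (inl A₂ A₃)))
      ((mapHom (inr A₁ (coprod A₂ A₃))).comp (mapHom (inr A₂ A₃)))) i z) :
    freeFun φ₁ (freeProd φ₂ φ₃) z = 0 := by
  refine freeFun_alt _ _ (h.group (Y := centredPair φ₁ (freeProd φ₂ φ₃)) ![true, false, false] ?_)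
  have key : ∀ i y, i ≠ 0 → IsAlt {j | j ≠ 0} (centredTriple φ₁ φ₂ φ₃
      (mapHom (inl A₁ (coprod A₂ A₃)))
      ((mapHom (inr A₁ (coprod A₂ A₃))).comp (mapHom (inl A₂ A₃)))
      ((mapHom (inr A₁ (coprod A₂ A₃))).comp (mapHom (inr A₂ A₃)))) i y →
      y ∈ centred (freeProd φ₂ φ₃) (mapHom (inr A₁ (coprod A₂ A₃))) := by
    intro i y hi hy
    obtain ⟨y', hy', rfl⟩ := hy.exists_lift (Z' := centredPair φ₂ φ₃) (mapHom (inr A₁ _))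
      ![true, true, false] (show ∀ i : Fin 3, i ≠ 0 → ∀ j : Fin 3, j ≠ 0 →
        (![true, true, false] : Fin 3 → Bool) i = ![true, true, false] j → i = j by decide)
      (fun j hj x hx => centredTriple_mem φ₁ φ₂ φ₃
        (P := fun j x => j ≠ 0 → ∃ x' ∈ centredPair φ₂ φ₃ (![true, true, false] j),
          mapHom (inr A₁ _) x' = x)
        (fun x hx h => absurd rfl h)
        (fun x hx _ => ⟨_, mem_centred φ₂ (mapHom (inl A₂ A₃)) hx, rfl⟩)
        (fun x hx _ => ⟨_, mem_centred φ₃ (mapHom (inr A₂ A₃)) hx, rfl⟩) j x hx hj)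
    exact mem_centred _ _ (by rw [freeProd_ext, freeFun_alt φ₂ φ₃ hy'])
  intro i y hy
  fin_cases i
  · exact hy.mem_of_subsingleton (by decide)
  · exact key 1 y (by decide) (hy.mono (by rintro _ hj rfl; exact absurd (show true = false from hj) (by decide)))
  · exact key 2 y (by decide) (hy.mono (by rintro _ hj rfl; exact absurd (show true = false from hj) (by decide)))

theorem centredTriple_span (z : Uni (coprod (coprod A₁ A₂) A₃)) :
    z ∈ (ofBHom (coprod (coprod A₁ A₂) A₃)).toAddMonoidHom.range ⊔ ⨆ i, altSpan
      (centredTriple φ₁ φ₂ φ₃ ((mapHom (inl (coprod A₁ A₂) A₃)).comp (mapHom (inl A₁ A₂)))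
        ((mapHom (inl (coprod A₁ A₂) A₃)).comp (mapHom (inr A₁ A₂)))
        (mapHom (inr (coprod A₁ A₂) A₃))) i := by
  let Z : Fin 3 → AddSubgroup (Uni (coprod (coprod A₁ A₂) A₃)) := centredTriple φ₁ φ₂ φ₃
    ((mapHom (inl (coprod A₁ A₂) A₃)).comp (mapHom (inl A₁ A₂)))
    ((mapHom (inl (coprod A₁ A₂) A₃)).comp (mapHom (inr A₁ A₂)))
    (mapHom (inr (coprod A₁ A₂) A₃))
  let W := (ofBHom (coprod (coprod A₁ A₂) A₃)).toAddMonoidHom.range ⊔ ⨆ i, altSpan Z i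
  have h : IsCentred (ofBHom (coprod (coprod A₁ A₂) A₃)) Z := by
    refine isCentred_of_eq fun i => ?_
    fin_cases i
    · exact ⟨A₁, φ₁, (mapHom (inl (coprod A₁ A₂) A₃)).comp (mapHom (inl A₁ A₂)),
        fun b => by simp, rfl⟩
    · exact ⟨A₂, φ₂, (mapHom (inl (coprod A₁ A₂) A₃)).comp (mapHom (inr A₁ A₂)),
        fun b => by simp, rfl⟩
    · exact ⟨A₃, φ₃, mapHom (inr (coprod A₁ A₂) A₃), fun b => by simp, rfl⟩
  have hl : ∀ (y : Uni (coprod A₁ A₂)) (v), v ∈ W → map (inl (coprod A₁ A₂) A₃) y * v ∈ W := by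
    intro y
    refine word_induction (p := fun y => ∀ v ∈ W, map (inl (coprod A₁ A₂) A₃) y * v ∈ W)
      (fun b v hv => ?_) (fun a v hv => ?_) (fun a v hv => ?_) (fun x y hx hy v hv => ?_)
      (fun x y hx hy v hv => ?_) y
    · rw [map_ofB]
      exact h.base_mem hv
    · exact h.ring_mul_mem 0 φ₁ ((mapHom (inl (coprod A₁ A₂) A₃)).comp (mapHom (inl A₁ A₂)))
        (fun b => by simp) rfl (ofA a) hv
    · exact h.ring_mul_mem 1 φ₂ ((mapHom (inl (coprod A₁ A₂) A₃)).comp (mapHom (inr A₁ A₂)))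
        (fun b => by simp) rfl (ofA a) hv
    · rw [Uni.map_add, add_mul]
      exact add_mem (hx v hv) (hy v hv)
    · rw [Uni.map_mul, mul_assoc]
      exact hx _ (hy v hv)
  have key : ∀ v ∈ W, z * v ∈ W := by
    refine word_induction (p := fun z => ∀ v ∈ W, z * v ∈ W) (fun b v hv => ?_) (fun a v hv => ?_)
      (fun a v hv => ?_) (fun x y hx hy v hv => ?_) (fun x y hx hy v hv => ?_) z
    · exact h.base_mem hv
    · exact hl (ofA a) v hv
    · exact h.ring_mul_mem 2 φ₃ (mapHom (inr (coprod A₁ A₂) A₃)) (fun b => by simp) rfl (ofA a) hv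
    · rw [add_mul]
      exact add_mem (hx v hv) (hy v hv)
    · rw [mul_assoc]
      exact hx _ (hy v hv)
  have := key 1 (AddSubgroup.mem_sup_left ⟨1, map_one (ofBHom _)⟩)
  rwa [mul_one] at this

/-- Both bracketings vanish on the alternating products of centred elements of the three algebras
and are the identity on `B`; these elements span. -/
theorem freeProd_assoc (x : coprod (coprod A₁ A₂) A₃) :
    freeProd (freeProd φ₁ φ₂) φ₃ x = freeProd φ₁ (freeProd φ₂ φ₃) (assoc A₁ A₂ A₃ x) := by
  refine IsCentred.eq_of_vanish (centredTriple_span φ₁ φ₂ φ₃)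
    (L' := (freeFun φ₁ (freeProd φ₂ φ₃)).comp (mapHom (assoc A₁ A₂ A₃)).toAddMonoidHom)
    (fun i z h => freeFun_triple_left φ₁ φ₂ φ₃ h) (fun i z h => ?_) (fun b => ?_) (ofA x)
  · refine freeFun_triple_right φ₁ φ₂ φ₃ (i := i) (h.map (S' := Set.univ) (mapHom (assoc A₁ A₂ A₃)) id
      (fun _ _ _ _ => id) (fun _ _ => trivial) fun i _ x hx => ?_)
    exact centredTriple_mem φ₁ φ₂ φ₃ (P := fun i x => mapHom (assoc A₁ A₂ A₃) x ∈
      centredTriple φ₁ φ₂ φ₃ (mapHom (inl A₁ (coprod A₂ A₃)))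
        ((mapHom (inr A₁ (coprod A₂ A₃))).comp (mapHom (inl A₂ A₃)))
        ((mapHom (inr A₁ (coprod A₂ A₃))).comp (mapHom (inr A₂ A₃))) i)
      (fun x hx => mem_centred φ₁ (mapHom (inl A₁ (coprod A₂ A₃))) hx)
      (fun x hx => mem_centred φ₂
        ((mapHom (inr A₁ (coprod A₂ A₃))).comp (mapHom (inl A₂ A₃))) hx)
      (fun x hx => mem_centred φ₃
        ((mapHom (inr A₁ (coprod A₂ A₃))).comp (mapHom (inr A₂ A₃))) hx) i x hx
  · show freeFun _ _ (ofB b) = freeFun _ _ (map _ (ofB b))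
    rw [map_ofB, freeFun_ofB, freeFun_ofB]

/-! ### Units in the free product -/

/-- Meant for `g = e - 1` with a unit `e`. Since `g` swallows neighbouring elements of its own
algebra up to a coefficient from `B`, only words beginning with the other kind need to stand on
either side of `g`, and then orthogonality applies. -/
theorem freeFun_mul_unit {s : Bool} {g : Uni (coprod A₁ A₂)} (hg : g ∈ centredPair φ₁ φ₂ s)
    (hs : star g = g) (hu : ∀ z ∈ centredPair φ₁ φ₂ s, ∃ b, g * z = g * ofB b)
    (x y : Uni (coprod A₁ A₂)) : freeFun φ₁ φ₂ (x * g * y) = 0 := by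
  have key : ∀ y, ∃ v ∈ unitalSpan φ₁ φ₂ (!s), g * y = g * v := by
    intro y
    let T : AddSubgroup (Uni (coprod A₁ A₂)) :=
      { carrier := {y | ∃ v ∈ unitalSpan φ₁ φ₂ (!s), g * y = g * v}
        zero_mem' := ⟨0, zero_mem _, rfl⟩
        add_mem' := by
          rintro y y' ⟨v, hv, h⟩ ⟨v', hv', h'⟩
          exact ⟨v + v', add_mem hv hv', by rw [mul_add, mul_add, h, h']⟩
        neg_mem' := by
          rintro y ⟨v, hv, h⟩
          exact ⟨-v, neg_mem hv, by rw [mul_neg, mul_neg, h]⟩ }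
    suffices (ofBHom (coprod A₁ A₂)).toAddMonoidHom.range ⊔ ⨆ s, altSpan (centredPair φ₁ φ₂) s ≤ T
      from this (centredPair_span φ₁ φ₂ y)
    refine sup_le ?_ (iSup_le fun t => (AddSubgroup.closure_le _).2 fun z hz => ?_)
    · rintro _ ⟨b, rfl⟩
      exact ⟨ofB b, ofB_mem_unitalSpan φ₁ φ₂ _ b, rfl⟩
    · by_cases hst : t = s
      · subst hst
        cases hz with
        | single _ hx =>
          obtain ⟨b, hb⟩ := hu _ hx
          exact ⟨ofB b, ofB_mem_unitalSpan φ₁ φ₂ _ b, hb⟩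
        | @mul _ j x y _ hij hx hy =>
          obtain ⟨b, hb⟩ := hu _ hx
          obtain rfl : j = !t := by cases j <;> cases t <;> simp_all
          refine ⟨ofB b * y, AddSubgroup.mem_sup_right ((centredPair_isCentred φ₁ φ₂).base_mul
            (AddSubgroup.subset_closure hy)), ?_⟩
          rw [← mul_assoc, hb, mul_assoc]
      · obtain rfl : t = !s := by cases t <;> cases s <;> simp_all
        exact ⟨z, alt_mem_unitalSpan φ₁ φ₂ hz, rfl⟩
  obtain ⟨v, hv, h⟩ := key y
  -- As `g` is hermitian, the left neighbour is treated by taking adjoints.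
  obtain ⟨w, hw, h'⟩ := key (star x)
  have h'' := congrArg star h'
  rw [star_mul, star_mul, star_star, hs] at h''
  rw [mul_assoc, h, ← mul_assoc, h'', mul_assoc]
  exact freeFun_star_mul φ₁ φ₂ (by cases s <;> simp) hw
    (centred_mul_unitalSpan φ₁ φ₂ (by cases s <;> simp) hg hv)

theorem star_unit {e : A} (he : ∀ a, e * a = a ∧ a * e = a) : star e = e := by
  have h := (he (star e)).2
  have h' := congrArg star (he (star e)).1
  rw [star_mul, star_star] at h'
  exact (he (star e)).1.symm.trans h'

theorem centred_unit {e : A} (he : ∀ a, e * a = a ∧ a * e = a) (h : φ e = 1) :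
    φ.ext (ofA e - 1) = 0 := by
  rw [φ.ext_sub, φ.ext_ofA, φ.ext_one, h, sub_self]

theorem unit_sub_one_mul {e : A} (he : ∀ a, e * a = a ∧ a * e = a) (x : Uni A) :
    (ofA e - 1) * x = (ofA e - 1) * ofB x.1 := by
  have : (ofA e - 1 : Uni A) * ofA x.2 = 0 := by
    rw [sub_mul, one_mul, ← ofA_mul, (he _).1, sub_self]
  conv_lhs => rw [eq_add x, mul_add, this, add_zero]

end Free

namespace Independence

/-- Conditional free independence. -/
noncomputable def free : Independence.{u} where
  prod φ₁ φ₂ := freeProd φ₁ φ₂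
  prod_inl φ₁ φ₂ a := freeProd_inl φ₁ φ₂ a
  prod_inr φ₁ φ₂ a := freeProd_inr φ₁ φ₂ a
  associative φ₁ φ₂ φ₃ x := freeProd_assoc φ₁ φ₂ φ₃ x
  natural β _ _ _ _ φ₁ φ₂ φ₁' φ₂' f₁ f₂ h₁ h₂ x := freeProd_natural φ₁ φ₂ β φ₁' φ₂' f₁ f₂ h₁ h₂ x

theorem free_isSymmetric : free.{u}.IsSymmetric := fun φ₁ φ₂ x => freeProd_swap φ₁ φ₂ x

theorem free_isFree : free.{u}.IsFree := by
  intro B _ _ _ _ A₁ A₂ φ₁ φ₂ w hw hc h0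
  have key : ∀ s w, (s :: w).IsChain (fun s t : Uni A₁ ⊕ Uni A₂ => s.isLeft ≠ t.isLeft) →
      (∀ t ∈ s :: w, Sum.elim φ₁.ext φ₂.ext t = 0) → IsAlt Set.univ (centredPair φ₁ φ₂) s.isLeft
      ((s :: w).map (Sum.elim (Uni.map (inl A₁ A₂)) (Uni.map (inr A₁ A₂)))).prod := by
    have hZ : ∀ s : Uni A₁ ⊕ Uni A₂, Sum.elim φ₁.ext φ₂.ext s = 0 →
        Sum.elim (Uni.map (inl A₁ A₂)) (Uni.map (inr A₁ A₂)) s ∈ centredPair φ₁ φ₂ s.isLeft := by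
      rintro (x | x) hx
      · exact mem_centred φ₁ (mapHom (inl A₁ A₂)) hx
      · exact mem_centred φ₂ (mapHom (inr A₁ A₂)) hx
    intro s w
    induction w generalizing s with
    | nil =>
      intro _ h
      simpa using IsAlt.single (S := Set.univ) trivial (hZ s (h s (by simp)))
    | cons t w ih =>
      intro hc h
      rw [List.isChain_cons_cons] at hc
      rw [List.map_cons, List.prod_cons]
      exact .mul trivial hc.1 (hZ s (h s (by simp))) (ih t hc.2 fun t ht => h t (by simp [ht]))
  cases w with
  | nil => exact absurd rfl hw
  | cons s w =>
    show (freeProd φ₁ φ₂).ext _ = 0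
    rw [freeProd_ext]
    exact freeFun_alt φ₁ φ₂ (key s w hc h0)

theorem free_isUnital : free.{u}.IsUnital := by
  intro B _ _ _ _ A₁ A₂ φ₁ φ₂ e₁ e₂ he₁ he₂ h₁ h₂ x y
  show (freeProd φ₁ φ₂).ext _ = (freeProd φ₁ φ₂).ext _ ∧
    (freeProd φ₁ φ₂).ext _ = (freeProd φ₁ φ₂).ext _
  simp only [freeProd_ext]
  constructor
  · have := freeFun_mul_unit φ₁ φ₂ (s := true) (g := map (inl A₁ A₂) (ofA e₁ - 1))
      (mem_centred φ₁ (mapHom (inl A₁ A₂)) (centred_unit φ₁ he₁ h₁))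
      (by rw [← Uni.map_star, star_sub, star_ofA, star_one, star_unit he₁]) (by
        intro z hz
        obtain ⟨z, -, rfl⟩ := exists_of_mem_centred (φ := φ₁) (g := mapHom (inl A₁ A₂)) hz
        refine ⟨z.1, ?_⟩
        rw [mapHom_apply, ← Uni.map_mul, unit_sub_one_mul he₁, Uni.map_mul, map_ofB]) x y
    rw [Uni.map_sub, Uni.map_one, map_ofA, mul_sub, mul_one, sub_mul, map_sub, sub_eq_zero] at this
    exact this
  · have := freeFun_mul_unit φ₁ φ₂ (s := false) (g := map (inr A₁ A₂) (ofA e₂ - 1))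
      (mem_centred φ₂ (mapHom (inr A₁ A₂)) (centred_unit φ₂ he₂ h₂))
      (by rw [← Uni.map_star, star_sub, star_ofA, star_one, star_unit he₂]) (by
        intro z hz
        obtain ⟨z, -, rfl⟩ := exists_of_mem_centred (φ := φ₂) (g := mapHom (inr A₁ A₂)) hz
        refine ⟨z.1, ?_⟩
        rw [mapHom_apply, ← Uni.map_mul, unit_sub_one_mul he₂, Uni.map_mul, map_ofB]) x y
    rw [Uni.map_sub, Uni.map_one, map_ofA, mul_sub, mul_one, sub_mul, map_sub, sub_eq_zero] at this
    exact this

end Independence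

end CondProb

/-! ### Reduction of an independence to two copies of the scalar matrices. -/

namespace CondProb

open scoped RightActions

open Uni

/-! ### Scalars -/

/-- The complex numbers as a base algebra. -/
abbrev Scalars : Type u := ULift.{u} ℂ

section ScalarHom

variable (B : Type u) [Ring B] [StarRing B] [Algebra ℂ B] [StarModule ℂ B]

/-- The unit of a complex `*`-algebra. -/
def scalarHom : Scalars.{u} →⋆ₐ[ℂ] B where
  toFun z := algebraMap ℂ B z.down
  map_one' := map_one _
  map_mul' z w := map_mul _ _ _
  map_zero' := map_zero _
  map_add' z w := map_add _ _ _
  commutes' _ := rfl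
  map_star' z := algebraMap_star_comm z.down

variable {B}

theorem scalarHom_comm (z : Scalars.{u}) (b : B) : scalarHom B z * b = b * scalarHom B z :=
  Algebra.commutes z.down b

theorem ofB_scalarHom_comm {A : BAlg B} (z : Scalars.{u}) (x : Uni A) :
    ofB (scalarHom B z) * x = x * ofB (scalarHom B z) := by
  refine Uni.ext' (scalarHom_comm z x.1) ?_
  simp only [Uni.mul_snd, ofB_fst, ofB_snd, smul_zero, zero_mul, add_zero, mul_zero, zero_add]
  exact A.complex_smul z.down x.2

theorem ofB_comm {A : BAlg Scalars.{u}} (z : Scalars.{u}) (x : Uni A) :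
    ofB z * x = x * ofB z := ofB_scalarHom_comm z x

end ScalarHom

section Maps

variable {B B' : Type u} [Ring B] [StarRing B] [Algebra ℂ B]
  [Ring B'] [StarRing B'] [Algebra ℂ B']

/-- The entrywise application of a homomorphism of the bases to matrices. -/
def matMap (β : B →⋆ₐ[ℂ] B') : Hom (matAlg B) (restrict β (matAlg B')) where
  toFun m := mat fun i j => β (ent m i j)
  map_add m n := ent_ext fun i j => map_add β _ _
  map_mul m n := ent_ext fun i j => by
    refine Eq.trans ?_ (ent_mul _ _ i j).symm
    show β (ent (m * n) i j) = _
    rw [ent_mul, map_add, map_mul, map_mul]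
    rfl
  map_star m := ent_ext fun i j => map_star β _
  map_smul b m := ent_ext fun i j => map_mul β _ _
  map_op_smul b m := ent_ext fun i j => map_mul β _ _

theorem ent_matMap (β : B →⋆ₐ[ℂ] B') (m : matAlg B) (i j : Fin 2) :
    ent (under β (matMap β) m) i j = β (ent m i j) := rfl

theorem matMap_unit (β : B →⋆ₐ[ℂ] B') (i j : Fin 2) :
    under β (matMap β) (unit i j) = unit i j := ent_ext fun k l => by
  rw [ent_matMap, ent_unit, ent_unit]
  split_ifs
  · exact map_one β
  · exact map_zero β

/-- A homomorphism of the bases as a homomorphism of the algebras over themselves. -/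
def selfMap (β : B →⋆ₐ[ℂ] B') : Hom (selfAlg B) (restrict β (selfAlg B')) where
  toFun b := β b
  map_add m n := map_add β _ _
  map_mul m n := map_mul β _ _
  map_star m := map_star β _
  map_smul b m := map_mul β _ _
  map_op_smul b m := map_mul β _ _

end Maps

namespace Independence

variable {B B' : Type u} [Ring B] [StarRing B] [Algebra ℂ B] [StarModule ℂ B]
  [Ring B'] [StarRing B'] [Algebra ℂ B'] [StarModule ℂ B'] (P Q : Independence.{u})

theorem ext_natural (β : B →⋆ₐ[ℂ] B') {A₁ A₂ : BAlg B} {D₁ D₂ : BAlg B'}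
    (φ₁ : Expectation A₁) (φ₂ : Expectation A₂) (ψ₁ : Expectation D₁) (ψ₂ : Expectation D₂)
    (f₁ : Hom A₁ (restrict β D₁)) (f₂ : Hom A₂ (restrict β D₂))
    (h₁ : ∀ a, ψ₁ (under β f₁ a) = β (φ₁ a)) (h₂ : ∀ a, ψ₂ (under β f₂ a) = β (φ₂ a))
    (x : Uni (coprod A₁ A₂)) :
    (P.prod ψ₁ ψ₂).ext (baseMap β (coprodMap β f₁ f₂) x) = β ((P.prod φ₁ φ₂).ext x) :=
  ext_baseMap β (P.natural β φ₁ φ₂ ψ₁ ψ₂ f₁ f₂ h₁ h₂) x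

theorem ext_natural_fixed {A₁ A₂ D₁ D₂ : BAlg B}
    (φ₁ : Expectation A₁) (φ₂ : Expectation A₂) (ψ₁ : Expectation D₁) (ψ₂ : Expectation D₂)
    (f₁ : Hom A₁ D₁) (f₂ : Hom A₂ D₂) (h₁ : ∀ a, ψ₁ (f₁ a) = φ₁ a) (h₂ : ∀ a, ψ₂ (f₂ a) = φ₂ a)
    (x : Uni (coprod A₁ A₂)) :
    (P.prod ψ₁ ψ₂).ext (map (sumMap f₁ f₂) x) = (P.prod φ₁ φ₂).ext x :=
  congrArg (x.1 + ·) (P.natural_fixed φ₁ φ₂ ψ₁ ψ₂ f₁ f₂ h₁ h₂ x.2)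

theorem ext_associative {A₁ A₂ A₃ : BAlg B} (φ₁ : Expectation A₁) (φ₂ : Expectation A₂)
    (φ₃ : Expectation A₃) (x : Uni (coprod (coprod A₁ A₂) A₃)) :
    (P.prod (P.prod φ₁ φ₂) φ₃).ext x =
      (P.prod φ₁ (P.prod φ₂ φ₃)).ext (map (assoc A₁ A₂ A₃) x) :=
  congrArg (x.1 + ·) (P.associative φ₁ φ₂ φ₃ x.2)

theorem ext_map_inl {A₁ A₂ : BAlg B} (φ₁ : Expectation A₁) (φ₂ : Expectation A₂) (x : Uni A₁) :
    (P.prod φ₁ φ₂).ext (map (inl A₁ A₂) x) = φ₁.ext x :=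
  congrArg (x.1 + ·) (P.prod_inl φ₁ φ₂ x.2)

theorem ext_map_inr {A₁ A₂ : BAlg B} (φ₁ : Expectation A₁) (φ₂ : Expectation A₂) (x : Uni A₂) :
    (P.prod φ₁ φ₂).ext (map (inr A₁ A₂) x) = φ₂.ext x :=
  congrArg (x.1 + ·) (P.prod_inr φ₁ φ₂ x.2)

theorem ext_op {A₁ A₂ : BAlg B} (φ₁ : Expectation A₁) (φ₂ : Expectation A₂)
    (x : Uni (coprod A₁ A₂)) :
    (P.op.prod φ₁ φ₂).ext x = (P.prod φ₂ φ₁).ext (map (swap A₁ A₂) x) := rfl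

variable (B) in
/-- The embedding of the scalar matrices into the matrices over `B`, for two copies. -/
def scalarMat : Uni (coprod (matAlg Scalars.{u}) (matAlg Scalars.{u})) →+*
    Uni (coprod (matAlg B) (matAlg B)) :=
  baseMap (scalarHom B) (coprodMap (scalarHom B) (matMap (scalarHom B)) (matMap (scalarHom B)))

theorem ext_scalarMat (y : Uni (coprod (matAlg Scalars.{u}) (matAlg Scalars.{u}))) :
    (P.prod (matExp B) (matExp B)).ext (scalarMat B y) =
      scalarHom B ((P.prod (matExp Scalars) (matExp Scalars)).ext y) :=
  P.ext_natural (scalarHom B) _ _ _ _ _ _ (fun _ => rfl) (fun _ => rfl) y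

theorem scalarMat_wl (m : matAlg Scalars.{u}) : scalarMat B (wl _ _ m) =
    wl _ _ (under (scalarHom B) (matMap (scalarHom B)) m) := baseMap_wl _ _ _ _

theorem scalarMat_wr (m : matAlg Scalars.{u}) : scalarMat B (wr _ _ m) =
    wr _ _ (under (scalarHom B) (matMap (scalarHom B)) m) := baseMap_wr _ _ _ _

theorem scalarMat_ofB (z : Scalars.{u}) : scalarMat B (ofB z) = ofB (scalarHom B z) :=
  baseMap_ofB _ _ _

theorem matMap_comm (m : matAlg Scalars.{u}) (b : B) :
    (under (scalarHom B) (matMap (scalarHom B)) m) <• b =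
      b • under (scalarHom B) (matMap (scalarHom B)) m := ent_ext fun i j => by
  rw [ent_op_smul, ent_smul, ent_matMap, scalarHom_comm]

theorem scalarMat_comm (y : Uni (coprod (matAlg Scalars.{u}) (matAlg Scalars.{u}))) (b : B) :
    scalarMat B y * ofB b = ofB b * scalarMat B y := by
  refine word_induction (p := fun y => scalarMat B y * ofB b = ofB b * scalarMat B y)
    (fun z => ?_) (fun m => ?_) (fun m => ?_) (fun x y hx hy => ?_) (fun x y hx hy => ?_) y
  · rw [scalarMat_ofB, ofB_scalarHom_comm]
  · rw [scalarMat_wl, ← wl_op_smul, ← wl_smul, matMap_comm]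
  · rw [scalarMat_wr, ← wr_op_smul, ← wr_smul, matMap_comm]
  · rw [map_add (scalarMat B), add_mul, mul_add, hx, hy]
  · rw [map_mul (scalarMat B), mul_assoc, hy, ← mul_assoc, hx, mul_assoc]

/-- The matrix units are images of scalar ones, and such images commute with the base, so the
coefficients can be collected on the left of a product. -/
theorem mem_closure_scalarMat (x : Uni (coprod (matAlg B) (matAlg B))) :
    x ∈ AddSubgroup.closure {x | ∃ b y, x = ofB b * scalarMat B y} := by
  set S : AddSubgroup (Uni (coprod (matAlg B) (matAlg B))) :=
    AddSubgroup.closure {x | ∃ b y, x = ofB b * scalarMat B y} with hS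
  have hmem : ∀ b y, ofB b * scalarMat B y ∈ S := fun b y =>
    AddSubgroup.subset_closure ⟨b, y, rfl⟩
  have hl : ∀ (b : B) i j, ofB b * wl _ _ (unit i j) ∈ S := fun b i j => by
    have := hmem b (wl _ _ (unit i j))
    rwa [scalarMat_wl, matMap_unit] at this
  have hr : ∀ (b : B) i j, ofB b * wr _ _ (unit i j) ∈ S := fun b i j => by
    have := hmem b (wr _ _ (unit i j))
    rwa [scalarMat_wr, matMap_unit] at this
  refine word_induction (p := fun x => x ∈ S) (fun b => ?_) (fun m => ?_) (fun m => ?_)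
    (fun x y hx hy => S.add_mem hx hy) (fun x y hx hy => ?_) x
  · have := hmem b 1
    rwa [map_one (scalarMat B), mul_one] at this
  · rw [mat_eq_sum m]
    simp only [wl_add, wl_smul]
    exact S.add_mem (S.add_mem (hl _ _ _) (hl _ _ _)) (S.add_mem (hl _ _ _) (hl _ _ _))
  · rw [mat_eq_sum m]
    simp only [wr_add, wr_smul]
    exact S.add_mem (S.add_mem (hr _ _ _) (hr _ _ _)) (S.add_mem (hr _ _ _) (hr _ _ _))
  · suffices S ≤ S.comap (AddMonoidHom.mulRight y) from this hx
    refine (AddSubgroup.closure_le _).2 ?_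
    rintro _ ⟨b, v, rfl⟩
    suffices S ≤ S.comap (AddMonoidHom.mulLeft (ofB b * scalarMat B v)) from this hy
    refine (AddSubgroup.closure_le _).2 ?_
    rintro _ ⟨b', v', rfl⟩
    show ofB b * scalarMat B v * (ofB b' * scalarMat B v') ∈ S
    have e : ofB b * scalarMat B v * (ofB b' * scalarMat B v') =
        ofB (b * b') * scalarMat B (v * v') := by
      rw [map_mul (scalarMat B), ofB_mul, mul_assoc, ← mul_assoc (scalarMat B v), scalarMat_comm,
        mul_assoc, mul_assoc]
    rw [e]
    exact hmem _ _

variable {P Q}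

/-- An independence is determined by two copies of the scalar matrices. -/
theorem eq_of_matExp (h : ∀ x, (P.prod (matExp Scalars.{u}) (matExp Scalars.{u})).ext x =
    (Q.prod (matExp Scalars.{u}) (matExp Scalars.{u})).ext x) : P = Q := by
  have key : ∀ {B : Type u} [Ring B] [StarRing B] [Algebra ℂ B] [StarModule ℂ B]
      (x : Uni (coprod (matAlg B) (matAlg B))),
      (P.prod (matExp B) (matExp B)).ext x = (Q.prod (matExp B) (matExp B)).ext x := by
    intro B _ _ _ _ x
    suffices AddSubgroup.closure {x | ∃ b y, x = ofB b * scalarMat B y} ≤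
        (P.prod (matExp B) (matExp B)).extHom.eqLocus (Q.prod (matExp B) (matExp B)).extHom from
      this (mem_closure_scalarMat x)
    refine (AddSubgroup.closure_le _).2 ?_
    rintro _ ⟨b, y, rfl⟩
    show (P.prod (matExp B) (matExp B)).ext _ = (Q.prod (matExp B) (matExp B)).ext _
    rw [Expectation.ext_ofB_mul, Expectation.ext_ofB_mul, ext_scalarMat, ext_scalarMat, h]
  refine eq_of_prod fun {B} _ _ _ _ {A₁ A₂} φ₁ φ₂ => Expectation.eq_of_forall fun x => ?_
  -- The letters `A₁ × A₂` contain both algebras as summands, so both expectations are dilated over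
  -- the same base.
  apply toDbl_base_injective (X := A₁ × A₂)
  have e := fun R : Independence.{u} => R.ext_natural (toDbl (Fock.base B (A₁ × A₂))) φ₁ φ₂ _ _ _ _
    ((summandLeft A₁ A₂).matExp_dilation φ₁) ((summandRight A₁ A₂).matExp_dilation φ₂) (ofA x)
  rw [← Expectation.ext_ofA, ← Expectation.ext_ofA, ← e P, ← e Q, key]

end Independence

end CondProb

/-! ### Null elements and the invariant `alpha`. -/

namespace CondProb

open scoped RightActions

open Uni

open scoped ComplexOrder

/-! ### Null elements -/

namespace Expectation

variable {A : BAlg Scalars.{u}} (φ : Expectation A)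

/-- The elements of the left kernel of the inner product `φ (y* x)`. -/
def IsNull (x : Uni A) : Prop := ∀ y, φ.ext (y * x) = 0

variable {φ}

/-- The Cauchy–Schwarz argument: if `φ(x* x)` is a vanishing sum of `c* c` with complex `c`, every
vector of `x` in the Gram decomposition is zero, hence so is its inner product with any other
element. -/
theorem isNull_iff {x : Uni A} : φ.IsNull x ↔ φ.ext (star x * x) = 0 := by
  refine ⟨fun h => h _, fun h y => ?_⟩
  obtain ⟨m, c, hc⟩ := φ.ext_positive 2 ![x, star y]
  have h₀ := hc 0 0
  have h₁ := hc 1 0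
  simp only [Matrix.cons_val_zero, Matrix.cons_val_one, star_star] at h₀ h₁
  rw [h] at h₀
  have hz : ∀ k, c k 0 = 0 := by
    have e : ∑ k, star (c k 0).down * (c k 0).down = 0 := by
      have := congrArg (ULift.ringEquiv (R := ℂ)) h₀.symm
      rwa [map_sum, _root_.map_zero] at this
    have e' := (Finset.sum_eq_zero_iff_of_nonneg fun k _ => star_mul_self_nonneg (c k 0).down).1 e
    intro k
    have := e' k (Finset.mem_univ k)
    rw [mul_eq_zero, star_eq_zero, or_self] at this
    exact ULift.ext _ _ this
  rw [h₁]
  exact Finset.sum_eq_zero fun k _ => by rw [hz, mul_zero]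

namespace IsNull

variable {x y : Uni A}

theorem zero : φ.IsNull 0 := fun y => by rw [mul_zero, φ.ext_zero]

theorem add (hx : φ.IsNull x) (hy : φ.IsNull y) : φ.IsNull (x + y) := fun u => by
  rw [mul_add, φ.ext_add, hx, hy, add_zero]

theorem mul_left (hx : φ.IsNull x) (y : Uni A) : φ.IsNull (y * x) := fun u => by
  rw [← mul_assoc, hx]

theorem ext_star_mul (hx : φ.IsNull x) (y : Uni A) : φ.ext (star x * y) = 0 := by
  have := hx (star y)
  rw [← star_star y, ← star_mul, φ.ext_star, this, star_zero]

/-- Elements that agree with `1` up to a null element may be omitted on the right. -/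
theorem ext_mul (h : φ.IsNull (1 - x)) (u : Uni A) : φ.ext (u * x) = φ.ext u := by
  have := h u
  rwa [mul_sub, mul_one, φ.ext_sub, sub_eq_zero, eq_comm] at this

/-- Hermitian elements that agree with `1` up to a null element may be omitted on the left. -/
theorem ext_mul' (h : φ.IsNull (1 - x)) (hs : star x = x) (u : Uni A) :
    φ.ext (x * u) = φ.ext u := by
  have := h.ext_star_mul u
  rwa [star_sub, star_one, hs, sub_mul, one_mul, φ.ext_sub, sub_eq_zero, eq_comm] at this

end IsNull

theorem isNull_one_sub {x : Uni A} (hs : star x = x) (hx : x * x = x) (h : φ.ext x = 1) :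
    φ.IsNull (1 - x) := by
  rw [isNull_iff, star_sub, star_one, hs, mul_sub, sub_mul, sub_mul, one_mul, one_mul, mul_one, hx,
    sub_self, sub_zero, φ.ext_sub, φ.ext_one, h, sub_self]

end Expectation

/-! ### Projections in algebras over the scalars -/

section Projections

variable {B : Type u} [Ring B] [StarRing B] [Algebra ℂ B]

variable (B) in
/-- The unit of `B`, as an element of the algebra `B` over itself. -/
def selfOne : selfAlg B := (1 : B)

theorem smul_selfOne (b : selfAlg B) : (show B from b) • selfOne B = b := mul_one (show B from b)

theorem star_selfOne : star (selfOne B) = selfOne B := star_one B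

theorem selfOne_mul : selfOne B * selfOne B = selfOne B := mul_one (1 : B)

theorem unit_star (i j : Fin 2) : star (unit i j : matAlg B) = unit j i := ent_ext fun k l => by
  rw [ent_star, ent_unit, ent_unit]
  simp only [and_comm]
  split_ifs <;> simp

theorem unit_mul_unit (i j k : Fin 2) : (unit i j * unit j k : matAlg B) = unit i k :=
  Matrix.single_mul_single_same _ _ _ _ _ |>.trans (by rw [mul_one]; rfl)

theorem mat_eq_sum' (m : matAlg B) : m = unit 0 0 <• ent m 0 0 + unit 0 1 <• ent m 0 1 +
    (unit 1 0 <• ent m 1 0 + unit 1 1 <• ent m 1 1) := by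
  refine ent_ext fun i j => ?_
  fin_cases i <;> fin_cases j <;> simp [ent_unit]

theorem smul_comm_scalars {A : BAlg Scalars.{u}} (z : Scalars.{u}) (a : A) : z • a = a <• z :=
  A.complex_smul z.down a

/-- The homomorphism from the scalars that maps `1` to a given projection. -/
def projHom {A : BAlg Scalars.{u}} (j : A) (hj : j * j = j) (hs : star j = j) :
    Hom (selfAlg Scalars.{u}) A where
  toFun z := (show Scalars from z) • j
  map_add z w := add_smul (show Scalars from z) (show Scalars from w) j
  map_mul z w := by
    show ((show Scalars from z) * (show Scalars from w)) • j = _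
    rw [A.smul_mul, ← A.op_smul_mul, ← smul_comm_scalars, A.smul_mul, hj, mul_smul]
  map_star z := by
    rw [A.star_smul, hs, ← smul_comm_scalars]
    rfl
  map_smul b z := mul_smul b (show Scalars from z) j
  map_op_smul b z := by
    show ((show Scalars from z) * b) • j = ((show Scalars from z) • j) <• b
    rw [← smul_comm_scalars, ← mul_smul, mul_comm]

theorem projHom_selfOne {A : BAlg Scalars.{u}} (j : A) (hj : j * j = j) (hs : star j = j) :
    projHom j hj hs (selfOne Scalars) = j := one_smul Scalars.{u} j

end Projections

namespace Independence

variable (P : Independence.{u})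

/-- The expectation of `E₀₁ 1 E₁₀` in the product of the scalar `2 × 2` matrices and the
scalars. -/
def alpha : Scalars.{u} := (P.prod (matExp Scalars.{u}) (selfExp Scalars.{u})).ext
  (wl _ _ (unit 0 1) * wr _ _ (selfOne _) * wl _ _ (unit 1 0))

theorem isNull_one_sub_selfOne {A : BAlg Scalars.{u}} (φ : Expectation A) :
    (P.prod φ (selfExp Scalars)).IsNull (1 - wr _ _ (selfOne _)) := by
  refine Expectation.isNull_one_sub ?_ ?_ ?_
  · rw [star_wr, star_selfOne]
  · rw [← wr_mul, selfOne_mul]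
  · exact (Expectation.ext_ofA _ _).trans (P.prod_inr φ (selfExp Scalars) (selfOne _))

theorem isNull_one_sub_unit {A : BAlg Scalars.{u}} (ψ : Expectation A) :
    (P.prod (matExp Scalars) ψ).IsNull (1 - wl _ _ (unit 0 0)) := by
  refine Expectation.isNull_one_sub ?_ ?_ ?_
  · rw [star_wl, unit_star]
  · rw [← wl_mul, unit_mul_unit]
  · refine (Expectation.ext_ofA _ _).trans ((P.prod_inl (matExp Scalars) ψ (unit 0 0)).trans ?_)
    simp [ent_unit]

theorem isNull_unit {A : BAlg Scalars.{u}} (ψ : Expectation A) (k : Fin 2) :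
    (P.prod (matExp Scalars) ψ).IsNull (wl _ _ (unit k 1)) := by
  rw [Expectation.isNull_iff, star_wl, unit_star, ← wl_mul, unit_mul_unit]
  refine (Expectation.ext_ofA _ _).trans ((P.prod_inl (matExp Scalars) ψ (unit 1 1)).trans ?_)
  simp [ent_unit]

/-- Everything except `E₀₁ 1 E₁₀` is forced by null elements: `E₀₁` and `E₁₁` are null, while `E₀₀`
and the unit of the scalars may be omitted at either end of a word. -/
theorem sandwich_unit (i j k l : Fin 2) :
    (P.prod (matExp Scalars.{u}) (selfExp Scalars.{u})).ext
      (wl _ _ (unit i j) * wr _ _ (selfOne _) * wl _ _ (unit k l)) =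
      if i = 0 ∧ l = 0 then (if j = 0 ∧ k = 0 then 1 else if j = 1 ∧ k = 1 then P.alpha else 0)
      else 0 := by
  set ψ := P.prod (matExp Scalars.{u}) (selfExp Scalars.{u}) with hψ
  have he := P.isNull_one_sub_selfOne (matExp Scalars.{u})
  have he0 := P.isNull_one_sub_unit (selfExp Scalars.{u})
  have h1 := P.isNull_unit (selfExp Scalars.{u})
  rw [← hψ] at he he0 h1
  have hes : star (wr (matAlg Scalars.{u}) _ (selfOne Scalars.{u})) = wr _ _ (selfOne _) := by
    rw [star_wr, star_selfOne]
  have h00 : star (wl _ (selfAlg Scalars.{u}) (unit 0 0 : matAlg Scalars.{u})) =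
    wl _ _ (unit 0 0) := by rw [star_wl, unit_star]
  have hl : ∀ m : matAlg Scalars.{u}, ψ.ext (wl _ _ m) = ent m 0 0 := fun m =>
    (Expectation.ext_ofA _ _).trans (P.prod_inl _ _ m)
  have h1' : ∀ k y, ψ.ext (wl _ _ (unit 1 k) * y) = 0 := fun k y => by
    have := (h1 k).ext_star_mul y
    rwa [star_wl, unit_star] at this
  fin_cases i
  · fin_cases l
    · fin_cases j
      · fin_cases k
        · simp only [Fin.zero_eta, and_self, if_true]
          rw [he0.ext_mul, he0.ext_mul' h00, hψ]
          exact (Expectation.ext_ofA _ _).trans (P.prod_inr _ _ (selfOne _))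
        · simp only [Fin.zero_eta, Fin.mk_one]
          rw [mul_assoc, he0.ext_mul' h00, he.ext_mul' hes, hl]
          simp [ent_unit]
      · fin_cases k
        · simp only [Fin.zero_eta, Fin.mk_one]
          rw [he0.ext_mul, he.ext_mul, hl]
          simp [ent_unit]
        · simp [alpha, hψ]
    · simp only [Fin.zero_eta, Fin.mk_one]
      rw [h1]
      simp
  · simp only [Fin.mk_one]
    rw [mul_assoc, h1']
    simp

/-- Naturality along the scalars transfers the table for matrix units, and the bimodule property
provides the coefficients. -/
theorem sandwich_mat {B : Type u} [Ring B] [StarRing B] [Algebra ℂ B] [StarModule ℂ B]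
    (m n : matAlg B) : (P.prod (matExp B) (selfExp B)).ext
      (wl _ _ m * wr _ _ (selfOne _) * wl _ _ n) =
      ent m 0 0 * ent n 0 0 + ent m 0 1 * (scalarHom B P.alpha * ent n 1 0) := by
  have key : ∀ i j k l, (P.prod (matExp B) (selfExp B)).ext
      (wl _ _ (unit i j) * wr _ _ (selfOne _) * wl _ _ (unit k l)) = scalarHom B
      (if i = 0 ∧ l = 0 then (if j = 0 ∧ k = 0 then 1 else if j = 1 ∧ k = 1 then P.alpha else 0)
      else 0) := by
    intro i j k l
    have h := P.ext_natural (scalarHom B) (matExp Scalars) (selfExp Scalars) (matExp B) (selfExp B)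
      (matMap _) (selfMap _) (fun _ => rfl) (fun _ => rfl)
      (wl _ _ (unit i j) * wr _ _ (selfOne _) * wl _ _ (unit k l))
    have e : under (scalarHom B) (selfMap _) (selfOne Scalars) = selfOne B := map_one (scalarHom B)
    rw [map_mul (baseMap (scalarHom B) _), map_mul (baseMap (scalarHom B) _), baseMap_wl,
      baseMap_wl, baseMap_wr, matMap_unit, matMap_unit, e, sandwich_unit] at h
    exact h
  have key' : ∀ i j, (P.prod (matExp B) (selfExp B)).ext
      (wl _ _ (unit i j) * wr _ _ (selfOne _) * wl _ _ n) =
      if i = 0 then (if j = 0 then ent n 0 0 else scalarHom B P.alpha * ent n 1 0) else 0 := by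
    intro i j
    conv_lhs => rw [mat_eq_sum' n]
    simp only [wl_add, wl_op_smul, mul_add, Expectation.ext_add]
    simp only [← mul_assoc, Expectation.ext_mul_ofB, key]
    fin_cases i <;> fin_cases j <;> simp
  conv_lhs => rw [mat_eq_sum m]
  simp only [wl_add, wl_smul, add_mul, Expectation.ext_add]
  simp only [mul_assoc, Expectation.ext_ofB_mul]
  simp only [← mul_assoc (wl _ _ (unit _ _)), key']
  simp

/-- In a dilation, the product of the entries `(0, 1)` and `(1, 0)` is the covariance `φ(a a') -
φ(a) φ(a')`; this turns the formula for matrices into one for an arbitrary expectation. -/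
theorem sandwich_dilation {D : Type u} [Ring D] [StarRing D] [Algebra ℂ D] [StarModule ℂ D]
    {A : BAlg Scalars.{u}} (φ : Expectation A) (β : Scalars.{u} →⋆ₐ[ℂ] D)
    (f : Hom A (restrict β (matAlg D))) (hf : ∀ a, matExp D (under β f a) = β (φ a)) (a a' : A) :
    β ((P.prod φ (selfExp Scalars)).ext (wl _ _ a * wr _ _ (selfOne _) * wl _ _ a')) =
      β (φ a * φ a' + P.alpha * (φ (a * a') - φ a * φ a')) := by
  have h := P.ext_natural β φ (selfExp Scalars) (matExp D) (selfExp D) f (selfMap β) hf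
    (fun _ => rfl) (wl _ _ a * wr _ _ (selfOne _) * wl _ _ a')
  have e : under β (selfMap β) (selfOne Scalars) = selfOne _ := map_one β
  have hc : scalarHom D P.alpha = β P.alpha := (AlgHomClass.commutes β P.alpha.down).symm
  rw [map_mul (baseMap β _), map_mul (baseMap β _), baseMap_wl, baseMap_wl, baseMap_wr, e,
    sandwich_mat, ← mul_assoc, ← scalarHom_comm, mul_assoc, hc] at h
  have h00 : ∀ a, ent (under β f a) 0 0 = β (φ a) := hf
  have hm : β (φ (a * a')) = β (φ a) * β (φ a') +
      ent (under β f a) 0 1 * ent (under β f a') 1 0 := by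
    rw [← h00, ← h00, ← h00, ← ent_mul]
    exact congrArg (fun m : matAlg D => ent m 0 0) (f.map_mul a a')
  rw [h00, h00] at h
  rw [← h, map_add β, map_mul β, map_mul β, map_sub β, hm, map_mul β, add_sub_cancel_left]

theorem sandwich_mul {A : BAlg Scalars.{u}} (φ : Expectation A) (a a' : A) :
    (P.prod φ (selfExp Scalars)).ext (wl _ _ a * wr _ _ (selfOne _) * wl _ _ a') =
      φ a * φ a' + P.alpha * (φ (a * a') - φ a * φ a') :=
  toDbl_base_injective (X := A × A) (P.sandwich_dilation φ _ ((summandLeft A A).dilation φ)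
    ((summandLeft A A).matExp_dilation φ) a a')

/-- The product with the scalars is determined by `P.alpha`. -/
theorem sandwich {A : BAlg Scalars.{u}} (φ : Expectation A) (x y : Uni A) :
    (P.prod φ (selfExp Scalars)).ext
      (map (inl _ _) x * wr _ _ (selfOne _) * map (inl _ _) y) =
      φ.ext x * φ.ext y + P.alpha * (φ.ext (x * y) - φ.ext x * φ.ext y) := by
  have he := P.isNull_one_sub_selfOne φ
  have hes : star (wr A _ (selfOne Scalars.{u})) = wr _ _ (selfOne _) := by
    rw [star_wr, star_selfOne]
  have h₁ : ∀ a : A, (P.prod φ (selfExp Scalars)).ext (wl _ _ a) = φ a := fun a =>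
    (Expectation.ext_ofA _ _).trans (P.prod_inl _ _ a)
  rw [map_inl_eq, map_inl_eq, add_mul, add_mul, mul_add, Expectation.ext_add, Expectation.ext_add,
    mul_assoc, mul_assoc, Expectation.ext_ofB_mul, he.ext_mul' hes, Expectation.ext_ofB_mul,
    he.ext_mul' hes, Expectation.ext_ofB, mul_add, Expectation.ext_add, Expectation.ext_mul_ofB,
    he.ext_mul, sandwich_mul, h₁, h₁]
  conv_rhs => rw [eq_add x, eq_add y]
  simp only [add_mul, mul_add, Expectation.ext_add, Expectation.ext_ofB_mul,
    Expectation.ext_mul_ofB, Expectation.ext_ofB, Expectation.ext_ofA, ← ofA_mul]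
  ring

/-- A product with the scalars that is implemented by a projection. -/
theorem ext_eq_of_sandwich {A : BAlg Scalars.{u}} (φ : Expectation A) (j : A) (hj : j * j = j)
    (hs : star j = j) (h : ∀ x y : Uni A, φ.ext x * φ.ext y +
      P.alpha * (φ.ext (x * y) - φ.ext x * φ.ext y) = φ.ext (x * ofA j * y))
    (z : Uni (coprod A (selfAlg Scalars.{u}))) : (P.prod φ (selfExp Scalars)).ext z =
      φ.ext (map (lift (Hom.id A) (projHom j hj hs)) z) := by
  set H := lift (Hom.id A) (projHom j hj hs) with hH
  set ψ := P.prod φ (selfExp Scalars) with hψ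
  have hsand : ∀ x y : Uni A, ψ.ext (map (inl _ _) x * wr _ _ (selfOne _) * map (inl _ _) y) =
    φ.ext (x * ofA j * y) := fun x y => (P.sandwich φ x y).trans (h x y)
  have hl : ∀ x, ψ.ext (map (inl _ _) x) = φ.ext x := P.ext_map_inl φ _
  have hjj : (ofA j * ofA j : Uni A) = ofA j := by rw [← ofA_mul, hj]
  -- Expanding the norm of `1 x - j x` gives four terms, and the sandwich formula makes each of them
  -- equal to the expectation of `x* j x`, so they cancel.
  have base : ∀ x : Uni A, ψ.IsNull
      (wr _ _ (selfOne _) * map (inl _ _) x - map (inl _ _) (ofA j * x)) := by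
    intro x
    have hee : wr A _ (selfOne Scalars.{u}) * wr _ _ (selfOne _) = wr _ _ (selfOne _) := by
      rw [← wr_mul, selfOne_mul]
    have e₁ : ∀ p q r : Uni (coprod A (selfAlg Scalars.{u})),
      star (p * q - r) * (p * q - r) = star q * (star p * p) * q - star q * star p * r -
        (star r * p * q - star r * r) := fun p q r => by
      rw [star_sub, star_mul, sub_mul, mul_sub, mul_sub]
      simp only [mul_assoc]
    rw [Expectation.isNull_iff, e₁, star_wr, star_selfOne, hee, ← Uni.map_star, ← Uni.map_star,
      Expectation.ext_sub, Expectation.ext_sub, Expectation.ext_sub, hsand, hsand, hsand,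
      ← Uni.map_mul, hl, star_mul, star_ofA, hs]
    have e₂ : star x * ofA j * (ofA j * x) = star x * ofA j * x := by
      rw [mul_assoc, ← mul_assoc (ofA j), hjj, ← mul_assoc]
    have e₃ : star x * ofA j * ofA j * x = star x * ofA j * x := by
      rw [mul_assoc (star x), hjj]
    rw [e₂, e₃, sub_self]
  -- Null elements form a left ideal, so letters may be replaced starting from the right; the
  -- additional factor `x` holds what has already been moved into `A`.
  have key : ∀ z x, ψ.IsNull (z * map (inl _ _) x - map (inl _ _) (map H z * x)) := by
    intro z
    refine word_induction (p := fun z => ∀ x, ψ.IsNull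
      (z * map (inl _ _) x - map (inl _ _) (map H z * x))) (fun b x => ?_) (fun a x => ?_)
      (fun c x => ?_) (fun y z hy hz x => ?_) (fun y z hy hz x => ?_) z
    · rw [map_ofB, Uni.map_mul, map_ofB, sub_self]
      exact .zero
    · have : map H (wl _ _ a) = ofA a := rfl
      rw [this, Uni.map_mul, map_ofA, wl, sub_self]
      exact .zero
    · have e₁ : wr A _ c = ofB (show Scalars from c) * wr _ _ (selfOne _) := by
        rw [← wr_smul, smul_selfOne]
      have e₂ : map H (wr _ _ c) = ofB (show Scalars from c) * ofA j := by
        rw [← ofA_smul]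
        rfl
      have := (base x).mul_left (ofB (show Scalars from c))
      rwa [mul_sub, ← mul_assoc, ← e₁, ← map_ofB (inl A (selfAlg Scalars.{u})), ← Uni.map_mul,
        ← mul_assoc, ← e₂] at this
    · have := (hy x).add (hz x)
      rw [Uni.map_add, add_mul, add_mul, Uni.map_add]
      convert this using 1
      abel
    · have := ((hz x).mul_left y).add (hy (map H z * x))
      rw [mul_assoc, Uni.map_mul H, mul_assoc (map H y)]
      convert this using 1
      rw [mul_sub]
      abel
  have := key z 1 1
  rw [one_mul, Uni.map_one, mul_one, mul_one, Expectation.ext_sub, hl, sub_eq_zero] at this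
  exact this

/-- The expectation of `E₀₁ e e' e E₁₀`, with the units `e`, `e'` of two copies of the scalars, is
computed in both bracketings. To the left, the sandwich formula is applied twice and gives the
square; to the right, the copies of the scalars merge and give `alpha`. -/
theorem alpha_mul_self : P.alpha * P.alpha = P.alpha := by
  let M := matAlg Scalars.{u}
  let I := selfAlg Scalars.{u}
  let e : I := selfOne Scalars.{u}
  let ω := matExp Scalars.{u}
  let ι := selfExp Scalars.{u}
  have hn := P.isNull_one_sub_selfOne ω
  have hes : star (wr M I e) = wr M I e := by rw [star_wr, star_selfOne]
  have h₁ := P.sandwich (P.prod ω ι) (wl M I (unit 0 1) * wr M I e) (wr M I e * wl M I (unit 1 0))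
  have v₁ : (P.prod ω ι).ext (wl M I (unit 0 1) * wr M I e) = 0 := by
    rw [hn.ext_mul]
    refine (Expectation.ext_ofA _ _).trans ((P.prod_inl ω ι (unit 0 1)).trans ?_)
    simp [ω, ent_unit]
  have v₂ : (P.prod ω ι).ext (wl M I (unit 0 1) * wr M I e * (wr M I e * wl M I (unit 1 0))) =
      P.alpha := by
    rw [mul_assoc, ← mul_assoc (wr M I e), ← wr_mul, selfOne_mul, ← mul_assoc]
    rfl
  rw [v₁, v₂, zero_mul, zero_add, sub_zero, ext_associative] at h₁
  have hmul : ∀ x y : Uni I, ι.ext (x * y) = ι.ext x * ι.ext y := by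
    intro x y
    have h : ∀ p q r s : Scalars.{u}, p * r + (p * s + q * r + q * s) = (p + q) * (r + s) :=
      fun p q r s => by ring
    exact h x.1 x.2 y.1 y.2
  -- The expectation of the scalars is multiplicative, so its covariance vanishes and the unit
  -- implements the product whatever `alpha` is.
  have hι := P.ext_eq_of_sandwich ι e selfOne_mul star_selfOne fun x y => by
    have : ι.ext (ofA e) = 1 := ι.ext_ofA e
    rw [hmul, hmul, hmul, this]
    ring
  let H := lift (Hom.id I) (projHom e selfOne_mul star_selfOne)
  have hnat := P.ext_natural_fixed ω (P.prod ι ι) ω ι (Hom.id M) H (fun _ => rfl)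
    (fun z => by
      have := hι (ofA z)
      rw [Expectation.ext_ofA, map_ofA, Expectation.ext_ofA] at this
      exact this.symm)
  rw [← hnat] at h₁
  refine h₁.symm.trans ?_
  have e₁ : ∀ x : Uni (coprod M I), map (sumMap (Hom.id M) H) (map (assoc M I I)
      (map (inl (coprod M I) I) x)) = x := by
    intro x
    have : (sumMap (Hom.id M) H).comp ((assoc M I I).comp (inl (coprod M I) I)) = Hom.id _ :=
      coprod_hom_ext (fun _ => rfl) (fun _ => rfl)
    exact congrArg (fun f => map f x) this
  have e₂ : map (sumMap (Hom.id M) H) (map (assoc M I I) (wr (coprod M I) I e)) = wr M I e := by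
    show ofA (inr M I (H (inr I I e))) = ofA (inr M I e)
    rw [lift_inr, projHom_selfOne]
  rw [Uni.map_mul, Uni.map_mul, Uni.map_mul, Uni.map_mul, e₁, e₁, e₂,
    mul_assoc (wl M I _), ← wr_mul, selfOne_mul, ← mul_assoc, mul_assoc (wl M I _), ← wr_mul, selfOne_mul]
  rfl

theorem alpha_eq : P.alpha = 0 ∨ P.alpha = 1 := by
  have h : P.alpha.down * P.alpha.down = P.alpha.down := congrArg ULift.down P.alpha_mul_self
  rcases mul_right_eq_self₀.1 h with h | h
  · exact .inr (ULift.ext _ _ h)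
  · exact .inl (ULift.ext _ _ h)

end Independence

end CondProb

/-! ### Projections implementing the scalars, and the boolean and monotone cases. -/

namespace CondProb

open scoped RightActions

open Uni

section Matrices

/-- The unit matrix. -/
def matOne : matAlg Scalars.{u} := mat 1

theorem ent_matOne (i j : Fin 2) : ent matOne.{u} i j = if i = j then 1 else 0 :=
  Matrix.one_apply

theorem matOne_mul (m : matAlg Scalars.{u}) : matOne * m = m := one_mul (ent m)

theorem mul_matOne (m : matAlg Scalars.{u}) : m * matOne = m := mul_one (ent m)

theorem star_matOne : star matOne.{u} = matOne := star_one (Matrix (Fin 2) (Fin 2) Scalars.{u})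

theorem swap_surj {B : Type u} [Ring B] [StarRing B] [Algebra ℂ B] {A₁ A₂ : BAlg B}
    (x : Uni (coprod A₁ A₂)) : map (swap A₂ A₁) (map (swap A₁ A₂) x) = x :=
  Uni.ext' rfl (swap_swap x.2)

end Matrices

namespace Independence

variable (P : Independence.{u})

/-- The projection that implements the product of the matrices with the scalars. -/
def corner : matAlg Scalars.{u} := mat !![1, 0; 0, P.alpha]

theorem corner_mul_self : P.corner * P.corner = P.corner := ent_ext fun i j => by
  rw [ent_mul]
  fin_cases i <;> fin_cases j <;> simp [corner, P.alpha_mul_self]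

theorem star_corner : star P.corner = P.corner := ent_ext fun i j => by
  have : star P.alpha = P.alpha := by
    rcases P.alpha_eq with h | h <;> rw [h]
    · exact star_zero _
    · exact star_one _
  rw [ent_star]
  fin_cases i <;> fin_cases j <;> simp [corner, this]

theorem corner_eq_matOne (h : P.alpha = 1) : P.corner = matOne := ent_ext fun i j => by
  fin_cases i <;> fin_cases j <;> simp [corner, h, ent_matOne]

theorem corner_eq_unit (h : P.alpha = 0) : P.corner = unit 0 0 := ent_ext fun i j => by
  fin_cases i <;> fin_cases j <;> simp [corner, h, ent_unit]

/-- The retraction of the coproduct of the matrices and the scalars to the matrices. -/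
def retraction : Hom (coprod (matAlg Scalars.{u}) (selfAlg Scalars.{u})) (matAlg Scalars.{u}) :=
  lift (Hom.id _) (projHom P.corner P.corner_mul_self P.star_corner)

theorem retraction_selfOne : P.retraction (inr _ _ (selfOne Scalars)) = P.corner :=
  projHom_selfOne _ P.corner_mul_self P.star_corner

/-- The `(0, 0)`-entry of `m diag(1, α) n` is `m₀₀ n₀₀ + α m₀₁ n₁₀`, exactly the value demanded by
the sandwich formula. -/
theorem matExp_retraction (z : coprod (matAlg Scalars.{u}) (selfAlg Scalars.{u})) :
    matExp Scalars (P.retraction z) = P.prod (matExp Scalars) (selfExp Scalars) z := by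
  have h := P.ext_eq_of_sandwich (matExp Scalars) P.corner P.corner_mul_self P.star_corner
    (fun x y => ?_) (ofA z)
  · rw [Expectation.ext_ofA, map_ofA, Expectation.ext_ofA] at h
    exact h.symm
  · conv_lhs => rw [eq_add x, eq_add y]
    conv_rhs => rw [eq_add x, eq_add y]
    simp only [add_mul, mul_add, Expectation.ext_add, ← ofB_mul, ← ofA_mul, Expectation.ext_ofB_mul,
      Expectation.ext_mul_ofB, Expectation.ext_ofB, Expectation.ext_ofA, mul_assoc]
    simp only [matExp_apply, ent_mul, corner, ent_mat]
    simp
    ring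

theorem matExp_retraction_swap (z : coprod (selfAlg Scalars.{u}) (matAlg Scalars.{u})) :
    matExp Scalars (P.op.retraction (swap _ _ z)) = P.prod (selfExp Scalars) (matExp Scalars) z := by
  rw [matExp_retraction, op_prod, Expectation.comp_apply, swap_swap]

/-- The product of two copies of the scalar matrices. -/
def matProd : Expectation (coprod (matAlg Scalars.{u}) (matAlg Scalars.{u})) :=
  P.prod (matExp Scalars) (matExp Scalars)

theorem matProd_op (x : Uni (coprod (matAlg Scalars.{u}) (matAlg Scalars.{u}))) :
    P.op.matProd.ext x = P.matProd.ext (map (swap _ _) x) := rfl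

/-- The projections associated with `P` and with its opposite agree, placed in the first and
in the second factor, respectively. -/
theorem matProd_corner (x y : Uni (coprod (matAlg Scalars.{u}) (matAlg Scalars.{u}))) :
    P.matProd.ext (x * wl _ _ P.corner * y) = P.matProd.ext (x * wr _ _ P.op.corner * y) := by
  let g : Hom (coprod (matAlg Scalars.{u}) (matAlg Scalars.{u})) (coprod (coprod (matAlg Scalars.{u}) (selfAlg Scalars.{u})) (matAlg Scalars.{u})) := sumMap (inl (matAlg Scalars.{u}) (selfAlg Scalars.{u})) (Hom.id (matAlg Scalars.{u}))
  let e : Uni (coprod (coprod (matAlg Scalars.{u}) (selfAlg Scalars.{u})) (matAlg Scalars.{u})) := wl _ (matAlg Scalars.{u}) (inr (matAlg Scalars.{u}) (selfAlg Scalars.{u}) (selfOne Scalars))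
  let k : Hom (coprod (selfAlg Scalars.{u}) (matAlg Scalars.{u})) (matAlg Scalars.{u}) := P.op.retraction.comp (swap (selfAlg Scalars.{u}) (matAlg Scalars.{u}))
  -- The unit of the middle factor is retracted into the first copy in one bracketing and into the
  -- second copy in the other.
  have h := P.ext_associative (matExp Scalars) (selfExp Scalars) (matExp Scalars)
    (map g x * e * map g y)
  rw [← P.ext_natural_fixed (P.prod (matExp Scalars) (selfExp Scalars)) (matExp Scalars)
    (matExp Scalars) (matExp Scalars) P.retraction (Hom.id (matAlg Scalars.{u})) P.matExp_retraction (fun _ => rfl),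
    ← P.ext_natural_fixed (matExp Scalars) (P.prod (selfExp Scalars) (matExp Scalars))
    (matExp Scalars) (matExp Scalars) (Hom.id (matAlg Scalars.{u})) k (fun _ => rfl) P.matExp_retraction_swap] at h
  have e₁ : (sumMap P.retraction (Hom.id (matAlg Scalars.{u}))).comp g = Hom.id _ :=
    coprod_hom_ext (fun _ => rfl) (fun _ => rfl)
  have e₂ : (sumMap (Hom.id (matAlg Scalars.{u})) k).comp ((assoc (matAlg Scalars.{u}) (selfAlg Scalars.{u}) (matAlg Scalars.{u})).comp g) = Hom.id _ :=
    coprod_hom_ext (fun _ => rfl) (fun _ => rfl)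
  have e₁' : ∀ x, map (sumMap P.retraction (Hom.id (matAlg Scalars.{u}))) (map g x) = x := fun x =>
    congrArg (fun f => map f x) e₁
  have e₂' : ∀ x, map (sumMap (Hom.id (matAlg Scalars.{u})) k) (map (assoc (matAlg Scalars.{u}) (selfAlg Scalars.{u}) (matAlg Scalars.{u})) (map g x)) = x := fun x =>
    congrArg (fun f => map f x) e₂
  have e₃ : map (sumMap P.retraction (Hom.id (matAlg Scalars.{u}))) e = wl (matAlg Scalars.{u}) (matAlg Scalars.{u}) P.corner :=
    congrArg (wl (matAlg Scalars.{u}) (matAlg Scalars.{u})) P.retraction_selfOne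
  have e₄ : map (sumMap (Hom.id (matAlg Scalars.{u})) k) (map (assoc (matAlg Scalars.{u}) (selfAlg Scalars.{u}) (matAlg Scalars.{u})) e) = wr (matAlg Scalars.{u}) (matAlg Scalars.{u}) P.op.corner :=
    congrArg (wr (matAlg Scalars.{u}) (matAlg Scalars.{u})) P.op.retraction_selfOne
  simp only [Uni.map_mul, e₁', e₂', e₃, e₄] at h
  exact h

/-- With a third factor `ℂ`, the sandwich formula for `alpha = 1` lets its unit be omitted; in the
other bracketing this unit is retracted to the unit matrix of the second copy. -/
theorem matProd_wr_matOne (h : P.alpha = 1)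
    (x y : Uni (coprod (matAlg Scalars.{u}) (matAlg Scalars.{u}))) :
    P.matProd.ext (x * wr _ _ matOne * y) = P.matProd.ext (x * y) := by
  have hs := P.sandwich P.matProd x y
  rw [h, one_mul, add_sub_cancel, matProd, ext_associative,
    ← P.ext_natural_fixed (matExp Scalars) (P.prod (matExp Scalars) (selfExp Scalars))
    (matExp Scalars) (matExp Scalars) (Hom.id (matAlg Scalars.{u})) P.retraction (fun _ => rfl) P.matExp_retraction]
    at hs
  have e₁ : (sumMap (Hom.id (matAlg Scalars.{u})) P.retraction).comp ((assoc (matAlg Scalars.{u}) (matAlg Scalars.{u}) (selfAlg Scalars.{u})).comp (inl (coprod (matAlg Scalars.{u}) (matAlg Scalars.{u})) (selfAlg Scalars.{u}))) =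
    Hom.id _ := coprod_hom_ext (fun _ => rfl) (fun _ => rfl)
  have e₁' : ∀ x, map (sumMap (Hom.id (matAlg Scalars.{u})) P.retraction) (map (assoc (matAlg Scalars.{u}) (matAlg Scalars.{u}) (selfAlg Scalars.{u})) (map (inl _ (selfAlg Scalars.{u})) x)) = x :=
    fun x => congrArg (fun f => map f x) e₁
  have e₂ : map (sumMap (Hom.id (matAlg Scalars.{u})) P.retraction) (map (assoc (matAlg Scalars.{u}) (matAlg Scalars.{u}) (selfAlg Scalars.{u})) (wr _ (selfAlg Scalars.{u}) (selfOne Scalars))) =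
    wr (matAlg Scalars.{u}) (matAlg Scalars.{u}) P.corner := congrArg (wr (matAlg Scalars.{u}) (matAlg Scalars.{u})) P.retraction_selfOne
  rw [← P.corner_eq_matOne h]
  simp only [Uni.map_mul, e₁', e₂] at hs
  exact hs

theorem matProd_wl_matOne (h : P.op.alpha = 1)
    (x y : Uni (coprod (matAlg Scalars.{u}) (matAlg Scalars.{u}))) :
    P.matProd.ext (x * wl _ _ matOne * y) = P.matProd.ext (x * y) := by
  have := P.op.matProd_wr_matOne h (map (swap _ _) x) (map (swap _ _) y)
  rw [matProd_op, matProd_op, Uni.map_mul, Uni.map_mul, Uni.map_mul, swap_surj, swap_surj] at this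
  exact this

/-! ### The boolean case -/

/-- The unit matrix of the second copy is the image of the scalar unit, so for `alpha = 0` it
separates expectations. Hence its product with a centred element `x` has norm zero, and a matrix `c`
of the second copy in front of it can be written as `c 1`. -/
theorem matProd_bool_left (h : P.alpha = 0)
    (u : Uni (coprod (matAlg Scalars.{u}) (matAlg Scalars.{u}))) (c a : matAlg Scalars.{u}) :
    P.matProd.ext (u * (wr _ _ c * wl _ _ a - wr _ _ c * ofB (matExp Scalars a))) = 0 := by
  have hs : ∀ x y : Uni (matAlg Scalars.{u}), P.matProd.ext (map (inl _ _) x * wr _ _ matOne *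
      map (inl _ _) y) = (matExp Scalars).ext x * (matExp Scalars).ext y := by
    intro x y
    have h₁ := P.sandwich (matExp Scalars) x y
    have hι : ∀ z, matExp Scalars.{u} (projHom matOne (matOne_mul _) star_matOne z) =
      selfExp Scalars z := fun z => mul_one (show Scalars.{u} from z)
    rw [h, zero_mul, add_zero, ← P.ext_natural_fixed (matExp Scalars) (selfExp Scalars)
      (matExp Scalars) (matExp Scalars) (Hom.id _) (projHom matOne (matOne_mul _) star_matOne)
      (fun _ => rfl) hι] at h₁
    rw [← h₁, Uni.map_mul, Uni.map_mul]
    have e : map (sumMap (Hom.id (matAlg Scalars.{u})) (projHom matOne (matOne_mul _) star_matOne))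
      (wr _ _ (selfOne Scalars)) = wr _ _ matOne := congrArg (wr _ _) (projHom_selfOne ..)
    rw [e]
    rfl
  let x : Uni (matAlg Scalars.{u}) := ofA a - ofB (matExp Scalars a)
  have hx : (matExp Scalars).ext x = 0 := by
    rw [Expectation.ext_sub, Expectation.ext_ofA, Expectation.ext_ofB, sub_self]
  have hn : P.matProd.IsNull (wr _ _ matOne * map (inl _ _) x) := by
    rw [Expectation.isNull_iff, star_mul, star_wr, star_matOne, ← Uni.map_star, mul_assoc,
      ← mul_assoc (wr _ _ _), ← wr_mul, matOne_mul, ← mul_assoc, hs, hx, mul_zero]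
  have := hn (u * wr _ _ c)
  rw [mul_assoc, ← mul_assoc (wr _ _ _), ← wr_mul, mul_matOne, Uni.map_sub, map_ofB, mul_sub] at this
  exact this

theorem eq_boolean (h : P.alpha = 0) (h' : P.op.alpha = 0) : P = boolean := by
  refine eq_of_matExp fun x => ?_
  have k : IsBoolKernel (matExp Scalars) (matExp Scalars) P.matProd.extHom := by
    refine ⟨P.matProd_bool_left h, fun u a c => ?_⟩
    have := P.op.matProd_bool_left h' (map (swap _ _) u) a c
    rw [matProd_op, Uni.map_mul, swap_surj, Uni.map_sub, Uni.map_mul, Uni.map_mul, map_ofB] at this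
    exact this
  exact k.ext (boolProd_kernel _ _)
    (fun b => (Expectation.ext_ofB _ b).trans (Expectation.ext_ofB _ b).symm)
    (fun a => (P.ext_map_inl _ _ (ofA a)).trans (boolean.ext_map_inl _ _ (ofA a)).symm)
    (fun a => (P.ext_map_inr _ _ (ofA a)).trans (boolean.ext_map_inr _ _ (ofA a)).symm) x

/-! ### The monotone case -/

theorem unit_mul_mul_unit (x : Uni (matAlg Scalars.{u})) :
    ofA (unit 0 0) * x * ofA (unit 0 0) = ofB ((matExp Scalars).ext x) * ofA (unit 0 0) := by
  have hu : (ofA (unit 0 0) * ofA (unit 0 0) : Uni (matAlg Scalars.{u})) = ofA (unit 0 0) := by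
    rw [← ofA_mul, unit_mul_unit]
  have hm : ∀ m : matAlg Scalars.{u}, unit 0 0 * m * unit 0 0 = ent m 0 0 • unit 0 0 := fun m =>
    ent_ext fun i j => by
      fin_cases i <;> fin_cases j <;> simp [ent_unit]
  conv_lhs => rw [eq_add x]
  rw [mul_add, add_mul, ← ofB_comm, mul_assoc, hu, ← ofA_mul, ← ofA_mul, hm, ofA_smul, ← add_mul,
    ← ofB_add]
  rfl

/-- The unit of the second copy acts as `E₀₀` of the first. Writing `c = c 1` and `w = 1 w`
therefore encloses `x` in `E₀₀ x E₀₀`, which is its expectation times `E₀₀`. -/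
theorem eq_monotone (h : P.alpha = 0) (h' : P.op.alpha = 1) : P = monotone := by
  let ω := matExp Scalars.{u}
  have hc : ∀ x y, P.matProd.ext (x * wr (matAlg Scalars.{u}) (matAlg Scalars.{u}) matOne * y) =
      P.matProd.ext (x * wl (matAlg Scalars.{u}) (matAlg Scalars.{u}) (unit 0 0) * y) := fun x y => by
    have := P.matProd_corner x y
    rw [P.corner_eq_unit h, P.op.corner_eq_matOne h'] at this
    exact this.symm
  have hn : P.matProd.IsNull (1 - wl (matAlg Scalars.{u}) (matAlg Scalars.{u}) (unit 0 0)) := P.isNull_one_sub_unit ω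
  have hs : star (wl (matAlg Scalars.{u}) (matAlg Scalars.{u}) (unit 0 0)) = wl (matAlg Scalars.{u}) (matAlg Scalars.{u}) (unit 0 0) := by rw [star_wl, unit_star]
  have hp : ∀ x : Uni (matAlg Scalars.{u}), wl (matAlg Scalars.{u}) (matAlg Scalars.{u}) (unit 0 0) * map (inl (matAlg Scalars.{u}) (matAlg Scalars.{u})) x * wl (matAlg Scalars.{u}) (matAlg Scalars.{u}) (unit 0 0) =
      ofB (ω.ext x) * wl (matAlg Scalars.{u}) (matAlg Scalars.{u}) (unit 0 0) := fun x => by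
    have := congrArg (map (inl (matAlg Scalars.{u}) (matAlg Scalars.{u}))) (unit_mul_mul_unit x)
    rw [Uni.map_mul, Uni.map_mul, Uni.map_mul, map_ofB] at this
    exact this
  have hz : ∀ x : Uni (matAlg Scalars.{u}), ω.ext (x - ofB (ω.ext x)) = 0 := fun x => by
    rw [ω.ext_sub, ω.ext_ofB, sub_self]
  have hcr : ∀ m, wr (matAlg Scalars.{u}) (matAlg Scalars.{u}) m = wr (matAlg Scalars.{u}) (matAlg Scalars.{u}) m * wr (matAlg Scalars.{u}) (matAlg Scalars.{u}) matOne := fun m => by rw [← wr_mul, mul_matOne]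
  have hcl : ∀ m, wr (matAlg Scalars.{u}) (matAlg Scalars.{u}) m = wr (matAlg Scalars.{u}) (matAlg Scalars.{u}) matOne * wr (matAlg Scalars.{u}) (matAlg Scalars.{u}) m := fun m => by rw [← wr_mul, matOne_mul]
  have k : IsMonoKernel ω P.matProd.extHom := by
    intro u c x w
    show P.matProd.ext _ = 0
    have e : ∀ v, P.matProd.ext (u * (wr (matAlg Scalars.{u}) (matAlg Scalars.{u}) c * map (inl (matAlg Scalars.{u}) (matAlg Scalars.{u})) (x - ofB (ω.ext x)) * v)) =
        P.matProd.ext (u * wr (matAlg Scalars.{u}) (matAlg Scalars.{u}) c * (wl (matAlg Scalars.{u}) (matAlg Scalars.{u}) (unit 0 0) * map (inl (matAlg Scalars.{u}) (matAlg Scalars.{u})) (x - ofB (ω.ext x))) * v) := by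
      intro v
      have := hc (u * wr (matAlg Scalars.{u}) (matAlg Scalars.{u}) c) (map (inl (matAlg Scalars.{u}) (matAlg Scalars.{u})) (x - ofB (ω.ext x)) * v)
      rw [mul_assoc u, ← hcr] at this
      simp only [mul_assoc] at this ⊢
      exact this
    have e₁ := e 1
    -- The part of `w` in the second copy provides the right-hand `E₀₀`. For the part in the base,
    -- `e₁` has used that `1 - E₀₀` is null at the right end.
    have e₂ := e (wr (matAlg Scalars.{u}) (matAlg Scalars.{u}) w.2)
    rw [hcl w.2, ← mul_assoc (u * _ * _), hc, mul_assoc (u * _), hp, hz, ofB_zero, zero_mul, mul_zero,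
      zero_mul, Expectation.ext_zero, ← hcl] at e₂
    rw [mul_one, mul_one, ← hn.ext_mul (u * wr _ _ c * _), mul_assoc (u * _), hp, hz, ofB_zero, zero_mul,
      mul_zero, Expectation.ext_zero] at e₁
    rw [map_inr_eq, mul_add, mul_add, Expectation.ext_add, e₂, ← mul_assoc u, Expectation.ext_mul_ofB,
      e₁, zero_mul, zero_add]
  refine eq_of_matExp fun x => k.ext (L' := monotone.matProd.extHom) ?_ ?_ x
  · have e : monotone.matProd.extHom = monoFun ω ω := AddMonoidHom.ext (monoProd_ext ω ω)
    rw [e]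
    exact monoFun_kernel ω ω
  · intro x y
    show P.matProd.ext _ = (monoProd ω ω).ext _
    rw [monoProd_ext, monoFun_apply, monoEv_inl_mul_inr, Expectation.ext_ofB_mul, map_inr_eq, mul_add,
      Expectation.ext_add, Expectation.ext_mul_ofB, matProd, ext_map_inl, ← matProd, hcl, ← mul_assoc,
      hc, mul_assoc, ← hn.ext_mul' hs, ← mul_assoc, ← mul_assoc, hp, mul_assoc,
      Expectation.ext_ofB_mul, hn.ext_mul' hs]
    have : P.matProd.ext (wr (matAlg Scalars.{u}) (matAlg Scalars.{u}) y.2) = ω y.2 :=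
      (P.ext_map_inr ω ω (ofA y.2)).trans (ω.ext_ofA _)
    rw [this, ← mul_add]
    rfl

end Independence

end CondProb

/-! ### Gauge transformations by Toeplitz isometries and the free case. -/

namespace CondProb

open scoped RightActions

open Uni

/-! ### Gauge transformations -/

section Gauge

variable {T : Type u} [Ring T] [StarRing T] [Algebra ℂ T] [StarModule ℂ T]

/-- The matrices over the scalars, conjugated by the diagonal matrix with the entries `1` and `s`,
where `s` is an isometry. -/
def gauge (s : T) (hs : star s * s = 1) :
    Hom (matAlg Scalars.{u}) (restrict (scalarHom T) (matAlg T)) where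
  toFun m := mat fun i j => ![1, s] i * scalarHom T (ent m i j) * star (![1, s] j)
  map_add m n := ent_ext fun i j => by
    show ![1, s] i * scalarHom T (ent (m + n) i j) * star (![1, s] j) =
      ![1, s] i * scalarHom T (ent m i j) * star (![1, s] j) +
        ![1, s] i * scalarHom T (ent n i j) * star (![1, s] j)
    rw [ent_add, map_add, mul_add, add_mul]
  map_mul m n := ent_ext fun i j => by
    refine Eq.trans ?_ (ent_mul (B := T) _ _ i j).symm
    show ![1, s] i * scalarHom T (ent (m * n) i j) * star (![1, s] j) =
      ![1, s] i * scalarHom T (ent m i 0) * star 1 *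
        (1 * scalarHom T (ent n 0 j) * star (![1, s] j)) +
      ![1, s] i * scalarHom T (ent m i 1) * star s *
        (s * scalarHom T (ent n 1 j) * star (![1, s] j))
    -- Only `star s * s = 1` is needed in the middle, so a non-unitary isometry will do.
    have e : ∀ p q r t : T, p * q * star s * (s * r * t) = p * (q * r) * t := fun p q r t => by
      rw [mul_assoc (p * q), ← mul_assoc (star s), ← mul_assoc (star s), hs, one_mul]
      simp only [mul_assoc]
    rw [e, ent_mul, map_add, map_mul, map_mul, star_one, mul_one, one_mul, mul_add, add_mul]
    simp only [mul_assoc]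
  map_star m := ent_ext fun i j => by
    show ![1, s] i * scalarHom T (star (ent m j i)) * star (![1, s] j) =
      star (![1, s] j * scalarHom T (ent m j i) * star (![1, s] i))
    rw [map_star, star_mul, star_mul, star_star, mul_assoc]
  map_smul b m := ent_ext fun i j => by
    show ![1, s] i * scalarHom T (b * ent m i j) * star (![1, s] j) =
      scalarHom T b * (![1, s] i * scalarHom T (ent m i j) * star (![1, s] j))
    rw [map_mul, ← mul_assoc, ← scalarHom_comm b]
    simp only [mul_assoc]
  map_op_smul b m := ent_ext fun i j => by
    show ![1, s] i * scalarHom T (ent m i j * b) * star (![1, s] j) =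
      ![1, s] i * scalarHom T (ent m i j) * star (![1, s] j) * scalarHom T b
    rw [mul_comm, map_mul, ← mul_assoc, ← scalarHom_comm b, ← scalarHom_comm b (_ * _)]
    simp only [mul_assoc]

variable {s : T} (hs : star s * s = 1)

theorem ent_gauge (m : matAlg Scalars.{u}) (i j : Fin 2) :
    ent (under (scalarHom T) (gauge s hs) m) i j =
      ![1, s] i * scalarHom T (ent m i j) * star (![1, s] j) := rfl

theorem matExp_gauge (m : matAlg Scalars.{u}) :
    matExp T (under (scalarHom T) (gauge s hs) m) = scalarHom T (matExp Scalars m) := by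
  rw [matExp_apply, ent_gauge]
  simp

theorem gauge_unit (i j : Fin 2) : under (scalarHom T) (gauge s hs) (unit i j) =
    (![1, s] i * star (![1, s] j)) • unit i j := ent_ext fun k l => by
  rw [ent_gauge, ent_smul, ent_unit, ent_unit]
  split_ifs with h
  · rw [h.1, h.2, _root_.map_one, mul_one, mul_one]
  · rw [_root_.map_zero, mul_zero, zero_mul, mul_zero]

/-- A matrix in the copy with the given label; `true` stands for the first one. -/
def copy (B : Type u) [Ring B] [StarRing B] [Algebra ℂ B] (b : Bool) (m : matAlg B) :
    Uni (coprod (matAlg B) (matAlg B)) :=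
  bif b then wl _ _ m else wr _ _ m

theorem copy_add (b : Bool) (m n : matAlg Scalars.{u}) :
    copy Scalars b (m + n) = copy Scalars b m + copy Scalars b n := by
  cases b
  · exact wr_add m n
  · exact wl_add m n

theorem copy_smul (b : Bool) (z : Scalars.{u}) (m : matAlg Scalars.{u}) :
    copy Scalars b (z • m) = ofB z * copy Scalars b m := by
  cases b
  · exact wr_smul z m
  · exact wl_smul z m

variable {t : Bool → T} (ht : ∀ b, star (t b) * t b = 1)

/-- The gauge transformation of two copies of the scalar matrices. -/
def gaugePair : Uni (coprod (matAlg Scalars.{u}) (matAlg Scalars.{u})) →+*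
    Uni (coprod (matAlg T) (matAlg T)) :=
  baseMap (scalarHom T) (coprodMap (scalarHom T) (gauge (t true) (ht true))
    (gauge (t false) (ht false)))

theorem ext_gaugePair (P : Independence.{u})
    (z : Uni (coprod (matAlg Scalars.{u}) (matAlg Scalars.{u}))) :
    (P.prod (matExp T) (matExp T)).ext (gaugePair ht z) = scalarHom T (P.matProd.ext z) :=
  P.ext_natural (scalarHom T) _ _ _ _ _ _ (matExp_gauge _) (matExp_gauge _) z

/-- A matrix unit only acquires a weight: `1`, `s*`, `s` or `s s*` for the isometry `s` of its copy.
-/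
theorem gaugePair_copy (b : Bool) (i j : Fin 2) : gaugePair ht (copy Scalars b (unit i j)) =
    ofB (![1, t b] i * star (![1, t b] j)) *
      Independence.scalarMat T (copy Scalars b (unit i j)) := by
  cases b
  · refine (baseMap_wr _ _ _ _).trans ?_
    rw [gauge_unit, wr_smul, ← matMap_unit (scalarHom T), ← Independence.scalarMat_wr]
    rfl
  · refine (baseMap_wl _ _ _ _).trans ?_
    rw [gauge_unit, wl_smul, ← matMap_unit (scalarHom T), ← Independence.scalarMat_wl]
    rfl

end Gauge

/-! ### The Toeplitz algebra on two generators -/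

section Toeplitz

/-- The functions on words in two letters. -/
abbrev WordFun : Type u := ULift.{u} (List Bool) → ℂ

/-- The creation operator. -/
def create (b : Bool) : Module.End ℂ WordFun.{u} where
  toFun f w := match w.down with
    | [] => 0
    | c :: v => if c = b then f ⟨v⟩ else 0
  map_add' _ _ := funext fun w => by
    rcases w with ⟨_ | ⟨c, v⟩⟩
    · simp
    · by_cases h : c = b <;> simp [h]
  map_smul' _ _ := funext fun w => by
    rcases w with ⟨_ | ⟨c, v⟩⟩
    · simp
    · by_cases h : c = b <;> simp [h]

/-- The annihilation operator. -/
def annihilate (b : Bool) : Module.End ℂ WordFun.{u} where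
  toFun f w := f ⟨b :: w.down⟩
  map_add' _ _ := rfl
  map_smul' _ _ := rfl

@[simp] theorem create_nil (b : Bool) (f : WordFun.{u}) : create b f ⟨[]⟩ = 0 := rfl

@[simp] theorem create_cons (b c : Bool) (f : WordFun.{u}) (v : List Bool) :
    create b f ⟨c :: v⟩ = if c = b then f ⟨v⟩ else 0 := rfl

@[simp] theorem annihilate_apply (b : Bool) (f : WordFun.{u}) (w : ULift.{u} (List Bool)) :
    annihilate b f w = f ⟨b :: w.down⟩ := rfl

theorem annihilate_mul_create (b : Bool) : annihilate.{u} b * create b = 1 :=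
  LinearMap.ext fun _ => funext fun _ => if_pos rfl

/-- The double of the operators on words. -/
abbrev Toeplitz : Type u := Dbl (Module.End ℂ WordFun.{u})

/-- The isometry that creates a letter. -/
def letter (b : Bool) : Toeplitz.{u} := Dbl.mk (create b) (annihilate b)

theorem star_letter_mul (b : Bool) : star (letter.{u} b) * letter b = 1 :=
  Dbl.ext' (annihilate_mul_create b) (annihilate_mul_create b)

/-- The empty word. -/
def emptyWord : WordFun.{u} := fun w => if w.down = [] then 1 else 0

/-- The words that occur in `τ` do not begin with the letter `b`. -/
def AvoidsLetter (b : Bool) (τ : Toeplitz.{u}) : Prop := ∀ w, τ.1 emptyWord ⟨b :: w⟩ = 0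

/-- The words that occur in `τ` begin with the letter `b`. -/
def BeginsWith (b : Bool) (τ : Toeplitz.{u}) : Prop :=
  ∀ w, w.head? ≠ some b → τ.1 emptyWord ⟨w⟩ = 0

theorem avoidsLetter_one (b : Bool) : AvoidsLetter.{u} b 1 := fun w => by
  show (if b :: w = [] then (1 : ℂ) else 0) = 0
  exact if_neg (List.cons_ne_nil b w)

theorem BeginsWith.avoidsLetter {b c : Bool} (h : b ≠ c) {τ : Toeplitz.{u}}
    (hτ : BeginsWith b τ) : AvoidsLetter c τ := fun w => hτ _ (by simpa using h.symm)

/-- The annihilator of `b` kills words that do not begin with `b`, so the weights `s*` and `s s*`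
give zero, while `s` creates the letter `b`. -/
theorem AvoidsLetter.beginsWith {b : Bool} {τ : Toeplitz.{u}} (hτ : AvoidsLetter b τ)
    {i j : Fin 2} (hij : ¬(i = 0 ∧ j = 0)) :
    BeginsWith b (![1, letter b] i * star (![1, letter b] j) * τ) := by
  have ha : annihilate b (τ.1 emptyWord) = 0 := funext fun w => hτ w.down
  intro w hw
  have hc : ∀ f : WordFun.{u}, create b f ⟨w⟩ = 0 := fun f => by
    cases w with
    | nil => rfl
    | cons c v =>
      rw [create_cons, if_neg]
      simpa using hw
  fin_cases i <;> fin_cases j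
  · exact absurd ⟨rfl, rfl⟩ hij
  · show (1 * annihilate b * τ.1) emptyWord ⟨w⟩ = 0
    rw [one_mul, Module.End.mul_apply, ha]
    rfl
  · exact hc _
  · exact hc _

end Toeplitz

namespace Independence

variable (P : Independence.{u})

/-- The elements that are multiplied by an operator satisfying `p` under the gauge
transformation. -/
def weightSpace (p : Toeplitz.{u} → Prop) :
    AddSubgroup (Uni (coprod (matAlg Scalars.{u}) (matAlg Scalars.{u}))) :=
  AddSubgroup.closure {z | ∃ τ, p τ ∧
    gaugePair star_letter_mul z = ofB τ * scalarMat Toeplitz.{u} z}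

/-- The gauge transformation preserves the expectation but multiplies `z` by `τ`, so `Φ(z) 1 = τ
Φ(z)`. On the vacuum, `τ` has no coefficient at the empty word, while `1` has coefficient `1` there.
-/
theorem matProd_weightSpace {b : Bool}
    {z : Uni (coprod (matAlg Scalars.{u}) (matAlg Scalars.{u}))}
    (hz : z ∈ weightSpace (BeginsWith b)) : P.matProd.ext z = 0 := by
  suffices weightSpace (BeginsWith b) ≤ P.matProd.extHom.ker from this hz
  refine (AddSubgroup.closure_le _).2 ?_
  rintro z ⟨τ, hτ, e⟩
  have h := congrArg (fun x => (P.prod (matExp Toeplitz.{u}) (matExp Toeplitz.{u})).ext x) e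
  beta_reduce at h
  rw [ext_gaugePair, Expectation.ext_ofB_mul, ext_scalarMat] at h
  have h' := congrArg (fun x : Toeplitz.{u} => x.1 emptyWord ⟨[]⟩) h
  beta_reduce at h'
  rw [← scalarHom_comm] at h'
  have e₁ : ∀ τ : Toeplitz.{u}, (scalarHom Toeplitz (P.matProd.ext z) * τ).1 emptyWord ⟨[]⟩ =
    (P.matProd.ext z).down * τ.1 emptyWord ⟨[]⟩ := fun _ => rfl
  have e₂ := e₁ 1
  have e₃ := e₁ τ
  rw [mul_one] at e₂
  rw [e₂] at h'
  refine ULift.ext _ _ ?_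
  have h₁ : (1 : Toeplitz.{u}).1 emptyWord ⟨[]⟩ = 1 := rfl
  rw [h₁, mul_one] at h'
  refine h'.trans (e₃.trans ?_)
  rw [hτ [] (by simp), mul_zero]
  rfl

/-- Images of scalar matrices commute with the base, so the weight of a product is the product of
the weights. -/
theorem copy_unit_mul_mem {b : Bool} {i j : Fin 2} (hij : ¬(i = 0 ∧ j = 0))
    {z : Uni (coprod (matAlg Scalars.{u}) (matAlg Scalars.{u}))}
    (hz : z ∈ weightSpace (AvoidsLetter b)) (c : Scalars.{u}) :
    ofB c * copy Scalars b (unit i j) * z ∈ weightSpace (BeginsWith b) := by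
  suffices weightSpace (AvoidsLetter b) ≤ (weightSpace (BeginsWith b)).comap
    (AddMonoidHom.mulLeft (ofB c * copy Scalars b (unit i j))) from this hz
  refine (AddSubgroup.closure_le _).2 ?_
  rintro z ⟨τ, hτ, e⟩
  refine AddSubgroup.subset_closure ⟨_, hτ.beginsWith hij, ?_⟩
  show gaugePair star_letter_mul (_ * _ * z) = ofB _ * scalarMat Toeplitz.{u} (_ * _ * z)
  have e₀ : gaugePair star_letter_mul.{u} (ofB c) = ofB (scalarHom Toeplitz.{u} c) :=
    baseMap_ofB _ _ _
  rw [map_mul (gaugePair _), map_mul (gaugePair _), map_mul (scalarMat _), map_mul (scalarMat _),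
    gaugePair_copy, e, e₀, scalarMat_ofB]
  generalize ![1, letter b] i * star (![1, letter b] j) = σ
  rw [← mul_assoc, mul_assoc _ _ (ofB τ), mul_assoc _ _ (ofB τ), scalarMat_comm, ← mul_assoc (ofB σ),
    ← ofB_mul, ← mul_assoc, ofB_scalarHom_comm]
  simp only [mul_assoc]

theorem copy_mul_mem {b : Bool} {m : matAlg Scalars.{u}} (hm : ent m 0 0 = 0)
    {z : Uni (coprod (matAlg Scalars.{u}) (matAlg Scalars.{u}))}
    (hz : z ∈ weightSpace (AvoidsLetter b)) :
    copy Scalars b m * z ∈ weightSpace (BeginsWith b) := by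
  rw [mat_eq_sum m, hm, zero_smul, zero_add, copy_add, copy_add, copy_smul, copy_smul, copy_smul,
    add_mul, add_mul]
  exact add_mem (copy_unit_mul_mem (by simp) hz _)
    (add_mem (copy_unit_mul_mem (by simp) hz _) (copy_unit_mul_mem (by simp) hz _))

theorem weightSpace_mono {p q : Toeplitz.{u} → Prop} (h : ∀ τ, p τ → q τ) :
    weightSpace p ≤ weightSpace q :=
  AddSubgroup.closure_mono fun _ ⟨τ, hτ, e⟩ => ⟨τ, h τ hτ, e⟩

theorem one_mem_weightSpace (b : Bool) : 1 ∈ weightSpace.{u} (AvoidsLetter b) :=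
  AddSubgroup.subset_closure ⟨1, avoidsLetter_one b, by
    rw [_root_.map_one, _root_.map_one, ofB_one, one_mul]⟩

variable {P}

theorem matProd_copy_matOne (h : P.alpha = 1) (h' : P.op.alpha = 1) (b : Bool)
    (u v : Uni (coprod (matAlg Scalars.{u}) (matAlg Scalars.{u}))) :
    P.matProd.ext (u * copy Scalars b matOne * v) = P.matProd.ext (u * v) := by
  cases b
  · exact P.matProd_wr_matOne h u v
  · exact P.matProd_wl_matOne h' u v

/-- As the unit matrices act as `1`, the component of a centred element in the base may be moved
into the matrix; being centred then says that the `(0, 0)`-entry vanishes. -/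
theorem exists_copy (h : P.alpha = 1) (h' : P.op.alpha = 1) {b : Bool}
    {x : Uni (coprod (matAlg Scalars.{u}) (matAlg Scalars.{u}))}
    (hx : x ∈ centredPair (matExp Scalars) (matExp Scalars) b) : ∃ m, ent m 0 0 = 0 ∧
      ∀ u v, P.matProd.ext (u * x * v) = P.matProd.ext (u * copy Scalars b m * v) := by
  have key : ∀ y : Uni (matAlg Scalars.{u}), (matExp Scalars).ext y = 0 →
      x = ofB y.1 + copy Scalars b y.2 → ∃ m, ent m 0 0 = 0 ∧
      ∀ u v, P.matProd.ext (u * x * v) = P.matProd.ext (u * copy Scalars b m * v) := by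
    rintro y hy rfl
    refine ⟨y.1 • matOne + y.2, ?_, fun u v => ?_⟩
    · rw [ent_add, ent_smul, ent_matOne, if_pos rfl, mul_one]
      exact hy
    · rw [copy_add, copy_smul, mul_add, mul_add, add_mul, add_mul, Expectation.ext_add,
        Expectation.ext_add, ← mul_assoc, matProd_copy_matOne h h']
  cases b
  · obtain ⟨y, hy, rfl⟩ := exists_of_mem_centred hx
    exact key y hy (map_inr_eq y)
  · obtain ⟨y, hy, rfl⟩ := exists_of_mem_centred hx
    exact key y hy (map_inl_eq y)

theorem exists_mem_weightSpace (h : P.alpha = 1) (h' : P.op.alpha = 1) {b : Bool}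
    {z : Uni (coprod (matAlg Scalars.{u}) (matAlg Scalars.{u}))}
    (hz : IsAlt Set.univ (centredPair (matExp Scalars) (matExp Scalars)) b z) :
    ∃ z' ∈ weightSpace.{u} (BeginsWith b), ∀ u, P.matProd.ext (u * z) = P.matProd.ext (u * z') := by
  induction hz with
  | @single b x _ hx =>
    obtain ⟨m, hm, e⟩ := exists_copy h h' hx
    refine ⟨_, copy_mul_mem hm (one_mem_weightSpace b), fun u => ?_⟩
    have := e u 1
    rwa [mul_one, mul_assoc] at this
  | @mul b c x y _ hbc hx _ ih =>
    obtain ⟨m, hm, e⟩ := exists_copy h h' hx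
    obtain ⟨y', hy', e'⟩ := ih
    refine ⟨_, copy_mul_mem hm (weightSpace_mono (fun τ hτ => hτ.avoidsLetter hbc.symm) hy'),
      fun u => ?_⟩
    rw [← mul_assoc, e', e, mul_assoc]

/-- An alternating product of centred elements becomes one of matrices without `(0, 0)`-entry. Since
the copies alternate, each factor meets words that avoid its own letter, and the resulting weight
has no vacuum coefficient. -/
theorem eq_free (h : P.alpha = 1) (h' : P.op.alpha = 1) : P = free := by
  refine eq_of_matExp fun x => ?_
  refine (eq_of_vanish_centredPair (matExp Scalars) (matExp Scalars) (L := P.matProd.extHom)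
    (fun b z hz => ?_) (fun b z hz => freeFun_alt _ _ hz) (fun b => ?_) x).trans
    (freeProd_ext _ _ x).symm
  · obtain ⟨z', hz', e⟩ := exists_mem_weightSpace h h' hz
    have := e 1
    rw [one_mul, one_mul, P.matProd_weightSpace hz'] at this
    exact this
  · rw [freeFun_ofB]
    exact Expectation.ext_ofB _ b

end Independence

end CondProb

/-! ### The values of the invariant and the classification. -/

namespace CondProb

open scoped RightActions

open Uni

namespace Independence

variable {P : Independence.{u}}

theorem IsUnital.op (h : P.IsUnital) : P.op.IsUnital := by
  intro B _ _ _ _ A₁ A₂ φ₁ φ₂ e₁ e₂ he₁ he₂ h₁ h₂ x y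
  have := h φ₂ φ₁ e₂ e₁ he₂ he₁ h₂ h₁ (map (swap A₁ A₂) x) (map (swap A₁ A₂) y)
  rw [ext_op, ext_op, ext_op, Uni.map_mul, Uni.map_mul, Uni.map_mul, Uni.map_mul, Uni.map_mul]
  exact this.symm

/-- Unitality allows the unit between `E₀₁` and `E₁₀` to be dropped, which leaves `E₀₀`. -/
theorem IsUnital.alpha_eq_one (h : P.IsUnital) : P.alpha = 1 := by
  have := (h (matExp Scalars.{u}) (selfExp Scalars.{u}) matOne (selfOne Scalars)
    (fun m => ⟨matOne_mul m, mul_matOne m⟩)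
    (fun z => ⟨one_mul (show Scalars.{u} from z), mul_one (show Scalars.{u} from z)⟩)
    (by simp [ent_matOne]) rfl (wl _ _ (unit 0 1)) (wl _ _ (unit 1 0))).2
  refine this.trans ?_
  rw [← wl_mul, unit_mul_unit]
  refine (P.ext_map_inl _ _ (ofA (unit 0 0))).trans ?_
  simp [ent_unit]

theorem IsUnital.eq_free (h : P.IsUnital) : P = free :=
  Independence.eq_free h.alpha_eq_one (IsUnital.alpha_eq_one (IsUnital.op @h))

theorem boolean_alpha : boolean.{u}.alpha = 0 := by
  refine (boolProd_ext _ _ _).trans ?_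
  have : matExp Scalars.{u} (unit 1 0) = 0 := by simp [ent_unit]
  rw [mul_assoc, boolFun_mul_left, this, ofB_zero, mul_zero, mul_zero, _root_.map_zero]

theorem monotone_alpha : monotone.{u}.alpha = 0 := by
  refine (monoProd_ext _ _ _).trans ?_
  have := monoEv_inl_mul_wr_mul (matExp Scalars.{u}) (ofA (unit 0 1)) (selfOne Scalars)
    (wl _ _ (unit 1 0))
  have h0 : (matExp Scalars.{u}).ext (ofA (unit 0 1)) = 0 := by simp [ent_unit]
  rw [h0, ofB_zero, zero_mul, zero_mul] at this
  exact (congrArg _ this).trans (Expectation.ext_zero _)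

/-- After the exchange the unit of the scalars lies in the first algebra and is replaced by its
expectation `1`, whereas the matrices are multiplied as they stand. -/
theorem monotone_op_alpha : monotone.{u}.op.alpha = 1 := by
  rw [alpha, ext_op]
  refine (monoProd_ext _ _ _).trans ?_
  rw [monoFun_apply, Uni.map_mul, Uni.map_mul, mul_assoc]
  have h₁ := monoEv_inr_mul (selfExp Scalars.{u}) (ofA (unit 0 1))
    (map (inl _ _) (ofA (selfOne Scalars)) * map (inr _ (matAlg Scalars)) (ofA (unit 1 0)))
  have h0 : (selfExp Scalars.{u}).ext (ofA (selfOne Scalars)) = 1 := Expectation.ext_ofA _ _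
  rw [monoEv_inl_mul_inr, h0, ofB_one, one_mul, ← ofA_mul, unit_mul_unit] at h₁
  refine (congrArg _ h₁).trans ?_
  simp [ent_unit]

theorem boolean_not_isUnital : ¬ boolean.{u}.IsUnital := fun h =>
  zero_ne_one (boolean_alpha.symm.trans h.alpha_eq_one)

theorem monotone_op_ne : monotone.{u}.op ≠ monotone := fun h => by
  have := monotone_op_alpha.{u}
  rw [h, monotone_alpha] at this
  exact zero_ne_one this

/-- The classification of the conditional independences. -/
theorem classification (P : Independence.{u}) :
    P = free ∨ P = boolean ∨ P = monotone ∨ P = monotone.op := by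
  rcases P.alpha_eq with h | h <;> rcases P.op.alpha_eq with h' | h'
  · exact .inr (.inl (eq_boolean P h h'))
  · exact .inr (.inr (.inl (eq_monotone P h h')))
  -- The remaining case is the monotone one for the opposite independence.
  · have := eq_monotone P.op h' (by rwa [op_op])
    exact .inr (.inr (.inr (by rw [← this, op_op])))
  · exact .inl (Independence.eq_free h h')

theorem not_isSymmetric_iff (P : Independence.{u}) :
    ¬ P.IsSymmetric ↔ P = monotone ∨ P = monotone.op := by
  constructor
  · intro h
    rcases P.classification with rfl | rfl | h' | h'
    · exact (h free_isSymmetric).elim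
    · exact (h boolean_isSymmetric).elim
    · exact .inl h'
    · exact .inr h'
  · rintro (rfl | rfl) h
    · exact monotone_op_ne (isSymmetric_iff.1 h)
    · have := isSymmetric_iff.1 h
      rw [op_op] at this
      exact monotone_op_ne this.symm

theorem eq_boolean_of_isSymmetric (h : ¬ P.IsUnital) (h' : P.IsSymmetric) : P = boolean := by
  rcases P.classification with rfl | hP | hP
  · exact (h free_isUnital).elim
  · exact hP
  · exact (P.not_isSymmetric_iff.2 hP h').elim

end Independence

end CondProb

open CondProb in
theorem mainTheorem1 :
    -- there is exactly one unital conditional independence: it is free, and symmetric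
    ((∃! P : Independence.{u}, P.IsUnital) ∧
      ∀ P : Independence.{u}, P.IsUnital → P.IsFree ∧ P.IsSymmetric) ∧
    -- there is exactly one non-unital symmetric conditional independence: it is boolean
    ((∃! P : Independence.{u}, ¬ P.IsUnital ∧ P.IsSymmetric) ∧
      ∀ P : Independence.{u}, ¬ P.IsUnital ∧ P.IsSymmetric → P.IsBoolean) ∧
    -- up to the order of the factors, there is exactly one non-symmetric conditional
    -- independence: it is monotone, and non-unital
    ((∃ P P' : Independence.{u}, P.IsMonotone ∧ P'.IsOpposite P ∧
        ∀ Q : Independence.{u}, ¬ Q.IsSymmetric ↔ Q = P ∨ Q = P') ∧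
      ∀ Q : Independence.{u}, ¬ Q.IsSymmetric → ¬ Q.IsUnital) := by
  refine ⟨⟨⟨Independence.free, Independence.free_isUnital, fun P h => h.eq_free⟩, fun P h => ?_⟩,
    ⟨⟨Independence.boolean, ⟨Independence.boolean_not_isUnital, Independence.boolean_isSymmetric⟩,
      fun P h => Independence.eq_boolean_of_isSymmetric h.1 h.2⟩, fun P h => ?_⟩,
    ⟨Independence.monotone, Independence.monotone.op, Independence.monotone_isMonotone,
      Independence.op_isOpposite _, Independence.not_isSymmetric_iff⟩, fun Q h h' => ?_⟩
  · rw [h.eq_free]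
    exact ⟨Independence.free_isFree, Independence.free_isSymmetric⟩
  · rw [Independence.eq_boolean_of_isSymmetric h.1 h.2]
    exact Independence.boolean_isBoolean
  · rw [h'.eq_free] at h
    exact h Independence.free_isSymmetric
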